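/- Let $M$ be a closed orientable $3$-manifold with a Heegaard splitting $M=H^+\cup H^-$ into two genus $g$ handlebodies with common boundary the closed oriented surface $\Sigma$. Let $\Delta^\pm=\{\Delta^\pm_1,\dots,\Delta^\pm_g\}$ be minimal systems of meridional discs of $H^\pm$ (cutting $H^\pm$ along $\Delta^\pm$ gives one ball), and let $M^\pm=\{m_1^\pm,\dots,m_g^\pm\}$ be their boundary curves on $\Sigma$, smooth and arbitrarily oriented, with the curves of $M^+$ transverse to those of $M^-$. So $(\Sigma,M^\pm)$ is a Heegaard diagram of $M$. Its Gauss diagram $G=G(\Sigma,M^\pm)$ consists of the two families of oriented circles $\mu_1^\pm,\dots,\mu_g^\pm$ that parametrize the curves $m_i^\pm$. For each intersection point of $m_i^+$ and $m_j^-$ it has a chord joining its preimages on $\mu_i^+$ and $\mu_j^-$. The sign of the chord is $+1$ if the frame (tangent to $m_i^+$, tangent to $m_j^-$) is positive on $\Sigma$, and $-1$ otherwise. The chords cut the circles into edges. The ribbon graph $\Gamma(G)$ is the oriented surface obtained from annuli with cores $\mu_i^\pm$ by plumbing them at each chord as prescribed by its sign (so it is a neighbourhood of $\bigcup_i m_i^+\cup\bigcup_j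 m_j^-$ in $\Sigma$). Its boundary components, called cycles, are found from $G$ by the right turn rule as follows. Each edge $e$ has two sides, $e_1$ running in the direction of the edge and $e_2$ running against it. At a chord let $a,b$ be the incoming and outgoing edge of the circle of the first family and $c,d$ those of the circle of the second family. Then $(a_1,a_2,b_1,b_2)$ are continued by $(c_2,d_2,c_1,d_1)$ if the chord is positive and by $(d_1,c_1,d_2,c_2)$ if it is negative. The cycles are the resulting classes of sides, together with two cycles for each circle without chords. Let $S(G)$ be the closed surface obtained by gluing a disc to each cycle. For connected $G$ its genus is $g_{S(G)}=1+\tfrac12(|h|-|c|)$, where $|h|$ is the number of chords and $|c|$ the number of cycles. Suppose that $G$ is connected (as a union of circles and chords) and that $g=g_{S(G)}$. Then for every base point $$\pi_1(M)\cong\langle g_1,\dots,g_g\mid r_1,\dots,r_g\rangle .$$ Here the generator $g_i$ corresponds to the circle $\mu_i^+$: under the isomorphism it is represented by a loop (joined to the base point by a path that does not depend on $i$) that crosses $\Delta_i^+$ once, and otherwise stays in $H^+$ away from $\Delta^+$. The relator $r_j$ is the word read along $\mu_j^-$: travelling once around $\mu_j^-$ in its direction, one writes $g_k^{\varepsilon}$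 for each chord of sign $\varepsilon$ that joins $\mu_j^-$ to $\mu_k^+$. -/

import Mathlib

open scoped Manifold ContDiff

noncomputable section

/-- The Euclidean plane. -/
abbrev E2 : Type := EuclideanSpace ℝ (Fin 2)

/-- Euclidean 3-space. -/
abbrev E3 : Type := EuclideanSpace ℝ (Fin 3)

/-- The closed unit disc. -/
abbrev D2 : Type := Metric.closedBall (0 : E2) 1

/-- The closed unit ball. -/
abbrev D3 : Type := Metric.closedBall (0 : E3) 1

/-- The unit sphere, the boundary of the closed unit ball. -/
abbrev S2 : Type := Metric.sphere (0 : E3) 1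

/-! ### Gauss diagrams

The two families of circles are indexed by `Bool`: `true` is the family `𝓜⁺`, `false` is `𝓜⁻`. -/

/-- A Gauss diagram with `g` circles in each of the two families. Every circle is the oriented
circle `ℝ / ℤ`, its points being represented by their coordinates in `[0, 1)`. A chord `c` joins
the point `pos true c` of the circle number `circle true c` of `𝓜⁺` to the point `pos false c` of
the circle number `circle false c` of `𝓜⁻`. Different chords have different end points. -/
structure GaussDiagram (g : ℕ) where
  /-- the chords -/
  Chord : Type
  finite_chord : Finite Chord
  /-- the circle of the given family on which the chord ends -/
  circle : Bool → Chord → Fin g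
  /-- the coordinate of the end point of the chord on that circle -/
  pos : Bool → Chord → ℝ
  pos_mem : ∀ ε c, pos ε c ∈ Set.Ico (0 : ℝ) 1
  endpoint_inj : ∀ ε c d, circle ε c = circle ε d → pos ε c = pos ε d → c = d
  /-- the sign of the chord -/
  sign : Chord → ℤˣ

namespace GaussDiagram

variable {g : ℕ} (G : GaussDiagram g)

instance : Finite G.Chord := G.finite_chord

/-- The length in `(0, 1]` of the positively oriented arc of `ℝ / ℤ` that leaves the point `s` and
ends when it meets `t` (a full turn if `s = t`), for `s, t ∈ [0, 1)`. -/
def arcLength (s t : ℝ) : ℝ := if s < t then t - s else t - s + 1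

/-- `d` is the first chord met after leaving `c` along the circle of the family `ε` on which `c`
ends, in the direction of the circle (`d = c` if no other chord ends there). -/
def IsNext (ε : Bool) (c d : G.Chord) : Prop :=
  G.circle ε d = G.circle ε c ∧
    ∀ e, G.circle ε e = G.circle ε c →
      arcLength (G.pos ε c) (G.pos ε d) ≤ arcLength (G.pos ε c) (G.pos ε e)

/-- An edge is named by its family and by the chord at which it starts. The two sides of the edge
are the two boundary arcs of the corresponding ribbon: `(ε, c, true)` is the arc that runs in
the direction of the edge (on its right), `(ε, c, false)` is the arc that runs in the opposite
direction. -/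
abbrev Side : Type := Bool × G.Chord × Bool

/-- Two sides are consecutive on the boundary of the ribbon graph. At a chord `p`, let `a`, `b` be
the incoming and the outgoing edge of the circle of `𝓜⁺`, and `c`, `d` those of the circle of `𝓜⁻`;
let the index `1` stand for the side in the direction of the edge and `2` for the opposite one.
The right turn rule identifies `(a₁, a₂, b₁, b₂)` with `(c₂, d₂, c₁, d₁)` for a positive `p` and with
`(d₁, c₁, d₂, c₂)` for a negative one. Below, `a` and `c` are the chords at which the incoming
edges start. -/
inductive RightTurn : G.Side → G.Side → Prop
  | pos₁ (p a c : G.Chord) (hp : G.sign p = 1) (ha : G.IsNext true a p) (hc : G.IsNext false c p) :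
      RightTurn (true, a, true) (false, c, false)
  | pos₂ (p a c : G.Chord) (hp : G.sign p = 1) (ha : G.IsNext true a p) (hc : G.IsNext false c p) :
      RightTurn (true, a, false) (false, p, false)
  | pos₃ (p a c : G.Chord) (hp : G.sign p = 1) (ha : G.IsNext true a p) (hc : G.IsNext false c p) :
      RightTurn (true, p, true) (false, c, true)
  | pos₄ (p a c : G.Chord) (hp : G.sign p = 1) (ha : G.IsNext true a p) (hc : G.IsNext false c p) :
      RightTurn (true, p, false) (false, p, true)
  | neg₁ (p a c : G.Chord) (hp : G.sign p = -1) (ha : G.IsNext true a p) (hc : G.IsNext false c p) :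
      RightTurn (true, a, true) (false, p, true)
  | neg₂ (p a c : G.Chord) (hp : G.sign p = -1) (ha : G.IsNext true a p) (hc : G.IsNext false c p) :
      RightTurn (true, a, false) (false, c, true)
  | neg₃ (p a c : G.Chord) (hp : G.sign p = -1) (ha : G.IsNext true a p) (hc : G.IsNext false c p) :
      RightTurn (true, p, true) (false, p, false)
  | neg₄ (p a c : G.Chord) (hp : G.sign p = -1) (ha : G.IsNext true a p) (hc : G.IsNext false c p) :
      RightTurn (true, p, false) (false, c, false)

/-- The number of cycles of `G`, that is, of boundary components of its ribbon graph: the classes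
of sides under the right turn rule, and two for each circle without chords (an annulus). -/
def numCycles : ℕ :=
  Nat.card (Quot G.RightTurn) +
    2 * Nat.card {x : Bool × Fin g // ∀ c, G.circle x.1 c ≠ x.2}

/-- The Euler characteristic of the closed surface `S(G)` obtained from the ribbon graph of `G` by
gluing a disc to each boundary component. The ribbon graph has one vertex for each chord and two
edges for each chord (its annular components contribute `0`). -/
def surfaceEulerChar : ℤ :=
  (Nat.card G.Chord : ℤ) - 2 * (Nat.card G.Chord : ℤ) + (G.numCycles : ℤ)

/-- The genus of `S(G)` for a connected `G`: `1 - χ / 2 = 1 + (|h| - |c|) / 2` with `|h|` chords and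
`|c|` cycles. -/
def surfaceGenus : ℚ := 1 - (G.surfaceEulerChar : ℚ) / 2

/-- The graph with the circles of both families as vertices (`Sum.inl i` is the `i`-th circle of
`𝓜⁺`, `Sum.inr j` is the `j`-th circle of `𝓜⁻`), two of them being adjacent if a chord joins
them. -/
def circleGraph : SimpleGraph (Fin g ⊕ Fin g) :=
  SimpleGraph.fromRel fun x y =>
    ∃ c, x = Sum.inl (G.circle true c) ∧ y = Sum.inr (G.circle false c)

/-- The diagram, as a union of circles and chords, is connected. -/
def IsConnected : Prop := G.circleGraph.Connected

open scoped Classical in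
/-- The chords ending on the `j`-th circle of `𝓜⁻`, in the order in which they are met when
travelling once around the circle. -/
def chordsAlong (j : Fin g) : List G.Chord :=
  ((Set.toFinite {c : G.Chord | G.circle false c = j}).toFinset.toList).insertionSort
    fun c d => G.pos false c ≤ G.pos false d

/-- The word `r_j`: travelling around the `j`-th circle of `𝓜⁻`, write `g_k ^ ε` for each chord of
sign `ε` that joins this circle to the `k`-th circle of `𝓜⁺`. -/
def relator (j : Fin g) : FreeGroup (Fin g) :=
  ((G.chordsAlong j).map fun c => FreeGroup.of (G.circle true c) ^ (G.sign c : ℤ)).prod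

end GaussDiagram

/-! ### Handlebodies -/

/-- A handlebody of genus `g` in the space `M` together with a minimal system of meridional discs
`Δ_1, …, Δ_g`, described by cutting it along these discs. The cut handlebody is the closed ball
`D3`; each `Δ_i` gives two disjoint discs `foot i true`, `foot i false` in its boundary sphere, and
the handlebody is recovered by identifying `foot i true z` with `foot i false z`. -/
structure MeridianSystem (M : Type*) [TopologicalSpace M] (g : ℕ) where
  /-- the map that glues the ball to the handlebody -/
  glue : C(D3, M)
  /-- the two copies of the `i`-th meridional disc in the boundary of the ball -/
  foot : Fin g → Bool → C(D2, S2)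
  /-- the `2 g` discs are embedded and pairwise disjoint -/
  foot_inj : Function.Injective fun a : Fin g × Bool × D2 => foot a.1 a.2.1 a.2.2
  glue_eq_iff : ∀ x y : D3, glue x = glue y ↔
    x = y ∨ ∃ i b z, (x : E3) = foot i b z ∧ (y : E3) = foot i (!b) z

namespace MeridianSystem

variable {M : Type*} [TopologicalSpace M] {g : ℕ} (H : MeridianSystem M g)

/-- A point of the boundary sphere as a point of the ball. -/
def bd (x : S2) : D3 := ⟨x, Metric.sphere_subset_closedBall x.2⟩

/-- The handlebody itself. -/
def handlebody : Set M := Set.range H.glue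

/-- The boundary of the handlebody: the image of the sphere without the interiors of the discs. -/
def boundary : Set M :=
  {p | ∃ x : S2, H.glue (bd x) = p ∧ ∀ i b z, H.foot i b z = x → ‖(z : E2)‖ = 1}

/-- The boundary circle of the meridional disc `Δ_i`. -/
def meridian (i : Fin g) : Set M :=
  {p | ∃ z : D2, ‖(z : E2)‖ = 1 ∧ H.glue (bd (H.foot i true z)) = p}

/-- The center of the disc. -/
def origin2 : D2 := ⟨0, Metric.mem_closedBall_self zero_le_one⟩

/-- The center of the ball. -/
def origin3 : D3 := ⟨0, Metric.mem_closedBall_self zero_le_one⟩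

/-- The straight path in the ball from its center to a point of the sphere. -/
def radius (x : S2) : Path origin3 (bd x) where
  toFun t := ⟨(t : ℝ) • (x : E3), by
    have hx : ‖(x : E3)‖ = 1 := by simp
    rw [mem_closedBall_zero_iff, norm_smul, hx, mul_one, Real.norm_eq_abs, abs_of_nonneg t.2.1]
    exact t.2.2⟩
  continuous_toFun := by fun_prop
  source' := by ext; simp [origin3]
  target' := by ext; simp [bd]

/-- The point of the handlebody that is the image of the center of the ball. -/
def center : M := H.glue origin3

theorem glue_foot (i : Fin g) (b : Bool) (z : D2) :
    H.glue (bd (H.foot i b z)) = H.glue (bd (H.foot i (!b) z)) :=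
  (H.glue_eq_iff _ _).2 (Or.inr ⟨i, b, z, rfl, rfl⟩)

/-- The loop dual to the meridional disc `Δ_i`: it goes straight from the center of the ball to the
center of `foot i b`, crosses `Δ_i` there, and returns straight from the center of `foot i (!b)`.
It meets `Δ_i` in one point and no other disc of the system; the two values of `b` give the two
directions. -/
def dualLoop (i : Fin g) (b : Bool) : Path H.center H.center :=
  ((radius (H.foot i b origin2)).map H.glue.continuous).trans
    (((radius (H.foot i (!b) origin2)).map H.glue.continuous).symm.cast
      (H.glue_foot i b origin2) rfl)

end MeridianSystem

/-! ### Oriented surfaces and Heegaard diagrams -/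

/-- The charts of the surface `S` form an oriented atlas: the transition maps have positive Jacobian
determinant. The orientation of `S` is the one for which its charts preserve orientation. -/
def IsOrientedAtlas (S : Type*) [TopologicalSpace S] [ChartedSpace E2 S] : Prop :=
  ∀ e ∈ atlas E2 S, ∀ e' ∈ atlas E2 S, ∀ x ∈ (e.symm.trans e').source,
    0 < (fderiv ℝ (e.symm.trans e') x).det

/-- For curves `γ`, `δ` with `γ s = δ t = p`, the determinant in a chart around `p` of the frame
(tangent to `γ`, tangent to `δ`). -/
def frameDet {S : Type*} [TopologicalSpace S] [ChartedSpace E2 S] (γ δ : ℝ → S) (s t : ℝ) : ℝ :=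
  let u : E2 := deriv (fun x => chartAt E2 (γ s) (γ x)) s
  let v : E2 := deriv (fun x => chartAt E2 (γ s) (δ x)) t
  u 0 * v 1 - u 1 * v 0

/-- A Heegaard diagram of genus `g` of `M` on the oriented surface `S`: a Heegaard splitting of `M`
into two handlebodies with common boundary `S`, minimal systems of meridional discs of both, and
oriented parametrizations of the boundaries of these discs as smooth closed curves on `S`, the
curves of the first family being transverse to those of the second one. In `handle` and `curve`,
the index `true` stands for `+` and `false` for `-`. -/
structure HeegaardDiagram (M : Type*) [TopologicalSpace M]
    (S : Type*) [TopologicalSpace S] [ChartedSpace E2 S] (g : ℕ) where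
  /-- the handlebodies `H⁺`, `H⁻` with their meridional discs -/
  handle : Bool → MeridianSystem M g
  /-- the inclusion of the splitting surface -/
  incl : S → M
  isEmbedding_incl : Topology.IsEmbedding incl
  union_eq : (handle true).handlebody ∪ (handle false).handlebody = Set.univ
  inter_eq : (handle true).handlebody ∩ (handle false).handlebody = Set.range incl
  boundary_eq : ∀ ε, (handle ε).boundary = Set.range incl
  /-- the curves `m_i^±`, as maps of period `1` -/
  curve : Bool → Fin g → ℝ → S
  curve_smooth : ∀ ε i, ContMDiff 𝓘(ℝ, ℝ) (𝓡 2) ∞ (curve ε i)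
  curve_periodic : ∀ ε i, Function.Periodic (curve ε i) 1
  curve_immersed : ∀ ε i s, mfderiv 𝓘(ℝ, ℝ) (𝓡 2) (curve ε i) s ≠ 0
  /-- the curves of each family are simple and pairwise disjoint -/
  curve_disjoint : ∀ ε i k s t, curve ε i s = curve ε k t → i = k ∧ ∃ n : ℤ, t = s + n
  /-- the curves are the boundaries of the meridional discs -/
  curve_meridian : ∀ ε i, incl '' Set.range (curve ε i) = (handle ε).meridian i
  transverse : ∀ i j s t, curve true i s = curve false j t →
    frameDet (curve true i) (curve false j) s t ≠ 0

namespace HeegaardDiagram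

variable {M : Type*} [TopologicalSpace M] {S : Type*} [TopologicalSpace S] [ChartedSpace E2 S]
  {g : ℕ} (D : HeegaardDiagram M S g)

/-- An intersection point of the two families, given by its two preimages: the point with coordinate
`c.1 true ∈ [0, 1)` on the curve number `c.2 true` of the family `+` and the point with coordinate
`c.1 false ∈ [0, 1)` on the curve number `c.2 false` of the family `-`. -/
def Crossing : Type :=
  {c : (Bool → ℝ) × (Bool → Fin g) // (∀ ε, c.1 ε ∈ Set.Ico (0 : ℝ) 1) ∧
    D.curve true (c.2 true) (c.1 true) = D.curve false (c.2 false) (c.1 false)}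

theorem hasDerivAt_chart {γ : ℝ → S} (h : ContMDiff 𝓘(ℝ, ℝ) (𝓡 2) ∞ γ) {s : ℝ} {p : S}
    (hp : γ s = p) :
    HasDerivAt (fun x => chartAt E2 p (γ x)) (deriv (fun x => chartAt E2 p (γ x)) s) s := by
  subst hp
  have h1 := (contMDiffAt_iff.1 (h s)).2
  have h2 : ContDiffWithinAt ℝ ∞ (fun x => chartAt E2 (γ s) (γ x)) Set.univ s := by
    simpa [Function.comp_def, chartAt_self_eq] using h1
  exact ((contDiffWithinAt_univ.1 h2).differentiableAt (by simp)).hasDerivAt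

theorem isolated [T2Space M] (i j : Fin g) (q : ℝ × ℝ) :
    ¬ AccPt q (Filter.principal {q : ℝ × ℝ | D.curve true i q.1 = D.curve false j q.2}) := by
  have : T2Space S := D.isEmbedding_incl.t2Space
  have hc : ∀ ε k, Continuous (D.curve ε k) := fun ε k => (D.curve_smooth ε k).continuous
  intro hq
  have hcl : IsClosed {q : ℝ × ℝ | D.curve true i q.1 = D.curve false j q.2} :=
    isClosed_eq ((hc _ _).comp continuous_fst) ((hc _ _).comp continuous_snd)
  have hmem : D.curve true i q.1 = D.curve false j q.2 :=
    (isClosed_iff_clusterPt.1 hcl q hq.clusterPt)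
  have hdet := D.transverse i j q.1 q.2 hmem
  simp only [frameDet] at hdet
  set p := D.curve true i q.1 with hp
  have hu := hasDerivAt_chart (D.curve_smooth true i) (s := q.1) hp.symm
  have hv := hasDerivAt_chart (D.curve_smooth false j) (s := q.2) hmem.symm
  set u : E2 := deriv (fun x => chartAt E2 p (D.curve true i x)) q.1
  set v : E2 := deriv (fun x => chartAt E2 p (D.curve false j x)) q.2
  have hF := (hu.hasFDerivAt.comp q hasFDerivAt_fst).sub (hv.hasFDerivAt.comp q hasFDerivAt_snd)
  set F' : ℝ × ℝ →L[ℝ] E2 := _ - _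
  have hinj : LinearMap.ker (F' : ℝ × ℝ →ₗ[ℝ] E2) = ⊥ := by
    refine LinearMap.ker_eq_bot'.2 fun w hw => ?_
    have h0 : w.1 * u 0 - w.2 * v 0 = 0 := by
      simpa [F'] using congrArg (fun z : E2 => z 0) hw
    have h1 : w.1 * u 1 - w.2 * v 1 = 0 := by
      simpa [F'] using congrArg (fun z : E2 => z 1) hw
    have e1 : w.1 * (u 0 * v 1 - u 1 * v 0) = 0 := by linear_combination v 1 * h0 - v 0 * h1
    have e2 : w.2 * (u 0 * v 1 - u 1 * v 0) = 0 := by linear_combination u 1 * h0 - u 0 * h1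
    exact Prod.ext ((mul_eq_zero.1 e1).resolve_right hdet) ((mul_eq_zero.1 e2).resolve_right hdet)
  obtain ⟨K, -, hK⟩ := LinearMap.exists_antilipschitzWith _ hinj
  have hev := hF.eventually_ne (c := 0) ⟨K, hK⟩
  rw [accPt_iff_frequently_nhdsNE] at hq
  obtain ⟨z, hz, hz'⟩ := (hq.and_eventually hev).exists
  refine hz' ?_
  have hz2 : D.curve true i z.1 = D.curve false j z.2 := hz
  simp [hz2]

/-- Transverse curves on a compact surface have finitely many intersection points. -/
instance finite_crossing [T2Space M] : Finite D.Crossing := by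
  have hfin : ∀ i j : Fin g, ({q : ℝ × ℝ | D.curve true i q.1 = D.curve false j q.2} ∩
      Set.Icc 0 1 ×ˢ Set.Icc 0 1).Finite := by
    intro i j
    by_contra h
    obtain ⟨q, -, hq⟩ := Set.Infinite.exists_accPt_of_subset_isCompact h
      (isCompact_Icc.prod isCompact_Icc) Set.inter_subset_right
    exact D.isolated i j q (hq.mono (Filter.principal_mono.2 Set.inter_subset_left))
  let f : D.Crossing → Σ a : Fin g × Fin g,
      ↥({q : ℝ × ℝ | D.curve true a.1 q.1 = D.curve false a.2 q.2} ∩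
        Set.Icc 0 1 ×ˢ Set.Icc 0 1) :=
    fun c => ⟨(c.1.2 true, c.1.2 false), (c.1.1 true, c.1.1 false), c.2.2,
      Set.Ico_subset_Icc_self (c.2.1 true), Set.Ico_subset_Icc_self (c.2.1 false)⟩
  have : ∀ a : Fin g × Fin g, Finite
      ↥({q : ℝ × ℝ | D.curve true a.1 q.1 = D.curve false a.2 q.2} ∩
        Set.Icc 0 1 ×ˢ Set.Icc 0 1) := fun a => (hfin a.1 a.2).to_subtype
  refine Finite.of_injective f fun c d h => ?_
  have h1 : (c.1.2 true, c.1.2 false) = (d.1.2 true, d.1.2 false) := congrArg Sigma.fst h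
  have h2 : (c.1.1 true, c.1.1 false) = (d.1.1 true, d.1.1 false) :=
    congrArg (fun x => (x.2 : ℝ × ℝ)) h
  simp only [Prod.mk.injEq] at h1 h2
  exact Subtype.ext (Prod.ext (funext fun ε => by cases ε <;> simp [h2])
    (funext fun ε => by cases ε <;> simp [h1]))

theorem coord_unique {ε : Bool} {i k : Fin g} {s t : ℝ} (hs : s ∈ Set.Ico (0 : ℝ) 1)
    (ht : t ∈ Set.Ico (0 : ℝ) 1) (h : D.curve ε i s = D.curve ε k t) : i = k ∧ s = t := by
  obtain ⟨hik, n, hn⟩ := D.curve_disjoint ε i k s t h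
  refine ⟨hik, ?_⟩
  have h1 : (n : ℝ) < 1 := by linarith [hs.1, ht.2]
  have h2 : (-1 : ℝ) < n := by linarith [hs.2, ht.1]
  have h3 : n = 0 := by
    have h4 : n < 1 := by exact_mod_cast h1
    have h5 : -1 < n := by exact_mod_cast h2
    omega
  simp [hn, h3]

/-- The Gauss diagram `G(Σ, M^±)` of a Heegaard diagram: the chords are the intersection points, and
the sign of a chord is `1` if the frame (tangent to `m_i^+`, tangent to `m_j^-`) is positive for the
orientation of the surface and `-1` otherwise. -/
def gauss [T2Space M] : GaussDiagram g where
  Chord := D.Crossing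
  finite_chord := D.finite_crossing
  circle ε c := c.1.2 ε
  pos ε c := c.1.1 ε
  pos_mem ε c := c.2.1 ε
  endpoint_inj ε c d h1 h2 := by
    have key : D.curve (!ε) (c.1.2 !ε) (c.1.1 !ε) = D.curve (!ε) (d.1.2 !ε) (d.1.1 !ε) := by
      have hc := c.2.2
      have hd := d.2.2
      cases ε
      · simp only [Bool.not_false]; rw [hc, hd, h1, h2]
      · simp only [Bool.not_true]; rw [← hc, ← hd, h1, h2]
    obtain ⟨h3, h4⟩ := D.coord_unique (c.2.1 _) (d.2.1 _) key
    refine Subtype.ext (Prod.ext (funext fun δ => ?_) (funext fun δ => ?_)) <;>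
      cases ε <;> cases δ <;> assumption
  sign c :=
    if 0 < frameDet (D.curve true (c.1.2 true)) (D.curve false (c.1.2 false)) (c.1.1 true)
      (c.1.1 false) then 1 else -1

end HeegaardDiagram

end

noncomputable section

open Filter Topology Set

/-! ### Covering spaces from cocycles -/

section Descent

variable {X K P : Type*} [TopologicalSpace K] [Group P]

/-! The manifold is obtained from two balls: gluing the copies of the discs `Δ_i^+` in pairs
contributes a free generator for each `i`, each disc `Δ_j^-` kills the class of its boundary, and
the ball that remains adds nothing because the sphere is simply connected. The argument works
directly with the two closed balls and their finite-to-one maps to `M`, without collars or open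
thickenings. A homomorphism from the presented group `P` to the fundamental group is written down
(`presentedHom`) and shown to be bijective.

Orientation. Each `m_i^+` has a left side, and one of the two copies of `Δ_i^+` in the sphere lies
next to it; the same copy serves all along the curve (`exists_side`). That two different copies lie
on the two sides rests on the fact that a boundary point of a disc embedded in the sphere is not an
interior point of it (`range_notMem_nhds_of_mem_rim`). With this choice `β`, the word read along
`m_j^-`, corrected at each crossing according to the copy on which the point of the ball lies,
becomes a locally constant function on pairs (point of the ball, parameter) over the same point of
the curve (`locConstOn_word`); its jump between the two copies is always the generator.

Relators (`dualHom_relator`). Classes of paths continued over the disc `Δ_j^-` are unchanged after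
one turn around its boundary. Their difference from the classes of radial paths in the first ball
jumps exactly as the word does, so comparing the start and the end of the turn makes the relator
trivial.

Injectivity (`injective_presentedHom`). A locally constant `P`-valued cocycle over the two balls
descends to a covering of `M` with fibre `P` (`exists_isCoveringMap`). On the first ball it is
prescribed by the generators; the words extend it over the discs `Δ_j^-` because the relators vanish
in `P`; it extends over the second ball because coverings of the sphere have sections
(`exists_section_sphere`). The generator number `i` then acts on the fibre as left multiplication by
itself, so a trivial image forces a trivial element.

Surjectivity (`surjective_presentedHom`). Path classes from the centre can be continued over both
balls so that values over the same point of `M` differ by an element of the image only. Continuing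
along an arbitrary loop and comparing shows that its class lies in the image. The connectedness of
the splitting surface enters here.

In `FundamentalGroup` the product `a * b` is `b` followed by `a`. The loops used as generators run
against the positive crossing direction, so the two reversals cancel: a word goes to the inverse of
the loop that it describes geometrically. -/

/-- A function is locally constant on a set: each point of the set has a neighbourhood such that the
function is constant on its intersection with the set. -/
def LocConstOn {A P : Type*} [TopologicalSpace A] (R : Set A) (f : A → P) : Prop :=
  ∀ a ∈ R, ∀ᶠ b in 𝓝 a, b ∈ R → f b = f a

/-- A `P`-valued cocycle on the fibre product of `q : K → X` with itself. -/
structure IsLocConstCocycle (q : K → X) (τ : K → K → P) : Prop where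
  mul : ∀ a b c, q a = q b → q b = q c → τ a b * τ b c = τ a c
  loc : LocConstOn {r : K × K | q r.1 = q r.2} fun r => τ r.1 r.2

namespace IsLocConstCocycle

variable {q : K → X} {τ : K → K → P}

theorem self (h : IsLocConstCocycle q τ) (a : K) : τ a a = 1 := by
  simpa using h.mul a a a rfl rfl

/-- Locally on the base the cocycle is a coboundary. The finitely many points over `x` have disjoint
neighbourhoods, so small that `τ` is constant on pairs taken from two of them; since `q` is closed,
all fibres near `x` lie in these neighbourhoods. There `w` is `τ` towards a fixed point over `x`. -/
theorem exists_local_section [TopologicalSpace X] [T2Space K]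
    (h : IsLocConstCocycle q τ) (hcl : IsClosedMap q)
    (hfin : ∀ x, (q ⁻¹' {x}).Finite) (hs : Function.Surjective q) (x : X) :
    ∃ U : Set X, ∃ w : K → P, IsOpen U ∧ x ∈ U ∧
      (∀ a b, q a = q b → q a ∈ U → w a = τ a b * w b) ∧
      (∀ a, q a ∈ U → ∀ᶠ b in 𝓝 a, w b = w a) := by
  classical
  obtain ⟨y₀, hy₀⟩ := hs x
  obtain ⟨V, hV, hdisj⟩ := (hfin x).t2_separation
  have hloc : ∀ a b, q a = q b → ∃ A B : Set K, IsOpen A ∧ a ∈ A ∧ IsOpen B ∧ b ∈ B ∧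
      ∀ y ∈ A, ∀ y' ∈ B, q y = q y' → τ y y' = τ a b := by
    intro a b hab
    obtain ⟨A, B, hA, haA, hB, hbB, hAB⟩ := mem_nhds_prod_iff'.1 (h.loc (a, b) hab)
    exact ⟨A, B, hA, haA, hB, hbB, fun y hy y' hy' e => hAB (Set.mk_mem_prod hy hy') e⟩
  choose! A B hA hA' hB hB' hAB using hloc
  let W : K → Set K := fun a => V a ∩ ((⋂ b ∈ q ⁻¹' {x}, A a b) ∩ ⋂ b ∈ q ⁻¹' {x}, B b a)
  have hWo : ∀ a ∈ q ⁻¹' {x}, IsOpen (W a) := fun a ha =>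
    (hV a).2.inter (((hfin x).isOpen_biInter fun b hb => hA a b (ha.trans hb.symm)).inter
      ((hfin x).isOpen_biInter fun b hb => hB b a (hb.trans ha.symm)))
  have hWm : ∀ a ∈ q ⁻¹' {x}, a ∈ W a := fun a ha => ⟨(hV a).1,
    Set.mem_iInter₂.2 fun b hb => hA' a b (ha.trans hb.symm),
    Set.mem_iInter₂.2 fun b hb => hB' b a (hb.trans ha.symm)⟩
  have hWτ : ∀ a ∈ q ⁻¹' {x}, ∀ b ∈ q ⁻¹' {x}, ∀ y ∈ W a, ∀ y' ∈ W b, q y = q y' →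
      τ y y' = τ a b := fun a ha b hb y hy y' hy' e =>
    hAB a b (ha.trans hb.symm) y (Set.mem_iInter₂.1 hy.2.1 b hb) y'
      (Set.mem_iInter₂.1 hy'.2.2 a ha) e
  -- Outside the chosen neighbourhoods the value 1 is a dummy: no point over `U` lies there.
  let w : K → P := fun y =>
    if H : ∃ a, a ∈ q ⁻¹' {x} ∧ y ∈ W a then τ H.choose y₀ else 1
  have hw : ∀ a ∈ q ⁻¹' {x}, ∀ y ∈ W a, w y = τ a y₀ := by
    intro a ha y hy
    have H : ∃ a, a ∈ q ⁻¹' {x} ∧ y ∈ W a := ⟨a, ha, hy⟩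
    have : H.choose = a := by
      by_contra hne
      exact Set.disjoint_left.1 (hdisj H.choose_spec.1 ha hne) H.choose_spec.2.1 hy.1
    simp only [w, dif_pos H, this]
  have hev : ∀ᶠ x' in 𝓝 x, ∀ y, q y = x' → ∃ a ∈ q ⁻¹' {x}, y ∈ W a := by
    refine hcl.eventually_nhds_fiber x fun a ha => ?_
    filter_upwards [(hWo a ha).mem_nhds (hWm a ha)] with y hy using ⟨a, ha, hy⟩
  obtain ⟨U, hU, hUo, hxU⟩ := eventually_nhds_iff.1 hev
  refine ⟨U, w, hUo, hxU, fun a b hab ha => ?_, fun a ha => ?_⟩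
  · obtain ⟨c, hc, hac⟩ := hU _ ha a rfl
    obtain ⟨d, hd, hbd⟩ := hU _ ha b hab.symm
    rw [hw c hc a hac, hw d hd b hbd, hWτ c hc d hd a hac b hbd hab,
      h.mul _ _ _ (hc.trans hd.symm) (hd.trans hy₀.symm)]
  · obtain ⟨c, hc, hac⟩ := hU _ ha a rfl
    filter_upwards [(hWo c hc).mem_nhds hac] with y hy
    rw [hw c hc y hy, hw c hc a hac]

/-- A locally constant cocycle on the fibre product of a closed surjection with finite fibres is
the descent datum of a covering space. -/
theorem exists_isCoveringMap {X : Type u} {K : Type*} {P : Type v} [TopologicalSpace X]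
    [TopologicalSpace K] [T2Space K] [Group P] {q : K → X} {τ : K → K → P}
    (h : IsLocConstCocycle q τ) (hc : Continuous q)
    (hcl : IsClosedMap q) (hfin : ∀ x, (q ⁻¹' {x}).Finite) (hs : Function.Surjective q) :
    ∃ (E : Type max u v) (_ : TopologicalSpace E) (p : E → X) (mk : K → P → E), IsCoveringMap p ∧
      (∀ k, Continuous fun a => mk a k) ∧ (∀ a k, p (mk a k) = q a) ∧
      (∀ a k b l, mk a k = mk b l ↔ q a = q b ∧ k = τ a b * l) ∧ ∀ e, ∃ a k, mk a k = e := by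
  let _ : TopologicalSpace P := ⊥
  have : DiscreteTopology P := ⟨rfl⟩
  choose U w hU hxU hmul hloc using h.exists_local_section hcl hfin hs
  let r : X → K := Function.surjInv hs
  have hr : ∀ x, q (r x) = x := Function.surjInv_eq hs
  -- Along a fibre all local solutions change by the same left factor `τ a b`, so their quotients
  -- are functions on the base. They are the transition functions of a bundle with discrete fibre,
  -- evaluated at an arbitrary point `r x` of the fibre.
  have key : ∀ i j a b, q a = q b → q a ∈ U i → q a ∈ U j →
      (w j a)⁻¹ * w i a = (w j b)⁻¹ * w i b := by
    intro i j a b hab hi hj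
    rw [hmul i a b hab hi, hmul j a b hab hj]; group
  let Z : FiberBundleCore X X P :=
    { baseSet := U
      isOpen_baseSet := hU
      indexAt := id
      mem_baseSet_at := hxU
      coordChange := fun i j x v => (w j (r x))⁻¹ * w i (r x) * v
      coordChange_self := fun i x hx v => by simp
      continuousOn_coordChange := by
        intro i j
        rintro ⟨x, v⟩ ⟨⟨hi, hj⟩, -⟩
        have h1 : ∀ᶠ x' in 𝓝 x, ∀ y, q y = x' →
            (w j y)⁻¹ * w i y = (w j (r x))⁻¹ * w i (r x) := by
          refine hcl.eventually_nhds_fiber x fun a ha => ?_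
          have ha : q a = x := ha
          filter_upwards [hloc i a (ha ▸ hi), hloc j a (ha ▸ hj)] with y h1 h2
          rw [h1, h2, key i j a (r x) (by rw [hr, ha]) (ha ▸ hi) (ha ▸ hj)]
        refine ContinuousAt.continuousWithinAt ?_
        have h2 : (fun p : X × P => (w j (r p.1))⁻¹ * w i (r p.1) * p.2) =ᶠ[𝓝 (x, v)]
            fun _ => (w j (r x))⁻¹ * w i (r x) * v := by
          have h3 : ∀ᶠ p in 𝓝 (x, v), p.2 = v := by
            have : ∀ᶠ z in 𝓝 v, z = v := by rw [nhds_discrete]; simp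
            exact (continuousAt_snd (p := (x, v))).eventually this
          filter_upwards [continuousAt_fst.eventually h1, h3] with p h1 h3
          rw [h1 _ (hr _), h3]
        exact continuousAt_const.congr h2.symm
      coordChange_comp := by intro i j k x hx v; group }
  have hcov : IsCoveringMap Z.proj := FiberBundle.isCoveringMap (E := Z.Fiber)
  refine ⟨Z.TotalSpace, inferInstance, Z.proj, fun a k => ⟨q a, (w (q a) a)⁻¹ * k⟩, hcov,
    fun k => ?_, fun a k => rfl, fun a k b l => ?_, fun e => ?_⟩
  · refine continuous_iff_continuousAt.2 fun a => ?_
    rw [FiberBundle.continuousAt_totalSpace P]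
    refine ⟨hc.continuousAt, ?_⟩
    have : (fun b => (trivializationAt P Z.Fiber (q a) ⟨q b, (w (q b) b)⁻¹ * k⟩).2) =ᶠ[𝓝 a]
        fun _ => (w (q a) a)⁻¹ * k := by
      filter_upwards [hloc (q a) a (hxU _), hc.continuousAt.eventually ((hU (q a)).mem_nhds (hxU _))]
        with b h1 h2
      change (w (q a) (r (q b)))⁻¹ * w (q b) (r (q b)) * ((w (q b) b)⁻¹ * k) = _
      rw [key (q b) (q a) (r (q b)) b (hr _) (by rw [hr]; exact hxU _) (by rw [hr]; exact h2), h1]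
      group
    exact continuousAt_const.congr this.symm
  · constructor
    · intro e
      have e1 : q a = q b := congrArg Bundle.TotalSpace.proj e
      refine ⟨e1, ?_⟩
      have e2 : (w (q a) a)⁻¹ * k = (w (q b) b)⁻¹ * l := by
        have := (Bundle.TotalSpace.mk.injEq .. ▸ e : _ ∧ _).2
        exact eq_of_heq this
      rw [← e1, hmul (q a) a b e1 (hxU _)] at e2
      rw [inv_mul_eq_iff_eq_mul] at e2
      rw [e2]; group
    · rintro ⟨e1, rfl⟩
      have : (w (q a) a)⁻¹ * (τ a b * l) = (w (q b) b)⁻¹ * l := by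
        rw [← e1, hmul (q a) a b e1 (hxU _)]; group
      exact Bundle.TotalSpace.ext e1 (heq_of_eq this)
  · let v : P := e.2
    refine ⟨r e.1, w (q (r e.1)) (r e.1) * v, ?_⟩
    refine Bundle.TotalSpace.ext (hr _) (heq_of_eq ?_)
    exact (inv_mul_cancel_left (w (q (r e.1)) (r e.1)) v :)

end IsLocConstCocycle

end Descent

/-- A covering space of the sphere has a section. -/
theorem IsCoveringMap.exists_section_sphere {E : Type*} [TopologicalSpace E] {p : E → S2}
    (cov : IsCoveringMap p) (hp : Function.Surjective p) :
    ∃ σ : S2 → E, Continuous σ ∧ ∀ x, p (σ x) = x := by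
  have hdim : Fact (Module.finrank ℝ E3 = 2 + 1) := ⟨by simp⟩
  let st : S2 → OpenPartialHomeomorph S2 E2 := fun v => stereographic' 2 v
  have hcont : ∀ v : S2, Continuous (st v).symm := fun v => by
    have := (st v).continuousOn_symm
    simpa [st, stereographic'_target, continuousOn_univ] using this
  have hmem : ∀ v x : S2, x ∈ (st v).source ↔ x ≠ v := fun v x => by simp [st]
  have hinv : ∀ (v : S2) (z : E2), st v ((st v).symm z) = z := fun v z =>
    (st v).right_inv (by simp [st])
  have hne : ∀ (v : S2) (z : E2), (st v).symm z ≠ v := fun v z =>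
    (hmem v _).1 ((st v).map_target (by simp [st]))
  obtain ⟨v, -⟩ : ∃ v : S2, True := by
    obtain ⟨v, hv⟩ := (NormedSpace.sphere_nonempty (x := (0 : E3)) (r := 1)).2 zero_le_one
    exact ⟨⟨v, hv⟩, trivial⟩
  obtain ⟨w, hw⟩ : ∃ w : S2, w ≠ v := ⟨(st v).symm 0, hne v 0⟩
  -- The sphere without two points is the plane without one point, by stereographic projection from
  -- `v`.
  have hover : IsPreconnected {x : S2 | x ≠ v ∧ x ≠ w} := by
    have h1 : IsPreconnected ({st v w}ᶜ : Set E2) :=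
      (isConnected_compl_singleton_of_one_lt_rank (by
        rw [← Module.finrank_eq_rank]; simp) _).isPreconnected
    have h2 := h1.image _ (hcont v).continuousOn
    convert h2 using 1
    ext x
    constructor
    · rintro ⟨h3, h4⟩
      refine ⟨st v x, fun h5 => h4 ?_, (st v).left_inv ((hmem v x).2 h3)⟩
      exact (st v).injOn ((hmem v x).2 h3) ((hmem v w).2 hw) h5
    · rintro ⟨z, hz, rfl⟩
      refine ⟨hne v z, fun h => hz ?_⟩
      rw [Set.mem_singleton_iff, ← h, hinv]
  obtain ⟨x₀, hx₀⟩ : ∃ x₀ : S2, x₀ ≠ v ∧ x₀ ≠ w := by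
    obtain ⟨z, hz⟩ := exists_ne (st v w)
    exact ⟨(st v).symm z, hne v z, fun h => hz (by rw [← h, hinv])⟩
  obtain ⟨e₀, he₀⟩ := hp x₀
  -- The inverse stereographic projection is a map from the simply connected plane and therefore
  -- lifts. The lifts on the complements of two points agree at `x₀`, hence on the connected
  -- overlap, and glue to a section.
  have hlift : ∀ u : S2, x₀ ≠ u → ∃ l : S2 → E, ContinuousOn l {u}ᶜ ∧ l x₀ = e₀ ∧
      ∀ x, x ≠ u → p (l x) = x := by
    intro u hu
    obtain ⟨F, ⟨hF1, hF2⟩, -⟩ := cov.existsUnique_continuousMap_lifts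
      (⟨(st u).symm, hcont u⟩ : C(E2, S2)) (st u x₀) e₀
      (by rw [he₀]; exact ((st u).left_inv ((hmem u x₀).2 hu)).symm)
    refine ⟨fun x => F (st u x), ?_, hF1, fun x hx => ?_⟩
    · refine F.continuous.comp_continuousOn ((st u).continuousOn.mono fun x hx => ?_)
      exact (hmem u x).2 hx
    · exact (congrFun hF2 (st u x)).trans ((st u).left_inv ((hmem u x).2 hx))
  obtain ⟨l, hl, hl0, hlp⟩ := hlift v hx₀.1
  obtain ⟨l', hl', hl0', hlp'⟩ := hlift w hx₀.2
  have heq : EqOn l l' {x : S2 | x ≠ v ∧ x ≠ w} :=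
    cov.eqOn_of_comp_eqOn hover (hl.mono fun x hx => hx.1) (hl'.mono fun x hx => hx.2)
      (fun x hx => (hlp x hx.1).trans (hlp' x hx.2).symm) hx₀ (hl0.trans hl0'.symm)
  classical
  refine ⟨fun x => if x = v then l' x else l x, ?_, fun x => ?_⟩
  · refine continuous_iff_continuousAt.2 fun x => ?_
    by_cases hx : x = v
    · subst hx
      have hxw : ({w}ᶜ : Set S2) ∈ 𝓝 x := isOpen_compl_singleton.mem_nhds (Ne.symm hw)
      refine (hl'.continuousAt hxw).congr ?_
      filter_upwards [hxw] with y hy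
      split_ifs with h
      · rfl
      · exact (heq ⟨h, hy⟩).symm
    · have hxv : ({v}ᶜ : Set S2) ∈ 𝓝 x := isOpen_compl_singleton.mem_nhds hx
      refine (hl.continuousAt hxv).congr ?_
      filter_upwards [hxv] with y hy
      rw [if_neg (show y ≠ v from hy)]
  · dsimp only
    split_ifs with h
    · exact hlp' x (by rw [h]; exact Ne.symm hw)
    · exact hlp x h

/-! ### Homotopy classes of paths with a fixed starting point -/

variable {M : Type*} [TopologicalSpace M]

/-- Homotopy classes of paths starting at `c`. -/
abbrev PathsFrom (c : M) : Type _ := Σ m : M, Path.Homotopic.Quotient c m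

namespace PathsFrom

variable {c : M}

/-- Prolongation of a class by a path. -/
def ext (x : PathsFrom c) {m : M} (p : Path x.1 m) : PathsFrom c := ⟨m, x.2.trans (.mk p)⟩

/-- The right action of the fundamental group by precomposition with loops. -/
def act (x : PathsFrom c) (γ : FundamentalGroup M c) : PathsFrom c :=
  ⟨x.1, Path.Homotopic.Quotient.trans γ x.2⟩

theorem act_one (x : PathsFrom c) : x.act 1 = x := by
  change (⟨x.1, (Path.Homotopic.Quotient.refl c).trans x.2⟩ : PathsFrom c) = x
  simp

/-- The product `a * b` of `FundamentalGroup` is the loop `b` followed by `a`. This is why prefixing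
a loop is a right action and not a left one. -/
theorem act_mul (x : PathsFrom c) (a b : FundamentalGroup M c) :
    x.act (a * b) = (x.act a).act b := by
  change (⟨x.1, (Path.Homotopic.Quotient.trans b a).trans x.2⟩ : PathsFrom c) =
    ⟨x.1, Path.Homotopic.Quotient.trans b (Path.Homotopic.Quotient.trans a x.2)⟩
  simp

theorem exists_act {x y : PathsFrom c} (h : x.1 = y.1) : ∃ a, y = x.act a := by
  obtain ⟨m, u⟩ := x
  obtain ⟨n, v⟩ := y
  obtain rfl : m = n := h
  exact ⟨v.trans u.symm, by simp [act]⟩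

theorem act_injective (x : PathsFrom c) {a b : FundamentalGroup M c} (h : x.act a = x.act b) :
    a = b := by
  obtain ⟨m, u⟩ := x
  have h' : Path.Homotopic.Quotient.trans a u = Path.Homotopic.Quotient.trans b u := by
    simpa [act] using h
  have := congrArg (fun w => w.trans u.symm) h'
  simpa using this

/-- Locally, the values of `l` arise from each other by prolongation with small paths. -/
def IsHorizontal {A : Type*} [TopologicalSpace A] (l : A → PathsFrom c) : Prop :=
  ∀ a, ∀ V ∈ 𝓝 (l a).1, ∀ᶠ b in 𝓝 a, ∃ p : Path (l a).1 (l b).1, (∀ t, p t ∈ V) ∧ l b = (l a).ext p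

theorem IsHorizontal.comp {A B : Type*} [TopologicalSpace A] [TopologicalSpace B]
    {l : A → PathsFrom c} (hl : IsHorizontal l) {f : B → A} (hf : Continuous f) :
    IsHorizontal (l ∘ f) := fun b V hV => hf.continuousAt.eventually (hl (f b) V hV)

end PathsFrom

/-- Small paths with the same end points are homotopic. -/
def SemilocSimplyConn (M : Type*) [TopologicalSpace M] : Prop :=
  ∀ m : M, ∃ V ∈ 𝓝 m, ∀ (n : M) (p q : Path m n), (∀ t, p t ∈ V) → (∀ t, q t ∈ V) → p.Homotopic q

/-- The preimage of a ball under a chart is contractible, so paths inside it with common ends are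
homotopic. -/
theorem semilocSimplyConn_of_chartedSpace (E M : Type*) [NormedAddCommGroup E] [NormedSpace ℝ E]
    [TopologicalSpace M] [ChartedSpace E M] : SemilocSimplyConn M := by
  intro m
  let e := chartAt E m
  have hm : m ∈ e.source := mem_chart_source E m
  obtain ⟨r, hr, hB⟩ := Metric.isOpen_iff.1 e.open_target (e m) (e.map_source hm)
  have hc : ContinuousOn e.symm (Metric.ball (e m) r) := e.continuousOn_symm.mono hB
  let f : C(Metric.ball (e m) r, M) := ⟨fun x => e.symm x, hc.domRestrict⟩
  have hsc : ContractibleSpace (Metric.ball (e m) r) := Metric.contractibleSpace_ball hr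
  refine ⟨e.source ∩ e ⁻¹' Metric.ball (e m) r,
    (e.isOpen_inter_preimage Metric.isOpen_ball).mem_nhds ⟨hm, Metric.mem_ball_self hr⟩,
    fun n p q hp hq => ?_⟩
  have hn : n ∈ e.source ∩ e ⁻¹' Metric.ball (e m) r := by simpa using hp 1
  have lift : ∀ p : Path m n, (∀ t, p t ∈ e.source ∩ e ⁻¹' Metric.ball (e m) r) →
      ∃ p' : Path (⟨e m, Metric.mem_ball_self hr⟩ : Metric.ball (e m) r) ⟨e n, hn.2⟩,
        p = (p'.map f.continuous).cast (e.left_inv hm).symm (e.left_inv hn.1).symm := by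
    intro p hp
    refine ⟨⟨⟨fun t => ⟨e (p t), (hp t).2⟩, ?_⟩, ?_, ?_⟩, ?_⟩
    · exact (e.continuousOn.comp_continuous p.continuous fun t => (hp t).1).subtype_mk _
    · simp
    · simp
    · ext t
      exact (e.left_inv (hp t).1).symm
  obtain ⟨p', rfl⟩ := lift p hp
  obtain ⟨q', rfl⟩ := lift q hq
  exact ((SimplyConnectedSpace.paths_homotopic p' q').map f).pathCast _ _

/-! ### Rigidity of horizontal families and continuation over simply connected spaces -/

namespace PathsFrom

variable {c : M}

/-- If `l` and `l'` differ by a loop at two points then they differ by it at all close points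
over the same point of the space. -/
theorem IsHorizontal.eventually_eq_act (hM : SemilocSimplyConn M) {A B : Type*} [TopologicalSpace A]
    [TopologicalSpace B] {l : A → PathsFrom c} {l' : B → PathsFrom c} (hl : IsHorizontal l)
    (hl' : IsHorizontal l') {a : A} {b : B} {γ : FundamentalGroup M c} (h : l' b = (l a).act γ) :
    ∀ᶠ z in 𝓝 (a, b), (l z.1).1 = (l' z.2).1 → l' z.2 = (l z.1).act γ := by
  obtain ⟨V, hV, hVh⟩ := hM (l a).1
  have hV' : V ∈ 𝓝 (l' b).1 := by rw [h]; exact hV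
  -- Both values arise by small paths from classes that differ by `γ`. If the small paths end at the
  -- same point they are homotopic, and `γ`, which is added at the other end, is not affected.
  have key : ∀ x y x' y' : PathsFrom c, ∀ p : Path x.1 y.1, ∀ p' : Path x'.1 y'.1,
      (∀ (n : M) (p q : Path x.1 n), (∀ t, p t ∈ V) → (∀ t, q t ∈ V) → p.Homotopic q) →
      x' = x.act γ → (∀ t, p t ∈ V) → (∀ t, p' t ∈ V) → y = x.ext p → y' = x'.ext p' →
      y.1 = y'.1 → y' = y.act γ := by
    rintro x ⟨m, u⟩ x' ⟨m', u'⟩ p p' hh rfl hp hp' hy hy' (rfl : m = m')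
    have h1 : Path.Homotopic.Quotient.mk (show Path x.1 m from p') =
        Path.Homotopic.Quotient.mk (show Path x.1 m from p) :=
      Path.Homotopic.Quotient.eq.2 (hh m p' p hp' hp)
    rw [hy', hy]
    change (⟨m, (Path.Homotopic.Quotient.trans γ x.2).trans (.mk (show Path x.1 m from p'))⟩ :
      PathsFrom c) = ⟨m, Path.Homotopic.Quotient.trans γ
        (x.2.trans (.mk (show Path x.1 m from p)))⟩
    rw [h1, Path.Homotopic.Quotient.trans_assoc]
  have h1 := (continuousAt_fst (p := (a, b))).eventually (hl a V hV)
  have h2 := (continuousAt_snd (p := (a, b))).eventually (hl' b V hV')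
  filter_upwards [h1, h2] with z ⟨p, hp, hz⟩ ⟨p', hp', hz'⟩ e
  exact key _ _ _ _ p p' hVh h hp hp' hz hz' e

/-- For each loop class the set where the two families differ by it is open, and these sets
partition the connected space because the action is simply transitive on classes with a common end
point. -/
theorem IsHorizontal.exists_eq_act (hM : SemilocSimplyConn M) {A : Type*} [TopologicalSpace A]
    [PreconnectedSpace A] {l l' : A → PathsFrom c} (hl : IsHorizontal l)
    (hl' : IsHorizontal l') (h : ∀ a, (l a).1 = (l' a).1) (a : A) {γ : FundamentalGroup M c}
    (ha : l' a = (l a).act γ) (b : A) : l' b = (l b).act γ := by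
  have hcont : Continuous fun a : A => (a, a) := by fun_prop
  have hopen : ∀ γ, IsOpen {b | l' b = (l b).act γ} := fun γ => isOpen_iff_eventually.2 fun b hb => by
    filter_upwards [hcont.continuousAt.eventually (hl.eventually_eq_act hM hl' hb)] with d hd
    exact hd (h d)
  have hcl : IsClosed {b | l' b = (l b).act γ} := by
    rw [← isOpen_compl_iff]
    have : {b | l' b = (l b).act γ}ᶜ = ⋃ δ ∈ {δ | δ ≠ γ}, {b | l' b = (l b).act δ} := by
      ext b
      simp only [mem_compl_iff, mem_ofPred_eq, mem_iUnion, exists_prop]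
      constructor
      · intro hb
        obtain ⟨δ, hδ⟩ := exists_act (h b)
        exact ⟨δ, fun e => hb (e ▸ hδ), hδ⟩
      · rintro ⟨δ, hδ, hb⟩ hb'
        exact hδ ((l b).act_injective (hb.symm.trans hb'))
    rw [this]
    exact isOpen_biUnion fun δ _ => hopen δ
  have := IsClopen.eq_univ ⟨hcl, hopen γ⟩ ⟨a, ha⟩
  exact this.ge (mem_univ b)

variable {A : Type*} [TopologicalSpace A] [SimplyConnectedSpace A]

/-- The continuation of a class along a map of a simply connected space. -/
def transport (f : C(A, M)) (a : A) (u : Path.Homotopic.Quotient c (f a)) (b : A) : PathsFrom c :=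
  ⟨f b, u.trans (.mk ((PathConnectedSpace.somePath a b).map f.continuous))⟩

theorem transport_eq (f : C(A, M)) (a : A) (u : Path.Homotopic.Quotient c (f a)) {b : A}
    (p : Path a b) : transport f a u b = ⟨f b, u.trans (.mk (p.map f.continuous))⟩ := by
  have : Path.Homotopic.Quotient.mk ((PathConnectedSpace.somePath a b).map f.continuous) =
      Path.Homotopic.Quotient.mk (p.map f.continuous) :=
    Path.Homotopic.Quotient.eq.2 ((SimplyConnectedSpace.paths_homotopic _ p).map f)
  simp only [transport, this]

theorem transport_self (f : C(A, M)) (a : A) (u : Path.Homotopic.Quotient c (f a)) :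
    transport f a u a = ⟨f a, u⟩ := by
  rw [transport_eq f a u (Path.refl a)]
  have : (Path.refl a).map f.continuous = Path.refl (f a) := rfl
  simp [this]

/-- The choice of the path in the definition is immaterial, so the path to a nearby point may be
taken as the path to `b` followed by a small one. -/
theorem isHorizontal_transport [LocallyPathConnectedSpace A] (f : C(A, M)) (a : A)
    (u : Path.Homotopic.Quotient c (f a)) : IsHorizontal (transport f a u) := by
  intro b V hV
  have hV' : f ⁻¹' V ∈ 𝓝 b := f.continuous.continuousAt.preimage_mem_nhds hV
  obtain ⟨W, ⟨hW, hWc⟩, hWV⟩ := (path_connected_basis b).mem_iff.1 hV'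
  filter_upwards [hW] with d hd
  obtain ⟨p, hp⟩ := hWc.joinedIn b (mem_of_mem_nhds hW) d hd
  refine ⟨p.map f.continuous, fun t => hWV (hp t), ?_⟩
  refine (transport_eq f a u ((PathConnectedSpace.somePath a b).trans p)).trans ?_
  simp [ext, transport, Path.Homotopic.Quotient.mk_trans]

/-- Continuation along a path ends with the class of that path. This recovers an arbitrary loop
class in the proof of surjectivity. -/
theorem transport_path (f : C(unitInterval, M)) {c d : M} (h₀ : f 0 = c) (h₁ : f 1 = d)
    [SimplyConnectedSpace unitInterval] :
    transport f 0 ((Path.Homotopic.Quotient.refl c).cast rfl h₀) 1 = ⟨d, .mk ⟨f, h₀, h₁⟩⟩ := by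
  subst h₀ h₁
  rw [transport_eq f 0 _ Path.id]
  simp only [Path.Homotopic.Quotient.cast_rfl_rfl, Path.Homotopic.Quotient.refl_trans]
  rfl

end PathsFrom

/-! ### Topology of handlebodies -/

instance : SimplyConnectedSpace D2 :=
  have := Metric.contractibleSpace_closedBall (x := (0 : E2)) zero_le_one
  inferInstance

instance : SimplyConnectedSpace D3 :=
  have := Metric.contractibleSpace_closedBall (x := (0 : E3)) zero_le_one
  inferInstance

instance : SimplyConnectedSpace unitInterval :=
  have := (convex_Icc (0 : ℝ) 1).contractibleSpace ⟨0, by simp⟩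
  inferInstanceAs (SimplyConnectedSpace (Icc (0 : ℝ) 1))

instance : LocallyPathConnectedSpace D2 := (convex_closedBall _ _).locallyPathConnectedSpace
instance : LocallyPathConnectedSpace D3 := (convex_closedBall _ _).locallyPathConnectedSpace
instance : LocallyPathConnectedSpace unitInterval :=
  (convex_Icc (0 : ℝ) 1).locallyPathConnectedSpace

theorem S2.preconnectedSpace : PreconnectedSpace S2 :=
  Subtype.preconnectedSpace (isPreconnected_sphere (by
    rw [← Module.finrank_eq_rank]; simp) _ _)

/-- The boundary circle of the disc. -/
def rim : Set D2 := {z | ‖(z : E2)‖ = 1}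

theorem isPreconnected_rim : IsPreconnected rim := by
  have h : IsPreconnected (Metric.sphere (0 : E2) 1) := isPreconnected_sphere (by
    rw [← Module.finrank_eq_rank]; simp) _ _
  have h2 := (Subtype.preconnectedSpace h).isPreconnected_univ.image
    (fun x : Metric.sphere (0 : E2) 1 => (⟨x, Metric.sphere_subset_closedBall x.2⟩ : D2))
    (by fun_prop)
  convert h2
  ext z
  simp only [rim, mem_ofPred_eq, image_univ, mem_range, Subtype.exists]
  constructor
  · intro hz
    exact ⟨z, by simpa using hz, rfl⟩
  · rintro ⟨a, ha, rfl⟩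
    simpa using ha

theorem rim_nonempty : rim.Nonempty := by
  obtain ⟨v, hv⟩ := (NormedSpace.sphere_nonempty (x := (0 : E2)) (r := 1)).2 zero_le_one
  exact ⟨⟨v, Metric.sphere_subset_closedBall hv⟩, by simpa [rim] using hv⟩

namespace MeridianSystem

variable {M : Type*} [TopologicalSpace M] {g : ℕ} (H : MeridianSystem M g)

theorem continuous_bd : Continuous bd := by unfold bd; fun_prop

theorem bd_injective : Function.Injective bd := fun x y h => by
  have := congrArg (fun z : D3 => (z : E3)) h
  exact Subtype.ext this

/-- The two copies of the meridional discs in the ball. -/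
def footPt (i : Fin g) (b : Bool) (z : D2) : D3 := bd (H.foot i b z)

theorem continuous_footPt (i : Fin g) (b : Bool) : Continuous (H.footPt i b) :=
  continuous_bd.comp (H.foot i b).continuous

variable {H} in
theorem foot_eq {i k : Fin g} {b b' : Bool} {z w : D2} (h : H.foot i b z = H.foot k b' w) :
    i = k ∧ b = b' ∧ z = w := by
  simpa using H.foot_inj (a₁ := (i, b, z)) (a₂ := (k, b', w)) h

variable {H} in
theorem footPt_eq {i k : Fin g} {b b' : Bool} {z w : D2} (h : H.footPt i b z = H.footPt k b' w) :
    i = k ∧ b = b' ∧ z = w := foot_eq (bd_injective h)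

theorem glue_footPt (i : Fin g) (b : Bool) (z : D2) :
    H.glue (H.footPt i (!b) z) = H.glue (H.footPt i b z) := (H.glue_foot i b z).symm

theorem glue_footPt' (i : Fin g) (b b' : Bool) (z : D2) :
    H.glue (H.footPt i b z) = H.glue (H.footPt i b' z) := by
  rcases Bool.eq_or_eq_not b' b with rfl | rfl
  · rfl
  · exact (H.glue_footPt i b z).symm

variable {H} in
theorem glue_eq {x y : D3} (h : H.glue x = H.glue y) :
    x = y ∨ ∃ i b z, x = H.footPt i b z ∧ y = H.footPt i (!b) z := by
  rcases (H.glue_eq_iff x y).1 h with h | ⟨i, b, z, hx, hy⟩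
  · exact Or.inl h
  · exact Or.inr ⟨i, b, z, Subtype.ext hx, Subtype.ext hy⟩

variable {H} in
theorem glue_footPt_eq {i : Fin g} {b : Bool} {z : D2} {y : D3}
    (h : H.glue y = H.glue (H.footPt i b z)) : ∃ b', y = H.footPt i b' z := by
  rcases glue_eq h with h | ⟨k, b', w, hx, hy⟩
  · exact ⟨b, h⟩
  · obtain ⟨rfl, rfl, rfl⟩ := footPt_eq hy
    exact ⟨b', hx⟩

theorem finite_fiber (m : M) : (H.glue ⁻¹' {m}).Finite := by
  rcases (H.glue ⁻¹' {m}).eq_empty_or_nonempty with h | ⟨y, hy⟩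
  · simp [h]
  by_cases hf : ∃ i b z, y = H.footPt i b z
  · obtain ⟨i, b, z, rfl⟩ := hf
    refine (Set.finite_range fun b' => H.footPt i b' z).subset fun x hx => ?_
    have hx' : H.glue x = m := hx
    obtain ⟨b', rfl⟩ := glue_footPt_eq (hx'.trans hy.symm)
    exact ⟨b', rfl⟩
  · refine (Set.finite_singleton y).subset fun x hx => ?_
    have hx' : H.glue x = m := hx
    rcases glue_eq (hy.trans hx'.symm) with h | ⟨i, b, z, h1, -⟩
    · exact h.symm
    · exact absurd ⟨i, b, z, h1⟩ hf

theorem isClosedMap_glue [T2Space M] : IsClosedMap H.glue := H.glue.continuous.isClosedMap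

/-- Disjoint neighbourhoods of the copies of the meridional discs in the ball. -/
def footNhd (i : Fin g) (b : Bool) : Set D3 :=
  {y | ∀ k b', (k, b') ≠ (i, b) →
    Metric.infDist y (range (H.footPt i b)) < Metric.infDist y (range (H.footPt k b'))}

theorem isOpen_footNhd (i : Fin g) (b : Bool) : IsOpen (H.footNhd i b) := by
  have : H.footNhd i b = ⋂ k, ⋂ b', {y | (k, b') ≠ (i, b) →
      Metric.infDist y (range (H.footPt i b)) < Metric.infDist y (range (H.footPt k b'))} := by
    ext y; simp [footNhd]
  rw [this]
  refine isOpen_iInter_of_finite fun k => isOpen_iInter_of_finite fun b' => ?_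
  by_cases h : (k, b') = (i, b)
  · simp [h]
  · simp only [h, ne_eq, not_false_eq_true, forall_true_left]
    exact isOpen_lt (Metric.continuous_infDist_pt _) (Metric.continuous_infDist_pt _)

theorem footPt_mem_footNhd (i : Fin g) (b : Bool) (z : D2) : H.footPt i b z ∈ H.footNhd i b := by
  intro k b' h
  rw [Metric.infDist_zero_of_mem (mem_range_self z)]
  refine lt_of_le_of_ne Metric.infDist_nonneg fun h0 => h ?_
  have hcl : IsClosed (range (H.footPt k b')) :=
    (isCompact_range (H.continuous_footPt k b')).isClosed
  have hne : (range (H.footPt k b')).Nonempty := ⟨_, mem_range_self z⟩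
  obtain ⟨w, hw⟩ := (hcl.mem_iff_infDist_zero hne).2 h0.symm
  obtain ⟨rfl, rfl, -⟩ := footPt_eq hw
  rfl

variable {H} in
theorem footNhd_eq {i k : Fin g} {b b' : Bool} {y : D3} (h : y ∈ H.footNhd i b)
    (h' : y ∈ H.footNhd k b') : i = k ∧ b = b' := by
  by_contra hne
  have h1 : (k, b') ≠ (i, b) := fun e => hne (by simp_all)
  exact lt_asymm (h k b' h1) (h' i b (Ne.symm h1))

/-- The part of the sphere that becomes the boundary of the handlebody. -/
def outer : Set S2 := {x | ∀ i b z, H.foot i b z = x → ‖(z : E2)‖ = 1}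

theorem foot_mem_outer {i : Fin g} {b : Bool} {z : D2} : H.foot i b z ∈ H.outer ↔ z ∈ rim :=
  ⟨fun h => h i b z rfl, fun h k b' w e => by obtain ⟨rfl, rfl, rfl⟩ := foot_eq e; exact h⟩

/-- Each boundary circle of a removed disc is connected, so it lies on one side of a separation of
the remaining region. Adding the disc to that side turns the separation into one of the whole
sphere, which is connected. -/
theorem isPreconnected_outer (hcl : IsClosed H.outer) : IsPreconnected H.outer := by
  classical
  rw [isPreconnected_closed_iff]
  intro t t' ht ht' hF ⟨x, hxF, hx⟩ ⟨x', hxF', hx'⟩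
  by_contra hcon
  have hcon' : ∀ x ∈ H.outer, x ∈ t → x ∈ t' → False := fun x h h1 h2 => hcon ⟨x, h, h1, h2⟩
  have hrim : ∀ i b, (H.foot i b '' rim ⊆ t) ∨ (H.foot i b '' rim ⊆ t') := by
    intro i b
    have hp : IsPreconnected (H.foot i b '' rim) :=
      isPreconnected_rim.image _ (H.foot i b).continuous.continuousOn
    have hsub : H.foot i b '' rim ⊆ H.outer := by
      rintro _ ⟨z, hz, rfl⟩
      exact H.foot_mem_outer.2 hz
    by_contra! h
    obtain ⟨h1, h2⟩ := h
    obtain ⟨y, hy, hyt⟩ := Set.not_subset.1 h1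
    obtain ⟨y', hy', hyt'⟩ := Set.not_subset.1 h2
    obtain ⟨w, hw, hw1, hw2⟩ := (isPreconnected_closed_iff.1 hp) t t' ht ht' (hsub.trans hF)
      ⟨y', hy', (hF (hsub hy')).resolve_right hyt'⟩ ⟨y, hy, (hF (hsub hy)).resolve_left hyt⟩
    exact hcon' w (hsub hw) hw1 hw2
  let T : Set S2 → Set S2 := fun s =>
    (H.outer ∩ s) ∪ ⋃ i, ⋃ b, ⋃ (_ : H.foot i b '' rim ⊆ s), range (H.foot i b)
  have hT : ∀ s, IsClosed s → IsClosed (T s) := fun s hs =>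
    (hcl.inter hs).union (isClosed_iUnion_of_finite fun i => isClosed_iUnion_of_finite fun b =>
      isClosed_iUnion_of_finite fun _ => (isCompact_range (H.foot i b).continuous).isClosed)
  have hmem : ∀ s x, x ∈ T s ↔ (x ∈ H.outer ∧ x ∈ s) ∨
      ∃ i b, H.foot i b '' rim ⊆ s ∧ ∃ z, H.foot i b z = x := by
    intro s x; simp [T]
  have hcov : (univ : Set S2) ⊆ T t ∪ T t' := by
    intro x _
    by_cases h : ∃ i b z, H.foot i b z = x
    · obtain ⟨i, b, z, hz⟩ := h
      rcases hrim i b with h | h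
      · exact Or.inl ((hmem _ _).2 (Or.inr ⟨i, b, h, z, hz⟩))
      · exact Or.inr ((hmem _ _).2 (Or.inr ⟨i, b, h, z, hz⟩))
    · have hx : x ∈ H.outer := fun i b z e => absurd ⟨i, b, z, e⟩ h
      rcases hF hx with h | h
      · exact Or.inl ((hmem _ _).2 (Or.inl ⟨hx, h⟩))
      · exact Or.inr ((hmem _ _).2 (Or.inl ⟨hx, h⟩))
  obtain ⟨y, -, hy, hy'⟩ := (isPreconnected_closed_iff.1 S2.preconnectedSpace.isPreconnected_univ)
    (T t) (T t') (hT t ht) (hT t' ht') hcov ⟨x, trivial, (hmem _ _).2 (Or.inl ⟨hxF, hx⟩)⟩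
    ⟨x', trivial, (hmem _ _).2 (Or.inl ⟨hxF', hx'⟩)⟩
  rw [hmem] at hy hy'
  obtain ⟨w, hw⟩ := rim_nonempty
  rcases hy with ⟨h1, h2⟩ | ⟨i, b, h1, z, rfl⟩ <;> rcases hy' with ⟨h3, h4⟩ | ⟨k, b', h3, z', h4⟩
  · exact hcon' _ h1 h2 h4
  · subst h4
    exact hcon' _ h1 h2 (h3 ⟨z', H.foot_mem_outer.1 h1, rfl⟩)
  · exact hcon' _ h3 (h1 ⟨z, H.foot_mem_outer.1 h3, rfl⟩) h4
  · obtain ⟨rfl, rfl, rfl⟩ := foot_eq h4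
    exact hcon' (H.foot k b' w) (H.foot_mem_outer.2 hw) (h1 ⟨w, hw, rfl⟩) (h3 ⟨w, hw, rfl⟩)

variable {H} in
theorem mem_boundary {p : M} : p ∈ H.boundary ↔ ∃ x ∈ H.outer, H.glue (bd x) = p :=
  ⟨fun ⟨x, h1, h2⟩ => ⟨x, h2, h1⟩, fun ⟨x, h1, h2⟩ => ⟨x, h2, h1⟩⟩

variable {H} in
-- Being outside the open discs is a property of the whole fibre: the only identifications match the
-- two copies of a disc, and these preserve the rim.
theorem exists_outer {y : D3} (h : H.glue y ∈ H.boundary) :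
    ∃ x ∈ H.outer, y = bd x := by
  obtain ⟨x, hx, e⟩ := mem_boundary.1 h
  rcases glue_eq e with rfl | ⟨i, b, z, h1, rfl⟩
  · exact ⟨x, hx, rfl⟩
  · exact ⟨_, H.foot_mem_outer.2 (H.foot_mem_outer.1 (bd_injective h1 ▸ hx)), rfl⟩

end MeridianSystem

/-! ### Boundary points of embedded discs -/

/-- A circle around the origin carries no continuous logarithm. -/
theorem Complex.not_exists_log_circle {ε : ℝ} :
    ¬ ∃ L : ℝ → ℂ, Continuous L ∧ L (2 * Real.pi) = L 0 ∧
      ∀ θ : ℝ, Complex.exp (L θ) = ε * Complex.exp (θ * Complex.I) := by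
  rintro ⟨L, hL, hper, hexp⟩
  -- `L` and `L 0 + iθ` are lifts of the same curve through the exponential map with the same start,
  -- hence equal; but only the first one is the same at both ends of a turn.
  have key := Complex.isCoveringMap_exp.eq_of_comp_eq hL
    (g₂ := fun θ : ℝ => L 0 + θ * Complex.I) (by fun_prop)
    (by
      ext θ
      simp [hexp, Complex.exp_add])
    0 (by simp)
  have h1 := congrFun key (2 * Real.pi)
  rw [hper] at h1
  have h2 : ((2 * Real.pi : ℝ) : ℂ) * Complex.I = 0 := by linear_combination -h1
  have h3 : ((2 * Real.pi : ℝ) : ℂ) ≠ 0 := by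
    exact_mod_cast (by positivity : (2 * Real.pi : ℝ) ≠ 0)
  exact (mul_ne_zero h3 Complex.I_ne_zero) h2

/-- A boundary point of the round disc is an extreme point, so the disc stays convex without it. -/
theorem isSimplyConnected_punctured_nhd {z₀ : D2} (hz₀ : z₀ ∈ rim) {δ : ℝ} (hδ : 0 < δ) :
    IsSimplyConnected {z : D2 | dist z z₀ < δ ∧ z ≠ z₀} := by
  have hval : Topology.IsEmbedding (Subtype.val : D2 → E2) := Topology.IsEmbedding.subtypeVal
  rw [← hval.isSimplyConnected_image]
  have hz : (z₀ : E2) ∈ extremePoints ℝ (Metric.closedBall (0 : E2) 1) := by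
    rw [StrictConvexSpace.extremePoints_closedBall_eq_sphere]
    simpa [rim] using hz₀
  have hconv : Convex ℝ (Metric.closedBall (0 : E2) 1 \ {(z₀ : E2)}) :=
    ((convex_closedBall _ _).mem_extremePoints_iff_convex_sdiff.1 hz).2
  have heq : Subtype.val '' {z : D2 | dist z z₀ < δ ∧ z ≠ z₀} =
      (Metric.closedBall (0 : E2) 1 \ {(z₀ : E2)}) ∩ Metric.ball (z₀ : E2) δ := by
    ext x
    constructor
    · rintro ⟨z, ⟨h1, h2⟩, rfl⟩
      exact ⟨⟨z.2, fun h => h2 (Subtype.ext h)⟩, h1⟩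
    · rintro ⟨⟨h1, h2⟩, h3⟩
      exact ⟨⟨x, h1⟩, ⟨h3, fun h => h2 (congrArg Subtype.val h)⟩, rfl⟩
  rw [heq]
  have hne : ((Metric.closedBall (0 : E2) 1 \ {(z₀ : E2)}) ∩ Metric.ball (z₀ : E2) δ).Nonempty := by
    have hn : ‖(z₀ : E2)‖ = 1 := hz₀
    let t : ℝ := min (δ / 2) 1
    have ht : 0 < t := lt_min (by linarith) one_pos
    have ht1 : t ≤ 1 := min_le_right _ _
    refine ⟨(1 - t) • (z₀ : E2), ⟨?_, ?_⟩, ?_⟩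
    · rw [mem_closedBall_zero_iff, norm_smul, hn, Real.norm_eq_abs, abs_of_nonneg (by linarith)]
      linarith
    · intro h
      have h1 := congrArg norm (Set.mem_singleton_iff.1 h)
      rw [norm_smul, hn, Real.norm_eq_abs, abs_of_nonneg (by linarith)] at h1
      linarith
    · rw [Metric.mem_ball, dist_eq_norm]
      have : (1 - t) • (z₀ : E2) - z₀ = (-t) • (z₀ : E2) := by module
      rw [this, norm_smul, hn, Real.norm_eq_abs, abs_neg, abs_of_pos ht]
      have : t ≤ δ / 2 := min_le_left _ _
      linarith
  have := (hconv.inter (convex_ball (z₀ : E2) δ)).contractibleSpace hne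
  exact SimplyConnectedSpace.ofContractible _

/-- A boundary point of a disc embedded in the sphere is not an interior point of the disc. -/
theorem range_notMem_nhds_of_mem_rim (f : C(D2, S2)) (hf : Function.Injective f) {z₀ : D2}
    (hz₀ : z₀ ∈ rim) : range f ∉ 𝓝 (f z₀) := by
  intro hr
  have hdim : Fact (Module.finrank ℝ E3 = 2 + 1) := ⟨by simp⟩
  have hemb : Topology.IsEmbedding f := (f.continuous.isClosedEmbedding hf).isEmbedding
  -- If the image were a neighbourhood of `f z₀`, a small circle around that point would pull back
  -- to a closed curve in a punctured neighbourhood of `z₀`. The latter is simply connected, so the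
  -- planar coordinate `ψ` has a logarithm there, and the circle would have one too. Projecting from
  -- the antipode keeps `f z₀` in the chart.
  let st : OpenPartialHomeomorph S2 E2 := stereographic' 2 (-(f z₀))
  have hsrc : st.source = {-(f z₀)}ᶜ := stereographic'_source _
  have hz₀s : f z₀ ∈ st.source := by
    rw [hsrc]; exact ne_neg_of_mem_unit_sphere ℝ _
  have htgt : ∀ x : E2, x ∈ st.target := fun x => by simp [st]
  have hsymm : Continuous st.symm := by
    have := st.continuousOn_symm
    simpa [st, stereographic'_target, continuousOn_univ] using this
  let iso : E2 ≃ₗᵢ[ℝ] ℂ := Complex.orthonormalBasisOneI.repr.symm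
  let c₀ : ℂ → S2 := fun w => st.symm (iso.symm (w + iso (st (f z₀))))
  have hc₀ : Continuous c₀ := by
    refine hsymm.comp (iso.symm.continuous.comp (by fun_prop))
  have hc₀0 : c₀ 0 = f z₀ := by simp [c₀, st.left_inv hz₀s]
  let ψ : D2 → ℂ := fun z => iso (st (f z)) - iso (st (f z₀))
  have hψc : ∀ z w, f z = c₀ w → ψ z = w := by
    intro z w h
    simp only [ψ, h, c₀, st.right_inv (htgt _)]
    simp
  obtain ⟨δ, hδ, hδs⟩ := Metric.mem_nhds_iff.1
    (f.continuous.continuousAt.preimage_mem_nhds (st.open_source.mem_nhds hz₀s))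
  let U : Set D2 := {z : D2 | dist z z₀ < δ ∧ z ≠ z₀}
  have hUo : IsOpen U := Metric.isOpen_ball.inter isOpen_ne
  have hψ : ContinuousOn ψ U := by
    refine ContinuousOn.sub ?_ continuousOn_const
    refine iso.continuous.comp_continuousOn (st.continuousOn.comp f.continuous.continuousOn ?_)
    exact fun z hz => hδs hz.1
  have hψ0 : (0 : ℂ) ∉ ψ '' U := by
    rintro ⟨z, hz, h⟩
    have h1 : st (f z) = st (f z₀) := iso.injective (sub_eq_zero.1 h)
    exact hz.2 (hf (st.injOn (hδs hz.1) hz₀s h1))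
  obtain ⟨L, hL, hLexp⟩ := Complex.exists_continuousOn_eqOn_exp_comp
    (isSimplyConnected_punctured_nhd hz₀ hδ) hUo hψ hψ0
  have hnhds : f '' Metric.ball z₀ δ ∈ 𝓝 (f z₀) := by
    have h1 : Metric.ball z₀ δ ∈ 𝓝 z₀ := Metric.ball_mem_nhds _ hδ
    rw [hemb.isInducing.nhds_eq_comap, Filter.mem_comap] at h1
    obtain ⟨O, hO, hO'⟩ := h1
    filter_upwards [hO, hr] with y hy ⟨z, hz⟩
    exact ⟨z, hO' (by rw [mem_preimage, hz]; exact hy), hz⟩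
  have hpre : c₀ ⁻¹' (f '' Metric.ball z₀ δ) ∈ 𝓝 (0 : ℂ) :=
    hc₀.continuousAt.preimage_mem_nhds (by rw [hc₀0]; exact hnhds)
  obtain ⟨ε, hε, hεs⟩ := Metric.nhds_basis_closedBall.mem_iff.1 hpre
  have hk : ∀ θ : ℝ, ∃ z ∈ U, f z = c₀ (ε * Complex.exp (θ * Complex.I)) := by
    intro θ
    have hn : ‖(ε : ℂ) * Complex.exp (θ * Complex.I)‖ = ε := by
      rw [norm_mul, Complex.norm_exp_ofReal_mul_I, mul_one, Complex.norm_real, Real.norm_eq_abs,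
        abs_of_pos hε]
    obtain ⟨z, hz, hzf⟩ := hεs (by rw [mem_closedBall_zero_iff, hn])
    refine ⟨z, ⟨hz, fun h => ?_⟩, hzf⟩
    have h1 := hψc z _ hzf
    rw [h] at h1
    simp only [ψ, sub_self] at h1
    rw [← h1, norm_zero] at hn
    exact hε.ne hn
  choose k hkU hkf using hk
  -- The pulled back circle is continuous because the injective map `f` of a compact space is an
  -- embedding.
  have hkc : Continuous k := by
    rw [hemb.continuous_iff]
    have : f ∘ k = fun θ : ℝ => c₀ (ε * Complex.exp (θ * Complex.I)) := funext hkf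
    rw [this]
    exact hc₀.comp (by fun_prop)
  refine Complex.not_exists_log_circle (ε := ε) ⟨L ∘ k, hL.comp_continuous hkc hkU, ?_, fun θ => ?_⟩
  · have : k (2 * Real.pi) = k 0 := hf (by rw [hkf, hkf]; simp [Complex.exp_two_pi_mul_I])
    simp [this]
  · exact (hLexp (hkU θ)).trans (hψc _ _ (hkf θ))

/-! ### The two sides of a smooth curve on an oriented surface -/

/-- The determinant of two vectors of the plane. -/
def det2 (u v : E2) : ℝ := u 0 * v 1 - u 1 * v 0

theorem det2_map (A : E2 →L[ℝ] E2) (u v : E2) : det2 (A u) (A v) = A.det * det2 u v := by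
  let e := (EuclideanSpace.basisFun (Fin 2) ℝ).toBasis
  have h := e.det_comp (A : E2 →ₗ[ℝ] E2) ![u, v]
  have he : ∀ w : Fin 2 → E2, e.det w = det2 (w 0) (w 1) := by
    intro w
    simp [Module.Basis.det_apply, Matrix.det_fin_two, Module.Basis.toMatrix_apply, e, det2]
    ring
  rw [he, he] at h
  simpa using h

theorem det2_smul_add (a b : ℝ) (u n : E2) : det2 u (a • u + b • n) = b * det2 u n := by
  simp only [det2, PiLp.add_apply, PiLp.smul_apply, smul_eq_mul]; ring

/-- The linear isomorphism with the plane given by a frame. -/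
theorem exists_frameEquiv {u n : E2} (h : det2 u n ≠ 0) :
    ∃ L : (ℝ × ℝ) ≃L[ℝ] E2, ∀ p, L p = p.1 • u + p.2 • n := by
  let f : ℝ × ℝ →ₗ[ℝ] E2 :=
    (LinearMap.fst ℝ ℝ ℝ).smulRight u + (LinearMap.snd ℝ ℝ ℝ).smulRight n
  have hf : ∀ p, f p = p.1 • u + p.2 • n := fun p => by simp [f]
  have hinj : Function.Injective f := by
    rw [← LinearMap.ker_eq_bot]
    refine LinearMap.ker_eq_bot'.2 fun w hw => ?_
    rw [hf] at hw
    have h0 : w.1 * u 0 + w.2 * n 0 = 0 := by simpa using congrArg (fun z : E2 => z 0) hw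
    have h1 : w.1 * u 1 + w.2 * n 1 = 0 := by simpa using congrArg (fun z : E2 => z 1) hw
    have e1 : w.1 * det2 u n = 0 := by rw [det2]; linear_combination n 1 * h0 - n 0 * h1
    have e2 : w.2 * det2 u n = 0 := by rw [det2]; linear_combination u 0 * h1 - u 1 * h0
    exact Prod.ext ((mul_eq_zero.1 e1).resolve_right h) ((mul_eq_zero.1 e2).resolve_right h)
  refine ⟨(LinearMap.linearEquivOfInjective f hinj (by simp)).toContinuousLinearEquiv, fun p => ?_⟩
  exact hf p

section

variable {S : Type*} [TopologicalSpace S] [ChartedSpace E2 S]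

theorem ContMDiff.contDiffAt_chart {γ : ℝ → S} (h : ContMDiff 𝓘(ℝ, ℝ) (𝓡 2) ∞ γ) (s : ℝ) :
    ContDiffAt ℝ ∞ (fun x => chartAt E2 (γ s) (γ x)) s := by
  have h1 := (contMDiffAt_iff.1 (h s)).2
  rw [← contDiffWithinAt_univ]
  simpa [Function.comp_def, chartAt_self_eq] using h1

theorem ContMDiff.deriv_chart_ne_zero {γ : ℝ → S} (h : ContMDiff 𝓘(ℝ, ℝ) (𝓡 2) ∞ γ) {s : ℝ}
    (hi : mfderiv 𝓘(ℝ, ℝ) (𝓡 2) γ s ≠ 0) : deriv (fun x => chartAt E2 (γ s) (γ x)) s ≠ 0 := by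
  intro h0
  refine hi (((h s).mdifferentiableAt (by simp)).mfderiv.trans ?_)
  have h1 : fderiv ℝ (fun x => chartAt E2 (γ s) (γ x)) s = 0 := by
    ext1
    simp [h0]
  have h2 : fderivWithin ℝ (writtenInExtChartAt 𝓘(ℝ, ℝ) (𝓡 2) s γ) (range 𝓘(ℝ, ℝ))
      (extChartAt 𝓘(ℝ, ℝ) s s) = fderiv ℝ (fun x => chartAt E2 (γ s) (γ x)) s := by
    simp [writtenInExtChartAt, Function.comp_def, chartAt_self_eq]
  exact h2.trans h1

/-- Change of charts for tangent vectors of curves. -/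
theorem hasDerivAt_change_chart [IsManifold (𝓡 2) ∞ S] {e e' : OpenPartialHomeomorph S E2}
    (he : e ∈ atlas E2 S) (he' : e' ∈ atlas E2 S) {δ : ℝ → S} {t : ℝ} {v : E2}
    (hδ : ContinuousAt δ t) (h : δ t ∈ e.source) (h' : δ t ∈ e'.source)
    (hd : HasDerivAt (fun τ => e (δ τ)) v t) :
    HasDerivAt (fun τ => e' (δ τ)) (fderiv ℝ (e.symm.trans e') (e (δ t)) v) t := by
  have hsrc : e (δ t) ∈ (e.symm.trans e').source := by
    rw [OpenPartialHomeomorph.trans_source]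
    exact ⟨e.map_source h, by simpa [e.left_inv h] using h'⟩
  have hdiff : DifferentiableAt ℝ (e.symm.trans e') (e (δ t)) := by
    have h1 := contMDiffOn_of_mem_contDiffGroupoid
      (HasGroupoid.compatible (G := contDiffGroupoid ∞ (𝓡 2)) he he')
    rw [contMDiffOn_iff_contDiffOn] at h1
    exact (h1.contDiffAt ((e.symm.trans e').open_source.mem_nhds hsrc)).differentiableAt (by simp)
  refine (hdiff.hasFDerivAt.comp_hasDerivAt t hd).congr_of_eventuallyEq ?_
  filter_upwards [hδ.eventually (e.open_source.mem_nhds h)] with τ hτ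
  simp [e.left_inv hτ]

/-- The determinant of two tangent vectors has the same sign in all charts. -/
theorem exists_frameDet_eq [IsManifold (𝓡 2) ∞ S] (hS : IsOrientedAtlas S)
    {e : OpenPartialHomeomorph S E2} (he : e ∈ atlas E2 S) {γ δ : ℝ → S} {s t : ℝ} (hp : δ t = γ s)
    (hγ : ContinuousAt γ s) (hδ : ContinuousAt δ t) (h : γ s ∈ e.source)
    (hdγ : DifferentiableAt ℝ (fun x => chartAt E2 (γ s) (γ x)) s)
    (hdδ : DifferentiableAt ℝ (fun x => chartAt E2 (γ s) (δ x)) t) :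
    ∃ u v : E2, HasDerivAt (fun x => e (γ x)) u s ∧ HasDerivAt (fun x => e (δ x)) v t ∧
      ∃ c > 0, det2 u v = c * frameDet γ δ s t := by
  have hc := mem_chart_source E2 (γ s)
  have ha := chart_mem_atlas E2 (γ s)
  refine ⟨_, _, hasDerivAt_change_chart ha he hγ hc h hdγ.hasDerivAt,
    hasDerivAt_change_chart ha he hδ (hp ▸ hc) (hp ▸ h) hdδ.hasDerivAt,
    (fderiv ℝ ((chartAt E2 (γ s)).symm.trans e) (chartAt E2 (γ s) (γ s))).det, ?_, ?_⟩
  · refine hS _ ha _ he _ ?_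
    rw [OpenPartialHomeomorph.trans_source]
    exact ⟨(chartAt E2 (γ s)).map_source hc, by simpa [(chartAt E2 (γ s)).left_inv hc] using h⟩
  · rw [hp, det2_map]; rfl

/-- A smooth curve that crosses `γ` from the right to the left has values in `N true` shortly
after the crossing and in `N false` shortly before it. -/
def SidesOf (γ : ℝ → S) (s : ℝ) (N : Bool → Set S) : Prop :=
  ∀ (δ : ℝ → S) (t : ℝ), δ t = γ s → ContinuousAt δ t →
    DifferentiableAt ℝ (fun x => chartAt E2 (γ s) (δ x)) t →
    ∀ b : Bool, 0 < (if b then 1 else -1) * frameDet γ δ s t →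
      (∀ᶠ τ in 𝓝[>] t, δ τ ∈ N b) ∧ ∀ᶠ τ in 𝓝[<] t, δ τ ∈ N (!b)

/-- The curve, displaced by multiples of a fixed normal vector, gives local coordinates in which it
is an axis; the two sides are the open half rectangles. The radius `r` does not depend on `O`, so
that `O` can afterwards be chosen to avoid the part of the closed curve outside the interval of
radius `r`. -/
theorem exists_sides [IsManifold (𝓡 2) ∞ S] (hS : IsOrientedAtlas S) {γ : ℝ → S}
    (hγ : ContMDiff 𝓘(ℝ, ℝ) (𝓡 2) ∞ γ) (s₀ : ℝ)
    (hi : mfderiv 𝓘(ℝ, ℝ) (𝓡 2) γ s₀ ≠ 0) :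
    ∃ r > 0, ∀ O ∈ 𝓝 (γ s₀), ∃ N : Bool → Set S, (∀ b, IsPreconnected (N b)) ∧ (∀ b, N b ⊆ O) ∧
      (∀ b, ∀ s ∈ Ioo (s₀ - r) (s₀ + r), γ s ∉ N b) ∧
      (γ '' Ioo (s₀ - r) (s₀ + r) ∪ (N true ∪ N false) ∈ 𝓝 (γ s₀)) ∧
      ∀ᶠ s in 𝓝 s₀, SidesOf γ s N := by
  set e := chartAt E2 (γ s₀) with he
  have hea : e ∈ atlas E2 S := chart_mem_atlas E2 (γ s₀)
  have hsrc : γ s₀ ∈ e.source := mem_chart_source E2 (γ s₀)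
  have hcd : ContDiffAt ℝ ∞ (fun x => e (γ x)) s₀ := hγ.contDiffAt_chart s₀
  set u₀ : E2 := deriv (fun x => e (γ x)) s₀ with hu₀
  have hu₀ne : u₀ ≠ 0 := hγ.deriv_chart_ne_zero hi
  -- The tangent vector rotated by a right angle to the left, which makes `det2 u₀ n` the square of
  -- its length.
  let n : E2 := !₂[-(u₀ 1), u₀ 0]
  have hn : ∀ u : E2, det2 u n = u 0 * u₀ 0 + u 1 * u₀ 1 := fun u => by simp [det2, n]
  have hn0 : 0 < det2 u₀ n := by
    rw [hn]
    have h1 : u₀ 0 ≠ 0 ∨ u₀ 1 ≠ 0 := by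
      by_contra! h
      exact hu₀ne (by ext i; fin_cases i <;> simp [h.1, h.2])
    rcases h1 with h1 | h1
    · nlinarith [mul_self_pos.2 h1, mul_self_nonneg (u₀ 1)]
    · nlinarith [mul_self_pos.2 h1, mul_self_nonneg (u₀ 0)]
  let F : ℝ × ℝ → E2 := fun p => e (γ p.1) + p.2 • n
  have hF : ContDiffAt ℝ ∞ F (s₀, 0) := by
    have h1 : ContDiffAt ℝ ∞ (fun p : ℝ × ℝ => e (γ p.1)) (s₀, 0) :=
      ContDiffAt.comp (g := fun x => e (γ x)) (s₀, (0 : ℝ)) hcd contDiffAt_fst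
    exact h1.add (contDiffAt_snd.smul contDiffAt_const)
  have hFd : ∀ (s t : ℝ) (u : E2), HasDerivAt (fun x => e (γ x)) u s → det2 u n ≠ 0 →
      ∃ L : (ℝ × ℝ) ≃L[ℝ] E2, (∀ p, L p = p.1 • u + p.2 • n) ∧
        HasFDerivAt F (L : ℝ × ℝ →L[ℝ] E2) (s, t) := by
    intro s t u hu hdet
    obtain ⟨L, hL⟩ := exists_frameEquiv hdet
    refine ⟨L, hL, ?_⟩
    have h1 : HasFDerivAt (fun p : ℝ × ℝ => e (γ p.1)) _ (s, t) :=
      HasFDerivAt.comp (s, t) (g := fun x => e (γ x)) hu.hasFDerivAt hasFDerivAt_fst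
    have h2 : HasFDerivAt (fun p : ℝ × ℝ => p.2 • n) _ (s, t) :=
      (hasFDerivAt_snd (𝕜 := ℝ) (p := (s, t))).smul_const n
    refine (h1.add h2).congr_fderiv ?_
    ext1 <;> ext1 <;> simp [hL]
  obtain ⟨L₀, -, hL₀⟩ := hFd s₀ 0 u₀ (hcd.differentiableAt (by simp)).hasDerivAt hn0.ne'
  let φ := hF.toOpenPartialHomeomorph F hL₀ (by simp)
  have hφ : ∀ p, φ p = F p := fun p => rfl
  let Ψ : OpenPartialHomeomorph (ℝ × ℝ) S := φ.trans e.symm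
  have hΨ : ∀ p, Ψ p = e.symm (F p) := fun p => rfl
  have hF0 : F (s₀, 0) = e (γ s₀) := by simp [F]
  have hΨs : (s₀, (0 : ℝ)) ∈ Ψ.source := by
    rw [OpenPartialHomeomorph.trans_source]
    refine ⟨hF.mem_toOpenPartialHomeomorph_source hL₀ _, ?_⟩
    change F (s₀, 0) ∈ e.target
    rw [hF0]; exact e.map_source hsrc
  have hΨ0 : Ψ (s₀, 0) = γ s₀ := by rw [hΨ, hF0, e.left_inv hsrc]
  -- a rectangle in the domain of the parametrization
  have hγsrc : ∀ᶠ s in 𝓝 s₀, γ s ∈ e.source :=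
    hγ.continuous.continuousAt.eventually (e.open_source.mem_nhds hsrc)
  have hrect : ∀ᶠ p in 𝓝 (s₀, (0 : ℝ)), p ∈ Ψ.source ∧ γ p.1 ∈ e.source :=
    Filter.Eventually.and (Ψ.open_source.mem_nhds hΨs) ((continuousAt_fst (p := (s₀, (0 : ℝ)))).eventually hγsrc)
  obtain ⟨r, hr, hrΨ⟩ := Metric.eventually_nhds_iff.1 hrect
  have hΨγ : ∀ s, γ s ∈ e.source → Ψ (s, 0) = γ s := by
    intro s hs
    rw [hΨ]
    simp [F, e.left_inv hs]
  have hsub : ∀ p : ℝ × ℝ, |p.1 - s₀| < r → |p.2| < r → p ∈ Ψ.source ∧ γ p.1 ∈ e.source := by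
    intro p h1 h2
    refine hrΨ ?_
    rw [Prod.dist_eq, max_lt_iff]
    exact ⟨h1, by simpa [Real.dist_eq] using h2⟩
  refine ⟨r, hr, fun O hO => ?_⟩
  obtain ⟨ρ, hρ, hρO⟩ := Metric.eventually_nhds_iff.1
    ((Ψ.continuousAt hΨs).eventually (by rw [hΨ0]; exact hO) : ∀ᶠ p in 𝓝 (s₀, (0 : ℝ)), Ψ p ∈ O)
  set m := min r ρ with hm
  have hm0 : 0 < m := lt_min hr hρ
  let I : Bool → Set ℝ := fun b => if b then Ioo 0 m else Ioo (-m) 0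
  have hI : ∀ b, Convex ℝ (I b) := fun b => by cases b <;> exact convex_Ioo _ _
  have hIm : ∀ b, ∀ t ∈ I b, |t| < m ∧ t ≠ 0 := by
    intro b t ht
    cases b
    · have ht : t ∈ Ioo (-m) 0 := ht
      exact ⟨abs_lt.2 ⟨ht.1, ht.2.trans hm0⟩, ht.2.ne⟩
    · have ht : t ∈ Ioo 0 m := ht
      exact ⟨abs_lt.2 ⟨by linarith [ht.1], ht.2⟩, ht.1.ne'⟩
  let R : Bool → Set (ℝ × ℝ) := fun b => Ioo (s₀ - m) (s₀ + m) ×ˢ I b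
  have hRs : ∀ b, ∀ p ∈ R b, |p.1 - s₀| < m ∧ |p.2| < m := by
    rintro b p ⟨h1, h2⟩
    exact ⟨abs_lt.2 ⟨by linarith [h1.1], by linarith [h1.2]⟩, (hIm b _ h2).1⟩
  have hRsrc : ∀ p : ℝ × ℝ, |p.1 - s₀| < m → |p.2| < m → p ∈ Ψ.source := fun p h1 h2 =>
    (hsub p (h1.trans_le (min_le_left _ _)) (h2.trans_le (min_le_left _ _))).1
  refine ⟨fun b => Ψ '' R b, fun b => ?_, ?_, ?_, ?_, ?_⟩
  · refine IsPreconnected.image ?_ Ψ (Ψ.continuousOn.mono fun p hp =>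
      hRsrc p (hRs b p hp).1 (hRs b p hp).2)
    exact ((convex_Ioo _ _).prod (hI b)).isPreconnected
  · rintro b _ ⟨p, hp, rfl⟩
    refine hρO ?_
    rw [Prod.dist_eq, max_lt_iff]
    obtain ⟨h1, h2⟩ := hRs b p hp
    exact ⟨h1.trans_le (min_le_right _ _), by
      simpa [Real.dist_eq] using h2.trans_le (min_le_right _ _)⟩
  · rintro b s hs ⟨p, hp, hps⟩
    have hsr : |s - s₀| < r := abs_lt.2 ⟨by linarith [hs.1], by linarith [hs.2]⟩
    obtain ⟨h1, h2⟩ := hsub (s, 0) hsr (by simpa using hr)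
    rw [← hΨγ s h2] at hps
    have h3 := Ψ.injOn (hRsrc p (hRs b p hp).1 (hRs b p hp).2) h1 hps
    exact (hIm b _ hp.2).2 (by rw [h3])
  · have hbox : Ioo (s₀ - m) (s₀ + m) ×ˢ Ioo (-m) m ∈ 𝓝 (s₀, (0 : ℝ)) :=
      prod_mem_nhds (Ioo_mem_nhds (by linarith) (by linarith)) (Ioo_mem_nhds (by linarith) hm0)
    have himg := Ψ.image_mem_nhds hΨs hbox
    rw [hΨ0] at himg
    filter_upwards [himg] with x hx
    obtain ⟨⟨s, t⟩, ⟨h1, h2⟩, rfl⟩ := hx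
    rcases lt_trichotomy t 0 with ht | rfl | ht
    · exact Or.inr (Or.inr ⟨(s, t), ⟨h1, h2.1, ht⟩, rfl⟩)
    · have hs : |s - s₀| < r := (abs_lt.2 ⟨by linarith [h1.1], by linarith [h1.2]⟩ :
        |s - s₀| < m).trans_le (min_le_left _ _)
      refine Or.inl ⟨s, ⟨by linarith [(abs_lt.1 hs).1], by linarith [(abs_lt.1 hs).2]⟩, ?_⟩
      exact (hΨγ s (hsub (s, 0) hs (by simpa using hr)).2).symm
    · exact Or.inr (Or.inl ⟨(s, t), ⟨h1, ht, h2.2⟩, rfl⟩)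
  · -- test curves
    have hev1 : ∀ᶠ s in 𝓝 s₀, ContDiffAt ℝ 1 (fun x => e (γ x)) s :=
      (hcd.of_le (by simp)).eventually (by simp)
    have hev2 : ∀ᶠ s in 𝓝 s₀, 0 < det2 (deriv (fun x => e (γ x)) s) n := by
      have h1 : ContinuousAt (fun s => deriv (fun x => e (γ x)) s) s₀ := by
        have h2 := (hcd.fderiv_right (m := 0) (by simp)).continuousAt
        have h3 : (fun s => deriv (fun x => e (γ x)) s) =
            fun s => (fderiv ℝ (fun x => e (γ x)) s) 1 := by
          ext1 s; rw [fderiv_apply_one_eq_deriv]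
        rw [h3]
        exact h2.clm_apply continuousAt_const
      have h4 : ContinuousAt (fun s => det2 (deriv (fun x => e (γ x)) s) n) s₀ := by
        simp only [hn]
        have h5 : ∀ i, ContinuousAt (fun s => (deriv (fun x => e (γ x)) s) i) s₀ := fun i =>
          ((EuclideanSpace.proj i : E2 →L[ℝ] ℝ).continuous.continuousAt).comp h1
        exact ((h5 0).mul_const _).add ((h5 1).mul_const _)
      exact h4.eventually (lt_mem_nhds hn0)
    have hev3 : ∀ᶠ s in 𝓝 s₀, s ∈ Ioo (s₀ - m) (s₀ + m) :=
      Ioo_mem_nhds (by linarith) (by linarith)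
    filter_upwards [hev1, hev2, hev3] with s hs1 hs2 hs3 δ t hp hδ hdδ b hb
    have hsm : |s - s₀| < m := abs_lt.2 ⟨by linarith [hs3.1], by linarith [hs3.2]⟩
    obtain ⟨hsΨ, hse⟩ := hsub (s, 0) (hsm.trans_le (min_le_left _ _)) (by simpa using hr)
    have hse : γ s ∈ e.source := hse
    obtain ⟨u, v, hu, hv, c, hc, hdet⟩ := exists_frameDet_eq hS hea hp hγ.continuous.continuousAt hδ
      hse ((hγ.contDiffAt_chart s).differentiableAt (by simp)) hdδ
    have hu' : deriv (fun x => e (γ x)) s = u := hu.deriv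
    rw [hu'] at hs2
    obtain ⟨L, hL, hFL⟩ := hFd s 0 u hu hs2.ne'
    have hφs : (s, (0 : ℝ)) ∈ φ.source := by
      rw [OpenPartialHomeomorph.trans_source] at hsΨ
      exact hsΨ.1
    have hδe : φ.symm (e (δ t)) = (s, 0) := by
      rw [hp]
      have : e (γ s) = φ (s, 0) := by simp [hφ, F]
      rw [this, φ.left_inv hφs]
    have hsymm : HasFDerivAt φ.symm (L.symm : E2 →L[ℝ] ℝ × ℝ) (e (δ t)) := by
      refine φ.hasFDerivAt_symm ?_ (by rw [hδe]; exact hFL)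
      have : e (δ t) = φ (s, 0) := by simp [hφ, F, hp]
      rw [this]
      exact φ.map_source hφs
    have hcomp := hsymm.comp_hasDerivAt t hv
    have hsnd : HasDerivAt (fun τ => (φ.symm (e (δ τ))).2) (L.symm v).2 t :=
      HasFDerivAt.comp_hasDerivAt (f := fun τ => φ.symm (e (δ τ))) t hasFDerivAt_snd hcomp
    -- The normal component of the velocity of the test curve has the sign of the frame determinant,
    -- since `det2 u n` stays positive near `s₀`. Hence the normal coordinate changes sign in the
    -- prescribed direction.
    have hcoef : det2 u v = (L.symm v).2 * det2 u n := by
      have : v = (L.symm v).1 • u + (L.symm v).2 • n := by rw [← hL]; simp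
      conv_lhs => rw [this]
      exact det2_smul_add _ _ _ _
    have hev : ∀ᶠ τ in 𝓝 t, φ.symm (e (δ τ)) ∈ Ioo (s₀ - m) (s₀ + m) ×ˢ Ioo (-m) m ∧
        Ψ (φ.symm (e (δ τ))) = δ τ := by
      have h1 : ContinuousAt (fun τ => φ.symm (e (δ τ))) t := hcomp.continuousAt
      have h2 : ∀ᶠ τ in 𝓝 t, φ.symm (e (δ τ)) ∈ Ioo (s₀ - m) (s₀ + m) ×ˢ Ioo (-m) m := by
        refine h1.eventually ((isOpen_Ioo.prod isOpen_Ioo).mem_nhds ?_)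
        change φ.symm (e (δ t)) ∈ _
        rw [hδe]
        exact ⟨hs3, by simpa using hm0, hm0⟩
      have h3 : ∀ᶠ τ in 𝓝 t, e (δ τ) ∈ φ.target := by
        refine hv.continuousAt.eventually (φ.open_target.mem_nhds ?_)
        have : e (δ t) = φ (s, 0) := by simp [hφ, F, hp]
        change e (δ t) ∈ _
        rw [this]
        exact φ.map_source hφs
      filter_upwards [h2, h3, hδ.eventually (e.open_source.mem_nhds (hp ▸ hse))] with τ h2 h3 h4
      refine ⟨h2, ?_⟩
      have : F (φ.symm (e (δ τ))) = e (δ τ) := φ.right_inv h3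
      rw [hΨ, this, e.left_inv h4]
    have hpos : ∀ σ : ℝ, σ ≠ 0 → 0 < σ * frameDet γ δ s t →
        ∀ᶠ τ in 𝓝 t, SignType.sign (σ * (φ.symm (e (δ τ))).2) = SignType.sign (τ - t) := by
      intro σ hσ hf
      have hsnd' : HasDerivAt (fun τ => σ * (φ.symm (e (δ τ))).2) (σ * (L.symm v).2) t :=
        hsnd.const_mul σ
      refine eventually_nhdsWithin_sign_eq_of_deriv_pos ?_ (by rw [hδe]; simp)
      rw [hsnd'.deriv]
      have h1 : σ * (L.symm v).2 * det2 u n = c * (σ * frameDet γ δ s t) := by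
        linear_combination -σ * hcoef + σ * hdet
      exact pos_of_mul_pos_left (by rw [h1]; positivity) hs2.le
    have hN : ∀ b τ, φ.symm (e (δ τ)) ∈ Ioo (s₀ - m) (s₀ + m) ×ˢ Ioo (-m) m →
        Ψ (φ.symm (e (δ τ))) = δ τ → 0 < (if b then 1 else -1) * (φ.symm (e (δ τ))).2 →
        δ τ ∈ Ψ '' R b := by
      intro b τ h1 h2 h3
      refine ⟨_, ⟨h1.1, ?_⟩, h2⟩
      cases b
      · exact ⟨h1.2.1, by simpa using h3⟩
      · exact ⟨by simpa using h3, h1.2.2⟩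
    have hsig := hpos (if b then 1 else -1) (by cases b <;> simp) hb
    constructor
    · filter_upwards [nhdsWithin_le_nhds hsig, nhdsWithin_le_nhds hev, self_mem_nhdsWithin]
        with τ h1 h2 (h3 : t < τ)
      refine hN b τ h2.1 h2.2 ?_
      rwa [sign_pos (sub_pos.2 h3), sign_eq_one_iff] at h1
    · filter_upwards [nhdsWithin_le_nhds hsig, nhdsWithin_le_nhds hev, self_mem_nhdsWithin]
        with τ h1 h2 (h3 : τ < t)
      refine hN (!b) τ h2.1 h2.2 ?_
      rw [sign_neg (sub_neg.2 h3), sign_eq_neg_one_iff] at h1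
      cases b <;> simp at h1 ⊢ <;> linarith

end

theorem SidesOf.mono {S : Type*} [TopologicalSpace S] [ChartedSpace E2 S] {γ : ℝ → S} {s : ℝ}
    {N N' : Bool → Set S} (h : SidesOf γ s N) (hN : ∀ b, N b ⊆ N' b) : SidesOf γ s N' :=
  fun δ t h1 h2 h3 b hb => ⟨(h δ t h1 h2 h3 b hb).1.mono fun _ h => hN _ h,
    (h δ t h1 h2 h3 b hb).2.mono fun _ h => hN _ h⟩

/-- Along every smooth immersed curve there is a curve that crosses it from the right to the
left. -/
theorem exists_crossing_curve {S : Type*} [TopologicalSpace S] [ChartedSpace E2 S] {γ : ℝ → S}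
    (hγ : ContMDiff 𝓘(ℝ, ℝ) (𝓡 2) ∞ γ) (s : ℝ) (hi : mfderiv 𝓘(ℝ, ℝ) (𝓡 2) γ s ≠ 0) :
    ∃ δ : ℝ → S, δ 0 = γ s ∧ ContinuousAt δ 0 ∧
      DifferentiableAt ℝ (fun x => chartAt E2 (γ s) (δ x)) 0 ∧ 0 < frameDet γ δ s 0 := by
  let e := chartAt E2 (γ s)
  have hs : γ s ∈ e.source := mem_chart_source E2 (γ s)
  let u : E2 := deriv (fun x => e (γ x)) s
  have hu : u ≠ 0 := hγ.deriv_chart_ne_zero hi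
  let n : E2 := !₂[-(u 1), u 0]
  let l : ℝ → E2 := fun τ => e (γ s) + τ • n
  have hl : ∀ τ, HasDerivAt l n τ := fun τ => by
    simpa [l] using ((hasDerivAt_id τ).smul_const n).const_add (e (γ s))
  have hl0 : l 0 = e (γ s) := by simp [l]
  have htgt : l 0 ∈ e.target := by rw [hl0]; exact e.map_source hs
  have hev : (fun τ => e (e.symm (l τ))) =ᶠ[𝓝 0] l := by
    filter_upwards [(hl 0).continuousAt.eventually (e.open_target.mem_nhds htgt)] with τ hτ
    exact e.right_inv hτ
  have hd : HasDerivAt (fun τ => e (e.symm (l τ))) n 0 := (hl 0).congr_of_eventuallyEq hev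
  refine ⟨fun τ => e.symm (l τ), ?_, ?_, hd.differentiableAt, ?_⟩
  · simp only [hl0]
    exact e.left_inv hs
  · exact (e.continuousAt_symm htgt).comp (hl 0).continuousAt
  · have h1 : frameDet γ (fun τ => e.symm (l τ)) s 0 = u 0 * n 1 - u 1 * n 0 := by
      simp only [frameDet]
      rw [show deriv (fun x => chartAt E2 (γ s) (e.symm (l x))) 0 = n from hd.deriv]
    rw [h1]
    have h2 : u 0 ≠ 0 ∨ u 1 ≠ 0 := by
      by_contra! h
      exact hu (by ext i; fin_cases i <;> simp [h.1, h.2])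
    simp only [n, Matrix.cons_val_zero, Matrix.cons_val_one]
    rcases h2 with h2 | h2
    · nlinarith [mul_self_pos.2 h2, mul_self_nonneg (u 1)]
    · nlinarith [mul_self_pos.2 h2, mul_self_nonneg (u 0)]

/-! ### The copies of the discs on the two sides of the curves of the first family -/

namespace HeegaardDiagram

open MeridianSystem

variable {M : Type*} [TopologicalSpace M] {S : Type*} [TopologicalSpace S] [ChartedSpace E2 S]
  {g : ℕ} (D : HeegaardDiagram M S g)

/-- The gluing map of one of the two handlebodies. -/
abbrev q (ε : Bool) : C(D3, M) := (D.handle ε).glue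

theorem continuous_curve (ε : Bool) (i : Fin g) : Continuous (D.curve ε i) :=
  (D.curve_smooth ε i).continuous

variable {D} in
theorem mem_range_incl {ε : Bool} {y y' : D3} (h : D.q ε y = D.q (!ε) y') :
    D.q ε y ∈ range D.incl := by
  rw [← D.inter_eq]
  cases ε
  · exact ⟨⟨y', h.symm⟩, ⟨y, rfl⟩⟩
  · exact ⟨⟨y, rfl⟩, ⟨y', h.symm⟩⟩

variable {D} in
theorem exists_outer_of_mem_range {ε : Bool} {y : D3} (h : D.q ε y ∈ range D.incl) :
    ∃ x ∈ (D.handle ε).outer, y = bd x :=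
  exists_outer (by rw [D.boundary_eq]; exact h)

theorem exists_q_eq (ε : Bool) {m : M} (h : m ∈ range D.incl) :
    ∃ x ∈ (D.handle ε).outer, D.q ε (bd x) = m := by
  rw [← D.boundary_eq ε] at h
  exact mem_boundary.1 h

variable {D} in
theorem q_mem_range {ε : Bool} {x : S2} (hx : x ∈ (D.handle ε).outer) :
    D.q ε (bd x) ∈ range D.incl := by
  rw [← D.boundary_eq ε]
  exact mem_boundary.2 ⟨x, hx, rfl⟩

/-- The region consists of the points of the sphere whose images also lie in the other handlebody,
and that handlebody is compact. -/
theorem isClosed_outer [T2Space M] (ε : Bool) : IsClosed (D.handle ε).outer := by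
  have : (D.handle ε).outer = (fun x => D.q ε (bd x)) ⁻¹' range (D.q (!ε)) := by
    ext x
    constructor
    · intro hx
      obtain ⟨x', -, h⟩ := D.exists_q_eq (!ε) (q_mem_range hx)
      exact ⟨_, h⟩
    · rintro ⟨y, hy⟩
      obtain ⟨x', hx', h⟩ := exists_outer_of_mem_range (mem_range_incl hy.symm)
      rwa [bd_injective h]
  rw [this]
  exact (isCompact_range (D.q _).continuous).isClosed.preimage
    ((D.q ε).continuous.comp continuous_bd)

theorem isPreconnected_outer [T2Space M] (ε : Bool) : IsPreconnected (D.handle ε).outer :=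
  (D.handle ε).isPreconnected_outer (D.isClosed_outer ε)

theorem exists_rim (ε : Bool) (i : Fin g) (s : ℝ) :
    ∃ z ∈ rim, ∀ b, D.q ε ((D.handle ε).footPt i b z) = D.incl (D.curve ε i s) := by
  have h : D.incl (D.curve ε i s) ∈ (D.handle ε).meridian i := by
    rw [← D.curve_meridian]
    exact ⟨_, mem_range_self s, rfl⟩
  obtain ⟨z, hz, e⟩ := h
  exact ⟨z, hz, fun b => ((D.handle ε).glue_footPt' i b true z).trans e⟩

variable {D} in
theorem exists_footPt {ε : Bool} {i : Fin g} {s : ℝ} {y : D3}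
    (h : D.q ε y = D.incl (D.curve ε i s)) :
    ∃ b, ∃ z ∈ rim, y = (D.handle ε).footPt i b z := by
  obtain ⟨z, hz, e⟩ := D.exists_rim ε i s
  obtain ⟨b, rfl⟩ := glue_footPt_eq (h.trans (e true).symm)
  exact ⟨b, z, hz, rfl⟩

theorem exists_curve_eq (ε : Bool) (i : Fin g) (b : Bool) {z : D2} (hz : z ∈ rim) :
    ∃ s ∈ Ico (0 : ℝ) 1, D.incl (D.curve ε i s) = D.q ε ((D.handle ε).footPt i b z) := by
  have h : D.q ε ((D.handle ε).footPt i true z) ∈ (D.handle ε).meridian i := ⟨z, hz, rfl⟩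
  rw [← D.curve_meridian] at h
  obtain ⟨_, ⟨t, rfl⟩, e⟩ := h
  obtain ⟨s, hs, hst⟩ := (D.curve_periodic ε i).exists_mem_Ico₀ one_pos t
  exact ⟨s, hs, by rw [← hst, e]; exact (D.handle ε).glue_footPt' i true b z⟩

theorem exists_q_curve (ε η : Bool) (i : Fin g) (s : ℝ) :
    ∃ y, D.q ε y = D.incl (D.curve η i s) := by
  obtain ⟨x, -, h⟩ := D.exists_q_eq ε (mem_range_self (D.curve η i s))
  exact ⟨_, h⟩

/-- The sets of points of the surface that come from points of the ball close to the copies of the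
disc `Δ_i`. -/
def sideSet (i : Fin g) (b c : Bool) : Set S :=
  {x | ∀ y, D.q true y = D.incl x → y ∈ (D.handle true).footNhd i (c == b)}

variable {D} in
-- A test curve that crosses from right to left would enter neighbourhoods of both copies at once,
-- and these are disjoint.
theorem side_unique {i : Fin g} {s : ℝ} {b b' : Bool}
    (h : SidesOf (D.curve true i) s (D.sideSet i b))
    (h' : SidesOf (D.curve true i) s (D.sideSet i b')) : b = b' := by
  obtain ⟨δ, h0, hc, hd, hdet⟩ := exists_crossing_curve (D.curve_smooth true i) s
    (D.curve_immersed true i s)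
  have h1 := (h δ 0 h0 hc hd true (by simpa using hdet)).1
  have h2 := (h' δ 0 h0 hc hd true (by simpa using hdet)).1
  obtain ⟨τ, h3, h4⟩ := (h1.and h2).exists
  obtain ⟨x, -, hx⟩ := D.exists_q_eq true (mem_range_self (δ τ))
  simpa using (footNhd_eq (h3 _ hx) (h4 _ hx)).2

variable [T2Space M]

/-- Over each half neighbourhood of the curve the points of the first ball stay close to one copy of
the disc. The half neighbourhoods cannot share the copy, for then the other copy would fill a
neighbourhood of one of its own boundary points. The value `b` names the copy on the left. -/
theorem exists_side_local [IsManifold (𝓡 2) ∞ S] (hS : IsOrientedAtlas S) (i : Fin g) (s₀ : ℝ) :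
    ∃ b, ∀ᶠ s in 𝓝 s₀, SidesOf (D.curve true i) s (D.sideSet i b) := by
  have hT2 : T2Space S := D.isEmbedding_incl.t2Space
  set H := D.handle true with hH
  set γ := D.curve true i with hγ
  obtain ⟨r, hr, hN⟩ := exists_sides hS (D.curve_smooth true i) s₀ (D.curve_immersed true i s₀)
  obtain ⟨z, hz, hzq⟩ := D.exists_rim true i s₀
  -- a neighbourhood without points of the other curves
  let C : Set S := γ '' Icc (s₀ + r) (s₀ + 1 - r) ∪
    ⋃ k ∈ {k | k ≠ i}, D.curve true k '' Icc 0 1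
  have hC : IsClosed C := by
    refine IsClosed.union (isCompact_Icc.image (D.continuous_curve true i)).isClosed ?_
    exact (Set.toFinite _).isClosed_biUnion fun k _ =>
      (isCompact_Icc.image (D.continuous_curve true k)).isClosed
  have hsC : γ s₀ ∉ C := by
    rintro (⟨s, hs, e⟩ | h)
    · obtain ⟨-, n, hn⟩ := D.curve_disjoint true i i s₀ s e.symm
      have h1 : (0 : ℝ) < n := by linarith [hs.1]
      have h2 : (n : ℝ) < 1 := by linarith [hs.2]
      have h3 : 0 < n := by exact_mod_cast h1
      have h4 : n < 1 := by exact_mod_cast h2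
      omega
    · simp only [mem_iUnion] at h
      obtain ⟨k, hk, s, -, e⟩ := h
      exact hk (D.curve_disjoint true k i s s₀ e).1
  have hV : ∀ᶠ x in 𝓝 (γ s₀), ∀ y, D.q true y = D.incl x →
      y ∈ H.footNhd i true ∪ H.footNhd i false := by
    have h1 : ∀ᶠ m in 𝓝 (D.incl (γ s₀)), ∀ y, D.q true y = m →
        y ∈ H.footNhd i true ∪ H.footNhd i false := by
      refine H.isClosedMap_glue.eventually_nhds_fiber _ fun y hy => ?_
      obtain ⟨b, w, -, rfl⟩ := exists_footPt (D := D) (ε := true) hy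
      refine ((H.isOpen_footNhd i true).union (H.isOpen_footNhd i false)).mem_nhds ?_
      cases b
      · exact Or.inr (H.footPt_mem_footNhd i false w)
      · exact Or.inl (H.footPt_mem_footNhd i true w)
    exact D.isEmbedding_incl.continuous.continuousAt.eventually h1
  obtain ⟨N, hNc, hNO, hNγ, hNn, hNs⟩ := hN _ (inter_mem (hC.isOpen_compl.mem_nhds hsC) hV)
  have hNcurve : ∀ c k s, D.curve true k s ∉ N c := by
    intro c k s hmem
    have h1 := (hNO c hmem).1
    by_cases hk : k = i
    · subst hk
      obtain ⟨s', hs', e⟩ := (D.curve_periodic true k).exists_mem_Ico one_pos s (s₀ - r)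
      rw [e] at hmem h1
      rcases lt_or_ge s' (s₀ + r) with h2 | h2
      · rcases hs'.1.eq_or_lt with h3 | h3
        · refine h1 (Or.inl ⟨s' + 1, ⟨?_, by linarith⟩, D.curve_periodic true k s'⟩)
          by_contra h4
          have h5 : s' + 1 ∈ Ioo (s₀ - r) (s₀ + r) := ⟨by linarith, by linarith⟩
          exact hNγ c _ h5 (by rw [D.curve_periodic true k s']; exact hmem)
        · exact hNγ c s' ⟨h3, h2⟩ hmem
      · exact h1 (Or.inl ⟨s', ⟨h2, by linarith [hs'.2]⟩, rfl⟩)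
    · obtain ⟨s', hs', e⟩ := (D.curve_periodic true k).exists_mem_Ico₀ one_pos s
      refine h1 (Or.inr ?_)
      simp only [mem_iUnion]
      exact ⟨k, hk, s', Ico_subset_Icc_self hs', e.symm⟩
  -- A point of the surface with two preimages lies on a curve of the first family, and the half
  -- neighbourhoods avoid all of these.
  have huniq : ∀ c, ∀ x ∈ N c, ∀ y y', D.q true y = D.incl x → D.q true y' = D.incl x → y = y' := by
    intro c x hx y y' hy hy'
    rcases glue_eq (hy.trans hy'.symm) with h | ⟨k, b, w, rfl, -⟩
    · exact h
    · exfalso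
      have hout : D.q true (H.footPt k b w) ∈ range D.incl := ⟨x, hy.symm⟩
      obtain ⟨x', hx', e⟩ := exists_outer_of_mem_range hout
      rw [← bd_injective e] at hx'
      obtain ⟨s, -, hs⟩ := D.exists_curve_eq true k b (H.foot_mem_outer.1 hx')
      have : D.curve true k s = x := D.isEmbedding_incl.injective (hs.trans hy)
      exact hNcurve c k s (this ▸ hx)
  -- Otherwise the closed sets of points with a preimage off one of the two neighbourhoods cover the
  -- connected set `N c` and both meet it, so they have a common point there. Its only preimage lies
  -- in neither neighbourhood, contrary to `hV`.
  have hlab : ∀ c, ∃ b, ∀ x ∈ N c, ∀ y, D.q true y = D.incl x → y ∈ H.footNhd i b := by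
    intro c
    let A : Bool → Set S := fun b => D.incl ⁻¹' (D.q true '' (H.footNhd i b)ᶜ)
    have hA : ∀ b, IsClosed (A b) := fun b =>
      (H.isClosedMap_glue _ (H.isOpen_footNhd i b).isClosed_compl).preimage
        D.isEmbedding_incl.continuous
    by_contra! hcon
    obtain ⟨x₁, hx₁, y₁, hy₁, hy₁'⟩ := hcon true
    obtain ⟨x₂, hx₂, y₂, hy₂, hy₂'⟩ := hcon false
    obtain ⟨x, hx, ⟨y, hy, hyx⟩, ⟨y', hy', hyx'⟩⟩ := (isPreconnected_closed_iff.1 (hNc c)) (A true)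
      (A false) (hA true) (hA false)
      (by
        intro x hx
        obtain ⟨x', -, hx'⟩ := D.exists_q_eq true (mem_range_self x)
        by_cases h : bd x' ∈ H.footNhd i true
        · refine Or.inr ⟨_, fun h' => ?_, hx'⟩
          simpa using (footNhd_eq h h').2
        · exact Or.inl ⟨_, h, hx'⟩)
      ⟨x₁, hx₁, y₁, hy₁', hy₁⟩ ⟨x₂, hx₂, y₂, hy₂', hy₂⟩
    obtain rfl := huniq c x hx _ _ hyx hyx'
    rcases (hNO c hx).2 y hyx with h | h
    · exact hy h
    · exact hy' h
  choose l hl using hlab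
  -- If both sides used the copy `b`, the points of the sphere near the rim of the copy `!b` could
  -- lie neither over one half neighbourhood nor over the other. They would all belong to the copy
  -- `!b`, which contradicts `range_notMem_nhds_of_mem_rim`.
  have hne : l false = !(l true) := by
    by_contra hcon
    have heq : ∀ c, l c = l true := by
      intro c; cases c
      · cases h1 : l false <;> cases h2 : l true <;> simp_all
      · rfl
    set b := l true with hb
    refine range_notMem_nhds_of_mem_rim (H.foot i (!b))
      (fun w w' e => (foot_eq e).2.2) hz ?_
    obtain ⟨O, hO, hO'⟩ := (D.isEmbedding_incl.isInducing.nhds_eq_comap (γ s₀) ▸ hNn :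
      _ ∈ comap D.incl (𝓝 (D.incl (γ s₀))))
    have hc : Continuous fun x => D.q true (bd x) := (D.q true).continuous.comp continuous_bd
    have h1 : ∀ᶠ x in 𝓝 (H.foot i (!b) z), D.q true (bd x) ∈ O := by
      refine hc.continuousAt.eventually ?_
      change O ∈ 𝓝 (D.q true (H.footPt i (!b) z))
      rw [hzq]
      exact hO
    have h2 : ∀ᶠ x in 𝓝 (H.foot i (!b) z), bd x ∈ H.footNhd i (!b) :=
      continuous_bd.continuousAt.eventually
        ((H.isOpen_footNhd i (!b)).mem_nhds (H.footPt_mem_footNhd i (!b) z))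
    filter_upwards [h1, h2] with x hx1 hx2
    have hfoot : ∀ k b' w, bd x = H.footPt k b' w → x ∈ range (H.foot i (!b)) := by
      intro k b' w e
      obtain ⟨rfl, rfl⟩ := footNhd_eq hx2 (e ▸ H.footPt_mem_footNhd k b' w)
      exact ⟨w, (bd_injective e).symm⟩
    by_cases hout : x ∈ H.outer
    · obtain ⟨w, hw⟩ := q_mem_range (D := D) (ε := true) hout
      have hwN := hO' (show w ∈ D.incl ⁻¹' O by rw [mem_preimage, hw]; exact hx1)
      have hcase : ∀ c, w ∉ N c := by
        intro c hwc
        have h3 := hl c w hwc (bd x) hw.symm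
        rw [heq c] at h3
        simpa using (footNhd_eq hx2 h3).2
      rcases hwN with ⟨s, -, hs⟩ | h | h
      · obtain ⟨b', w', -, e⟩ := exists_footPt (D := D) (ε := true) (i := i) (s := s) (y := bd x)
          (by rw [← hw, ← hs])
        exact hfoot i b' w' e
      · exact absurd h (hcase _)
      · exact absurd h (hcase _)
    · simp only [outer, mem_ofPred_eq, not_forall] at hout
      obtain ⟨k, b', w, e, -⟩ := hout
      exact hfoot k b' w (congrArg bd e.symm)
  refine ⟨l true, hNs.mono fun s hs => hs.mono fun c x hx y hy => ?_⟩
  have : l c = (c == l true) := by cases c <;> simp [hne]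
  rw [← this]
  exact hl c x hx y hy

/-- For every curve of the first family, the copy of the meridional disc that is adjacent to the
left side of the curve. -/
theorem exists_side [IsManifold (𝓡 2) ∞ S] (hS : IsOrientedAtlas S) :
    ∃ β : Fin g → Bool, ∀ i s, SidesOf (D.curve true i) s (D.sideSet i (β i)) := by
  have key : ∀ i, ∃ b, ∀ s, SidesOf (D.curve true i) s (D.sideSet i b) := by
    intro i
    choose l hl using D.exists_side_local hS i
    have hlc : IsLocallyConstant l := by
      rw [IsLocallyConstant.iff_eventually_eq]
      intro s
      filter_upwards [hl s] with t ht
      exact side_unique (hl t).self_of_nhds ht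
    refine ⟨l 0, fun s => ?_⟩
    have h1 : l 0 = l s := hlc.apply_eq_of_preconnectedSpace 0 s
    rw [h1]
    exact (hl s).self_of_nhds
  choose β hβ using key
  exact ⟨β, hβ⟩

end HeegaardDiagram

/-! ### Words read along the curves of the second family -/

/-- A tube lemma for moving fibres: a condition that holds near each of the finitely many points
over `m a₀` holds at every point of the fibres over `m a` for `a` close to `a₀`. -/
theorem IsClosedMap.eventually_forall_fiber {X K A : Type*} [TopologicalSpace X]
    [TopologicalSpace K] [TopologicalSpace A] {q : K → X} (hcl : IsClosedMap q)
    (hfin : ∀ x, (q ⁻¹' {x}).Finite) {m : A → X} {a₀ : A} (hm : ContinuousAt m a₀)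
    {p : K × A → Prop} (h : ∀ y, q y = m a₀ → ∀ᶠ z in 𝓝 (y, a₀), p z) :
    ∀ᶠ a in 𝓝 a₀, ∀ y, q y = m a → p (y, a) := by
  have h' : ∀ y, ∃ U V, q y = m a₀ → U ∈ 𝓝 y ∧ V ∈ 𝓝 a₀ ∧ ∀ y' ∈ U, ∀ a ∈ V, p (y', a) := by
    intro y
    by_cases hy : q y = m a₀
    · obtain ⟨U, hU, V, hV, hUV⟩ := mem_nhds_prod_iff.1 (h y hy)
      exact ⟨U, V, fun _ => ⟨hU, hV, fun y' hy' a ha => hUV (Set.mk_mem_prod hy' ha)⟩⟩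
    · exact ⟨univ, univ, fun e => absurd e hy⟩
  choose U V hUV using h'
  have h1 : ∀ᶠ x in 𝓝 (m a₀), ∀ y, q y = x → ∃ y₀, q y₀ = m a₀ ∧ y ∈ U y₀ := by
    refine hcl.eventually_nhds_fiber _ fun y hy => ?_
    filter_upwards [(hUV y hy).1] with y' hy' using ⟨y, hy, hy'⟩
  have h2 : ∀ᶠ a in 𝓝 a₀, ∀ y ∈ q ⁻¹' {m a₀}, a ∈ V y :=
    (eventually_all_finite (hfin _)).2 fun y hy => (hUV y hy).2.1
  filter_upwards [hm.eventually h1, h2] with a h3 h4 y hy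
  obtain ⟨y₀, h5, h6⟩ := h3 y hy
  exact (hUV y₀ h5).2.2 y h6 a (h4 y₀ h5)

theorem List.filter_le_eq_append {α : Type*} {f : α → ℝ} {l : List α}
    (hl : l.Pairwise fun a b => f a ≤ f b) (s : ℝ) :
    l.filter (fun a => f a ≤ s) = l.filter (fun a => f a < s) ++ l.filter (fun a => f a = s) := by
  induction l with
  | nil => simp
  | cons a l ih =>
    have ih := ih hl.of_cons
    rcases lt_trichotomy (f a) s with h | h | h
    · simp [h.le, h, h.ne, ih]
    · have h1 : l.filter (fun b => f b < s) = [] := by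
        rw [List.filter_eq_nil_iff]
        intro b hb
        have := List.rel_of_pairwise_cons hl hb
        simpa using h ▸ this
      simp [h, ih, h1]
    · have h1 : ∀ b ∈ l, s < f b := fun b hb => h.trans_le (List.rel_of_pairwise_cons hl hb)
      have h2 : l.filter (fun b => f b < s) = [] := by
        rw [List.filter_eq_nil_iff]
        intro b hb
        simpa using (h1 b hb).le
      simp [h.not_ge, h.not_gt, h.ne', ih, h2]

namespace HeegaardDiagram

open MeridianSystem

variable {M : Type*} [TopologicalSpace M] {S : Type*} [TopologicalSpace S] [ChartedSpace E2 S]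
  {g : ℕ} (D : HeegaardDiagram M S g)

open scoped Classical in
/-- Whether the crossing is positive. -/
def isPos (c : D.Crossing) : Bool :=
  decide (0 < frameDet (D.curve true (c.1.2 true)) (D.curve false (c.1.2 false)) (c.1.1 true)
    (c.1.1 false))

/-- The letter contributed by a crossing. -/
def letter (c : D.Crossing) : FreeGroup (Fin g) :=
  FreeGroup.of (c.1.2 true) ^ (if D.isPos c then 1 else -1 : ℤ)

/-- The copy of the meridional disc next to which the second curve runs after the crossing. -/
def after (β : Fin g → Bool) (c : D.Crossing) : Bool := D.isPos c == β (c.1.2 true)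

variable {D} in
theorem crossing_ext {c d : D.Crossing} (h : D.curve false (c.1.2 false) (c.1.1 false) =
    D.curve false (d.1.2 false) (d.1.1 false)) : c = d := by
  obtain ⟨h1, h2⟩ := D.coord_unique (c.2.1 false) (d.2.1 false) h
  obtain ⟨h3, h4⟩ := D.coord_unique (c.2.1 true) (d.2.1 true) (by rw [c.2.2, d.2.2, h])
  exact Subtype.ext (Prod.ext (funext fun δ => by cases δ <;> assumption)
    (funext fun δ => by cases δ <;> assumption))

variable {D} in
theorem exists_crossing {i j : Fin g} {b : Bool} {z : D2} {t : ℝ}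
    (h : D.q true ((D.handle true).footPt i b z) = D.incl (D.curve false j t)) :
    ∃ c : D.Crossing, c.1.2 true = i ∧ c.1.2 false = j ∧
      D.curve false j (c.1.1 false) = D.curve false j t := by
  obtain ⟨x, hx, e⟩ := exists_outer_of_mem_range (D := D) (ε := true) ⟨_, h.symm⟩
  rw [← bd_injective e] at hx
  obtain ⟨s, hs, hs'⟩ := D.exists_curve_eq true i b ((D.handle true).foot_mem_outer.1 hx)
  obtain ⟨t', ht', ht''⟩ := (D.curve_periodic false j).exists_mem_Ico₀ one_pos t
  refine ⟨⟨(fun ε => if ε then s else t', fun ε => if ε then i else j), fun ε => ?_, ?_⟩, rfl, rfl,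
    ?_⟩
  · cases ε
    · exact ht'
    · exact hs
  · simp only [if_true, Bool.false_eq_true, if_false]
    rw [← ht'']
    exact D.isEmbedding_incl.injective (hs'.trans h)
  · simp [ht'']

variable {D} in
theorem crossing_footPt {c : D.Crossing} {y : D3}
    (h : D.q true y = D.incl (D.curve false (c.1.2 false) (c.1.1 false))) :
    ∃ b, ∃ z ∈ rim, y = (D.handle true).footPt (c.1.2 true) b z :=
  exists_footPt (by rw [h, c.2.2])

section

variable {D} {β : Fin g → Bool}
  (hβ : ∀ i s, SidesOf (D.curve true i) s (D.sideSet i (β i)))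

include hβ

/-- The curve of the second family serves as test curve for the sides. Transversality makes its
frame determinant nonzero, so the sign of the crossing decides in which direction it passes. -/
theorem eventually_after_pos (c : D.Crossing) :
    (∀ᶠ τ in 𝓝[>] (c.1.1 false), ∀ y, D.q true y = D.incl (D.curve false (c.1.2 false) τ) →
      y ∈ (D.handle true).footNhd (c.1.2 true) (D.after β c)) ∧
    ∀ᶠ τ in 𝓝[<] (c.1.1 false), ∀ y, D.q true y = D.incl (D.curve false (c.1.2 false) τ) →
      y ∈ (D.handle true).footNhd (c.1.2 true) (!D.after β c) := by
  have h0 := D.transverse _ _ _ _ c.2.2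
  have h := hβ (c.1.2 true) (c.1.1 true) (D.curve false (c.1.2 false)) (c.1.1 false) c.2.2.symm
    (D.continuous_curve false _).continuousAt
    (hasDerivAt_chart (D.curve_smooth false _) c.2.2.symm).differentiableAt (D.isPos c) (by
      by_cases h1 : 0 < frameDet (D.curve true (c.1.2 true)) (D.curve false (c.1.2 false))
        (c.1.1 true) (c.1.1 false)
      · simp [isPos, h1]
      · simpa [isPos, h1] using lt_of_le_of_ne (not_lt.1 h1) h0)
  refine ⟨h.1, ?_⟩
  have : (!D.after β c) = ((!D.isPos c) == β (c.1.2 true)) := by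
    rw [after]
    cases D.isPos c <;> cases β (c.1.2 true) <;> rfl
  rw [this]
  exact h.2

/-- The period is used to allow parameters outside `[0, 1)`; a crossing at parameter 0 has to be
treated at parameter 1 as well. -/
theorem eventually_after (c : D.Crossing) {t : ℝ}
    (ht : D.curve false (c.1.2 false) (c.1.1 false) = D.curve false (c.1.2 false) t) :
    (∀ᶠ τ in 𝓝[>] t, ∀ y, D.q true y = D.incl (D.curve false (c.1.2 false) τ) →
      y ∈ (D.handle true).footNhd (c.1.2 true) (D.after β c)) ∧
    ∀ᶠ τ in 𝓝[<] t, ∀ y, D.q true y = D.incl (D.curve false (c.1.2 false) τ) →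
      y ∈ (D.handle true).footNhd (c.1.2 true) (!D.after β c) := by
  obtain ⟨-, n, rfl⟩ := D.curve_disjoint false _ _ _ _ ht
  have hper : ∀ τ, D.curve false (c.1.2 false) (τ - n) = D.curve false (c.1.2 false) τ := fun τ => by
    have := (D.curve_periodic false (c.1.2 false)).int_mul n (τ - n)
    rw [← this]
    simp
  have hc : Tendsto (fun τ : ℝ => τ - n) (𝓝 (c.1.1 false + n)) (𝓝 (c.1.1 false)) := by
    have : Continuous fun τ : ℝ => τ - n := by fun_prop
    simpa using this.tendsto (c.1.1 false + n)
  have h1 : Tendsto (fun τ : ℝ => τ - n) (𝓝[>] (c.1.1 false + n)) (𝓝[>] (c.1.1 false)) :=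
    tendsto_nhdsWithin_iff.2 ⟨hc.mono_left nhdsWithin_le_nhds, by
      filter_upwards [self_mem_nhdsWithin] with τ (hτ : _ < τ)
      exact lt_sub_iff_add_lt.2 hτ⟩
  have h2 : Tendsto (fun τ : ℝ => τ - n) (𝓝[<] (c.1.1 false + n)) (𝓝[<] (c.1.1 false)) :=
    tendsto_nhdsWithin_iff.2 ⟨hc.mono_left nhdsWithin_le_nhds, by
      filter_upwards [self_mem_nhdsWithin] with τ (hτ : τ < _)
      exact sub_lt_iff_lt_add.2 hτ⟩
  refine ⟨(h1.eventually (eventually_after_pos hβ c).1).mono fun τ hτ y hy => hτ y ?_,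
    (h2.eventually (eventually_after_pos hβ c).2).mono fun τ hτ y hy => hτ y ?_⟩ <;>
  rw [hper, hy]

end

/-! ### The word along a curve as a locally constant function -/

section

variable [T2Space M]

/-- The crossings along a curve of the second family, in the order in which they are met. -/
def crossingsAlong (j : Fin g) : List D.Crossing := D.gauss.chordsAlong j

/-- The parameter of a crossing on the curve of the second family. -/
def time {D : HeegaardDiagram M S g} (c : D.Crossing) : ℝ := c.1.1 false

theorem mem_crossingsAlong {j : Fin g} {c : D.Crossing} :
    c ∈ D.crossingsAlong j ↔ c.1.2 false = j := by
  classical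
  have h : ∀ c : D.gauss.Chord, c ∈ D.gauss.chordsAlong j ↔ D.gauss.circle false c = j := by
    intro c
    rw [GaussDiagram.chordsAlong, List.mem_insertionSort]
    simp
  exact h c

theorem pairwise_crossingsAlong (j : Fin g) :
    (D.crossingsAlong j).Pairwise fun c d => time c ≤ time d := by
  classical
  have : Std.Total fun c d : D.gauss.Chord => D.gauss.pos false c ≤ D.gauss.pos false d :=
    ⟨fun c d => le_total _ _⟩
  have : IsTrans D.gauss.Chord fun c d => D.gauss.pos false c ≤ D.gauss.pos false d :=
    ⟨fun c d e => le_trans⟩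
  have h : (D.gauss.chordsAlong j).Pairwise fun c d => D.gauss.pos false c ≤ D.gauss.pos false d :=
    List.pairwise_insertionSort _ _
  exact h

theorem nodup_crossingsAlong (j : Fin g) : (D.crossingsAlong j).Nodup := by
  classical
  have h : (D.gauss.chordsAlong j).Nodup :=
    (List.perm_insertionSort _ _).nodup_iff.2 (Finset.nodup_toList _)
  exact h

theorem relator_eq (j : Fin g) :
    D.gauss.relator j = ((D.crossingsAlong j).map D.letter).prod := by
  have h : (fun c : D.gauss.Chord =>
      FreeGroup.of (D.gauss.circle true c) ^ (D.gauss.sign c : ℤ)) = D.letter := by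
    funext c
    by_cases h : 0 < frameDet (D.curve true (c.1.2 true)) (D.curve false (c.1.2 false))
      (c.1.1 true) (c.1.1 false)
    · simp [gauss, letter, isPos, h]
    · simp [gauss, letter, isPos, h]
  have h' := congrArg (fun f => ((D.gauss.chordsAlong j).map f).prod) h
  exact h'

/-- The product of the letters of the crossings with parameter less than `s`. -/
def prefixWord (j : Fin g) (s : ℝ) : FreeGroup (Fin g) :=
  (((D.crossingsAlong j).filter fun c => time c < s).map D.letter).prod

theorem prefixWord_zero (j : Fin g) : D.prefixWord j 0 = 1 := by
  have : (D.crossingsAlong j).filter (fun c => time c < 0) = [] := by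
    rw [List.filter_eq_nil_iff]
    intro c _
    exact not_lt.2 (c.2.1 false).1 ∘ of_decide_eq_true
  rw [prefixWord, this]; rfl

theorem prefixWord_one (j : Fin g) : D.prefixWord j 1 = D.gauss.relator j := by
  have : (D.crossingsAlong j).filter (fun c => time c < 1) = D.crossingsAlong j := by
    rw [List.filter_eq_self]
    intro c _
    exact decide_eq_true (c.2.1 false).2
  rw [prefixWord, this, relator_eq]

theorem eventually_pos_lt_iff (s₀ : ℝ) : ∀ᶠ s in 𝓝 s₀, ∀ c : D.Crossing, time c ≠ s₀ →
    (time c < s ↔ time c < s₀) := by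
  refine eventually_all.2 fun c => ?_
  rcases lt_trichotomy (time c) s₀ with h | h | h
  · filter_upwards [lt_mem_nhds h] with s hs _ using ⟨fun _ => h, fun _ => hs⟩
  · simp [h]
  · filter_upwards [gt_mem_nhds h] with s hs _ using
      ⟨fun h1 => absurd h1 hs.not_gt, fun h1 => absurd h1 h.not_gt⟩

/-- Only crossings strictly before the parameter are counted, so the word is continuous from the
left and changes immediately after a crossing. -/
theorem eventually_prefixWord_le (j : Fin g) (s₀ : ℝ) :
    ∀ᶠ s in 𝓝 s₀, s ≤ s₀ → D.prefixWord j s = D.prefixWord j s₀ := by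
  filter_upwards [D.eventually_pos_lt_iff s₀] with s hs hle
  rw [prefixWord, prefixWord]
  congr 2
  refine List.filter_congr fun c _ => ?_
  by_cases h : time c = s₀
  · simp [h, hle]
  · simp [hs c h]

theorem eventually_prefixWord_gt (j : Fin g) (s₀ : ℝ) :
    ∀ᶠ s in 𝓝 s₀, s₀ < s → D.prefixWord j s = D.prefixWord j s₀ *
      (((D.crossingsAlong j).filter fun c => time c = s₀).map
        D.letter).prod := by
  filter_upwards [D.eventually_pos_lt_iff s₀] with s hs hlt
  rw [prefixWord, prefixWord, ← List.prod_append, ← List.map_append,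
    ← List.filter_le_eq_append (D.pairwise_crossingsAlong j)]
  congr 2
  refine List.filter_congr fun c _ => ?_
  by_cases h : time c = s₀
  · simp [h, hlt]
  · have := lt_iff_le_and_ne (a := time c) (b := s₀)
    simp [hs c h, this, h]

theorem filter_eq_of_forall_ne {j : Fin g} {s₀ : ℝ}
    (h : ∀ c : D.Crossing, c.1.2 false = j → time c ≠ s₀) :
    (D.crossingsAlong j).filter (fun c => time c = s₀) = [] := by
  rw [List.filter_eq_nil_iff]
  intro c hc
  simpa using h c (D.mem_crossingsAlong.1 hc)

theorem filter_eq_singleton (c : D.Crossing) :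
    (D.crossingsAlong (c.1.2 false)).filter (fun d => time d = time c) =
      [c] := by
  have h1 : ∀ d ∈ (D.crossingsAlong (c.1.2 false)).filter
      (fun d => time d = time c), d = c := by
    intro d hd
    rw [List.mem_filter] at hd
    have h2 : time d = time c := by simpa using hd.2
    exact crossing_ext (by rw [show d.1.1 false = c.1.1 false from h2, D.mem_crossingsAlong.1 hd.1])
  have h2 : c ∈ (D.crossingsAlong (c.1.2 false)).filter
      (fun d => time d = time c) := by
    rw [List.mem_filter]
    exact ⟨D.mem_crossingsAlong.2 rfl, by simp⟩
  have h3 := (D.nodup_crossingsAlong (c.1.2 false)).filter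
    (fun d => time d = time c)
  have h4 := List.eq_replicate_of_mem h1
  generalize (D.crossingsAlong (c.1.2 false)).filter
    (fun d => time d = time c) = l at h1 h2 h3 h4
  rw [h4] at h3 h2 ⊢
  rw [List.nodup_replicate] at h3
  rw [List.mem_replicate] at h2
  have : l.length = 1 := by omega
  rw [this]
  rfl

open scoped Classical in
/-- The correction of the prefix word at a crossing. -/
def jump (β : Fin g → Bool) (j : Fin g) (y : D3) (s : ℝ) : FreeGroup (Fin g) :=
  if h : ∃ c : D.Crossing, c.1.2 false = j ∧ D.curve false j (c.1.1 false) = D.curve false j s ∧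
    y ∈ (D.handle true).footNhd (c.1.2 true) (D.after β c) then D.letter h.choose else 1

/-- The word read along the curve number `j` of the second family up to the parameter `s`. At a
crossing, the letter of the crossing is included if the point `y` of the ball that lies over the
crossing is on the side reached after the crossing. -/
def word (β : Fin g → Bool) (j : Fin g) (y : D3) (s : ℝ) : FreeGroup (Fin g) :=
  D.prefixWord j s * D.jump β j y s

/-- The correction depends on the parameter only through the point of the curve, hence agrees at
both ends. This also covers a crossing at parameter 0: at parameter 1 its letter is already in the
prefix, and the correction starts the next turn. -/
theorem word_one (β : Fin g → Bool) (j : Fin g) (y : D3) :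
    D.word β j y 1 = D.gauss.relator j * D.word β j y 0 := by
  have h : D.curve false j 1 = D.curve false j 0 := by
    simpa using D.curve_periodic false j 0
  have h2 : D.jump β j y 1 = D.jump β j y 0 := by
    unfold jump
    rw [h]
  rw [word, word, h2, prefixWord_zero, prefixWord_one, one_mul]

variable {D}

open scoped Classical in
theorem jump_eq {β : Fin g → Bool} (c : D.Crossing) {y : D3} {s : ℝ}
    (hs : D.curve false (c.1.2 false) (c.1.1 false) = D.curve false (c.1.2 false) s) :
    D.jump β (c.1.2 false) y s =
      if y ∈ (D.handle true).footNhd (c.1.2 true) (D.after β c) then D.letter c else 1 := by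
  by_cases h : y ∈ (D.handle true).footNhd (c.1.2 true) (D.after β c)
  · have H : ∃ d : D.Crossing, d.1.2 false = c.1.2 false ∧
        D.curve false (c.1.2 false) (d.1.1 false) = D.curve false (c.1.2 false) s ∧
        y ∈ (D.handle true).footNhd (d.1.2 true) (D.after β d) := ⟨c, rfl, hs, h⟩
    have h1 : H.choose = c := by
      refine crossing_ext ?_
      have := H.choose_spec
      rw [this.1, this.2.1, hs]
    rw [jump, dif_pos H, if_pos h, h1]
  · rw [jump, dif_neg, if_neg h]
    rintro ⟨d, h1, h2, h3⟩
    obtain rfl : d = c := crossing_ext (by rw [h1, h2, hs])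
    exact h h3

theorem jump_eq_one {β : Fin g → Bool} {j : Fin g} {y : D3} {s : ℝ} (h : ∀ c : D.Crossing,
    c.1.2 false = j → D.curve false j (c.1.1 false) ≠ D.curve false j s) : D.jump β j y s = 1 := by
  rw [jump, dif_neg]
  rintro ⟨c, h1, h2, -⟩
  exact h c h1 h2

/-- At a positive crossing the copy `β i` is the one reached afterwards and carries the letter; at a
negative one the other copy carries the inverse letter. In both cases the quotient is the generator,
so the jump does not depend on the sign. -/
theorem word_footPt {β : Fin g → Bool} {i j : Fin g} {z : D2} {s : ℝ}
    (h : D.q true ((D.handle true).footPt i true z) = D.incl (D.curve false j s)) :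
    D.word β j ((D.handle true).footPt i (β i) z) s =
      D.word β j ((D.handle true).footPt i (!β i) z) s * FreeGroup.of i := by
  obtain ⟨c, rfl, rfl, hs⟩ := exists_crossing h
  have hmem : ∀ b b', (D.handle true).footPt (c.1.2 true) b z ∈
      (D.handle true).footNhd (c.1.2 true) b' ↔ b = b' := fun b b' =>
    ⟨fun h => (footNhd_eq ((D.handle true).footPt_mem_footNhd _ b z) h).2,
      fun h => h ▸ (D.handle true).footPt_mem_footNhd _ b z⟩
  rw [word, word, jump_eq c hs, jump_eq c hs, hmem, hmem, letter, after]
  cases D.isPos c <;> cases β (c.1.2 true) <;> simp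

/-- The pairs of a parameter and a point of the ball over the point of the curve. -/
def overCurve (D : HeegaardDiagram M S g) (j : Fin g) : Set (D3 × ℝ) :=
  {r | r.2 ∈ Icc (0 : ℝ) 1 ∧ D.q true r.1 = D.incl (D.curve false j r.2)}

/-- At a crossing there are two preimages in the ball. Shortly before, the preimage is near the copy
that has not yet received the letter, shortly after it is near the one that has; following the
preimage continuously, the word never changes. -/
theorem locConstOn_word {β : Fin g → Bool}
    (hβ : ∀ i s, SidesOf (D.curve true i) s (D.sideSet i (β i))) (j : Fin g) :
    LocConstOn (D.overCurve j) fun r => D.word β j r.1 r.2 := by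
  rintro ⟨y₀, s₀⟩ ⟨hs₀, hy₀⟩
  have hT2 : T2Space S := D.isEmbedding_incl.t2Space
  have hsnd : Tendsto Prod.snd (𝓝 (y₀, s₀)) (𝓝 s₀) := continuousAt_snd
  have hne : ∀ᶠ s in 𝓝 s₀, ∀ c : D.Crossing, D.curve false j (c.1.1 false) ≠ D.curve false j s₀ →
      D.curve false j (c.1.1 false) ≠ D.curve false j s := by
    refine eventually_all.2 fun c => ?_
    by_cases h : D.curve false j (c.1.1 false) = D.curve false j s₀
    · simp [h]
    · filter_upwards [(D.continuous_curve false j).continuousAt.eventually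
        (isOpen_compl_singleton.mem_nhds (Ne.symm h) :
          ({D.curve false j (c.1.1 false)}ᶜ : Set S) ∈ 𝓝 (D.curve false j s₀))] with s hs _
      exact Ne.symm hs
  by_cases hc : ∃ c : D.Crossing, c.1.2 false = j ∧
      D.curve false j (c.1.1 false) = D.curve false j s₀
  · obtain ⟨c, rfl, hcs⟩ := hc
    obtain ⟨b, z, -, rfl⟩ := crossing_footPt (c := c) (y := y₀) (by rw [hy₀, hcs])
    have hball : ∀ᶠ s in 𝓝 s₀, |s - s₀| < 1 := by
      filter_upwards [Metric.ball_mem_nhds s₀ one_pos] with s hs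
      exact hs
    have hinj : ∀ᶠ s in 𝓝 s₀, s ≠ s₀ → ∀ y, D.jump β (c.1.2 false) y s = 1 := by
      filter_upwards [hne, hball] with s hs hs1 hss y
      refine jump_eq_one fun d hd e => ?_
      by_cases h : D.curve false (c.1.2 false) (d.1.1 false) = D.curve false (c.1.2 false) s₀
      · obtain ⟨-, n, hn⟩ := D.curve_disjoint false _ _ _ _ (h.symm.trans e)
        rw [hn, add_sub_cancel_left] at hs1
        have h0 : |n| < 1 := by exact_mod_cast hs1
        have : n = 0 := Int.abs_lt_one_iff.1 h0
        exact hss (by simp [hn, this])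
      · exact hs d h e
    have hside := eventually_after hβ c hcs
    rw [eventually_nhdsWithin_iff, eventually_nhdsWithin_iff] at hside
    have hy : ∀ᶠ y in 𝓝 ((D.handle true).footPt (c.1.2 true) b z),
        y ∈ (D.handle true).footNhd (c.1.2 true) b :=
      ((D.handle true).isOpen_footNhd _ b).mem_nhds ((D.handle true).footPt_mem_footNhd _ b z)
    filter_upwards [continuousAt_fst.eventually hy, hsnd.eventually hside.1,
      hsnd.eventually hside.2, hsnd.eventually hinj,
      hsnd.eventually (D.eventually_prefixWord_le (c.1.2 false) s₀),
      hsnd.eventually (D.eventually_prefixWord_gt (c.1.2 false) s₀)]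
      with r h1 h2 h3 h4 h5 h6 ⟨h7, h8⟩
    have hmem : ∀ y ∈ (D.handle true).footNhd (c.1.2 true) b, ∀ b',
        y ∈ (D.handle true).footNhd (c.1.2 true) b' ↔ b = b' := fun y hy b' =>
      ⟨fun h => (footNhd_eq hy h).2, fun h => h ▸ hy⟩
    have h0 : D.word β (c.1.2 false) ((D.handle true).footPt (c.1.2 true) b z) s₀ =
        D.prefixWord (c.1.2 false) s₀ * if b = D.after β c then D.letter c else 1 := by
      rw [word, jump_eq c hcs, hmem _ ((D.handle true).footPt_mem_footNhd _ b z)]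
      split_ifs <;> rfl
    simp only [h0]
    rcases lt_trichotomy r.2 s₀ with h | h | h
    · have h9 := (hmem _ h1 _).1 (h3 h r.1 h8)
      rw [word, h4 h.ne, h5 h.le, if_neg (by rw [h9]; simp)]
    · rw [h, word, jump_eq c hcs, hmem _ h1]
      split_ifs <;> rfl
    · have h9 := (hmem _ h1 _).1 (h2 h r.1 h8)
      -- A later parameter in `[0, 1]` excludes `s₀ = 1`. So `s₀` is the recorded parameter of the
      -- crossing, and the prefix does pick up its letter.
      have h10 : s₀ ∈ Ico (0 : ℝ) 1 := ⟨hs₀.1, h.trans_le h7.2⟩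
      have h11 : s₀ = c.1.1 false := (D.coord_unique h10 (c.2.1 false) hcs.symm).2
      rw [word, h4 h.ne', h6 h, if_pos h9, mul_one, show s₀ = time c from h11, filter_eq_singleton]
      simp
  · push Not at hc
    have h0 : D.word β j y₀ s₀ = D.prefixWord j s₀ := by
      rw [word, jump_eq_one hc, mul_one]
    filter_upwards [hsnd.eventually hne, hsnd.eventually (D.eventually_prefixWord_le j s₀),
      hsnd.eventually (D.eventually_prefixWord_gt j s₀)] with r h1 h2 h3 _
    simp only [h0]
    rw [word, jump_eq_one fun c hcj => h1 c (hc c hcj), mul_one]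
    rcases le_or_gt r.2 s₀ with h | h
    · exact h2 h
    · rw [h3 h, filter_eq_of_forall_ne]
      · simp
      · rintro c hcj rfl
        exact hc c hcj rfl

/-- If a locally constant function on the points over the curve jumps at the crossings like the word
read along the curve, and if it is the same after one turn, then the relator is trivial. -/
theorem relator_eq_one_of_jumps {β : Fin g → Bool}
    (hβ : ∀ i s, SidesOf (D.curve true i) s (D.sideSet i (β i))) (j : Fin g) {Γ : Type*} [Group Γ]
    (ψ : FreeGroup (Fin g) →* Γ) (f : D3 → ℝ → Γ)
    (hf : LocConstOn (D.overCurve j) fun r => f r.1 r.2)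
    (hjump : ∀ i z s, s ∈ Icc (0 : ℝ) 1 →
      D.q true ((D.handle true).footPt i true z) = D.incl (D.curve false j s) →
      f ((D.handle true).footPt i (β i) z) s =
        f ((D.handle true).footPt i (!β i) z) s * ψ (FreeGroup.of i))
    (hper : ∀ y, D.q true y = D.incl (D.curve false j 0) → f y 1 = f y 0) :
    ψ (D.gauss.relator j) = 1 := by
  -- In the quotient of `f` by the word the jumps cancel, so it depends on the parameter alone and
  -- is constant on `[0, 1]`. Over one turn `f` returns to its value while the word gains the
  -- relator.
  let k : D3 → ℝ → Γ := fun y s => f y s * (ψ (D.word β j y s))⁻¹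
  have hk : LocConstOn (D.overCurve j) fun r => k r.1 r.2 := by
    intro r hr
    filter_upwards [hf r hr, locConstOn_word hβ j r hr] with r' h1 h2 h3
    simp only [k]
    rw [h1 h3, h2 h3]
  have hk' : ∀ s ∈ Icc (0 : ℝ) 1, ∀ y y', D.q true y = D.incl (D.curve false j s) →
      D.q true y' = D.incl (D.curve false j s) → k y s = k y' s := by
    intro s hs y y' hy hy'
    rcases glue_eq (hy.trans hy'.symm) with rfl | ⟨i, b, z, rfl, rfl⟩
    · rfl
    · have h1 : D.q true ((D.handle true).footPt i true z) = D.incl (D.curve false j s) :=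
        ((D.handle true).glue_footPt' i true b z).trans hy
      have h2 : k ((D.handle true).footPt i (β i) z) s =
          k ((D.handle true).footPt i (!β i) z) s := by
        simp only [k]
        rw [hjump i z s hs h1, word_footPt h1, map_mul]
        group
      rcases Bool.eq_or_eq_not b (β i) with rfl | rfl
      · exact h2
      · rw [Bool.not_not]; exact h2.symm
  choose Y hY using fun s => D.exists_q_curve true false j s
  have hloc : IsLocallyConstant fun s : Icc (0 : ℝ) 1 => k (Y s) s := by
    rw [IsLocallyConstant.iff_eventually_eq]
    intro s
    have h1 : ContinuousAt (fun s : Icc (0 : ℝ) 1 => D.incl (D.curve false j s)) s :=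
      (D.isEmbedding_incl.continuous.comp ((D.continuous_curve false j).comp
        continuous_subtype_val)).continuousAt
    have h2 := (D.handle true).isClosedMap_glue.eventually_forall_fiber
      (D.handle true).finite_fiber h1 (p := fun z : D3 × Icc (0 : ℝ) 1 =>
        (z.1, (z.2 : ℝ)) ∈ D.overCurve j → k z.1 z.2 = k (Y s) s) (by
      intro y hy
      have hc : ContinuousAt (fun z : D3 × Icc (0 : ℝ) 1 => (z.1, (z.2 : ℝ))) (y, s) := by fun_prop
      filter_upwards [hc.eventually (hk (y, s) ⟨s.2, hy⟩)] with z hz hz'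
      exact (hz hz').trans (hk' s s.2 _ _ hy (hY s)))
    filter_upwards [h2] with t ht
    exact ht (Y t) (hY t) ⟨t.2, hY t⟩
  have hpre : PreconnectedSpace (Icc (0 : ℝ) 1) := Subtype.preconnectedSpace isPreconnected_Icc
  have h01 := hloc.apply_eq_of_preconnectedSpace ⟨0, by simp⟩ ⟨1, by simp⟩
  have h10 : D.curve false j 1 = D.curve false j 0 := by
    simpa using D.curve_periodic false j 0
  simp only at h01
  rw [hk' 1 (by simp) _ (Y 0) (hY 1) (by rw [hY, h10])] at h01
  simp only [k] at h01
  rw [hper _ (hY 0), word_one, map_mul] at h01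
  have h3 := mul_left_cancel h01
  rw [mul_inv_rev, eq_comm, mul_eq_left, inv_eq_one] at h3
  exact h3

end

end HeegaardDiagram

/-! ### The relators are trivial in the fundamental group -/

namespace MeridianSystem

variable {M : Type*} [TopologicalSpace M] {g : ℕ} (H : MeridianSystem M g)

/-- The classes of the radial paths. -/
def radial (y : D3) : PathsFrom H.center :=
  PathsFrom.transport H.glue origin3 (Path.Homotopic.Quotient.refl H.center) y

theorem isHorizontal_radial : PathsFrom.IsHorizontal H.radial :=
  PathsFrom.isHorizontal_transport _ _ _

theorem radial_origin : H.radial origin3 = ⟨H.center, Path.Homotopic.Quotient.refl H.center⟩ :=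
  PathsFrom.transport_self _ _ _

/-- The class of the dual loop. -/
def dual (i : Fin g) (b : Bool) : FundamentalGroup M H.center :=
  FundamentalGroup.fromPath ⟦H.dualLoop i b⟧

/-- At the centre of the disc this is the construction of the dual loop; elsewhere it follows
because the disc is connected and both sides are horizontal over it. -/
theorem radial_footPt (hM : SemilocSimplyConn M) (i : Fin g) (b : Bool) (z : D2) :
    H.radial (H.footPt i b z) = (H.radial (H.footPt i (!b) z)).act (H.dual i b) := by
  refine PathsFrom.IsHorizontal.exists_eq_act hM (l := H.radial ∘ H.footPt i (!b))
    (l' := H.radial ∘ H.footPt i b) (H.isHorizontal_radial.comp (H.continuous_footPt i _))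
    (H.isHorizontal_radial.comp (H.continuous_footPt i _)) (fun a => H.glue_footPt i b a)
    origin2 ?_ z
  have h1 : ∀ b, H.radial (H.footPt i b origin2) =
      ⟨_, .mk ((radius (H.foot i b origin2)).map H.glue.continuous)⟩ := fun b => by
    refine (PathsFrom.transport_eq H.glue origin3 _ (radius (H.foot i b origin2))).trans ?_
    exact congrArg (Sigma.mk _) (Path.Homotopic.Quotient.refl_trans _)
  have key : ∀ {m m' : M} (A : Path H.center m) (B : Path H.center m') (h : m = m'),
      (⟨m, .mk A⟩ : PathsFrom H.center) =
        PathsFrom.act ⟨m', .mk B⟩ (FundamentalGroup.fromPath ⟦A.trans (B.symm.cast h rfl)⟧) := by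
    intro m m' A B h
    subst h
    change (⟨m, .mk A⟩ : PathsFrom H.center) = ⟨m, Path.Homotopic.Quotient.trans
      (Path.Homotopic.Quotient.mk (A.trans B.symm)) (.mk B)⟩
    simp [Path.Homotopic.Quotient.mk_trans, Path.Homotopic.Quotient.mk_symm]
  simp only [Function.comp_apply, h1]
  exact key _ _ _

/-- The homomorphism that sends the generators to the classes of the dual loops. -/
def dualHom (β : Fin g → Bool) : FreeGroup (Fin g) →* FundamentalGroup M H.center :=
  FreeGroup.lift fun i => H.dual i (β i)

end MeridianSystem

namespace HeegaardDiagram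

open MeridianSystem

variable {M : Type*} [TopologicalSpace M] {S : Type*} [TopologicalSpace S] [ChartedSpace E2 S]
  {g : ℕ} {D : HeegaardDiagram M S g}

/-- The curves of the diagram lift to the boundary circles of the discs. -/
theorem exists_lift_curve [T2Space M] (ε : Bool) (j : Fin g) :
    ∃ z : ℝ → D2, Continuous z ∧ (∀ s, z s ∈ rim) ∧ z 1 = z 0 ∧
      ∀ s b, D.q ε ((D.handle ε).footPt j b (z s)) = D.incl (D.curve ε j s) := by
  choose z hz hzq using D.exists_rim ε j
  have hinj : Function.Injective fun w => D.q ε ((D.handle ε).footPt j true w) := by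
    intro w w' h
    rcases glue_eq h with h | ⟨i, b, v, h1, h2⟩
    · exact (footPt_eq h).2.2
    · exact (footPt_eq h1).2.2.trans (footPt_eq h2).2.2.symm
  have hemb := (((D.q ε).continuous.comp ((D.handle ε).continuous_footPt j true)).isClosedEmbedding
    hinj).isEmbedding
  refine ⟨z, ?_, hz, hinj ?_, hzq⟩
  · rw [hemb.continuous_iff]
    have : (fun w => D.q ε ((D.handle ε).footPt j true w)) ∘ z = fun s => D.incl (D.curve ε j s) :=
      funext fun s => hzq s true
    exact this ▸ D.isEmbedding_incl.continuous.comp (D.continuous_curve ε j)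
  · have h10 : D.curve ε j 1 = D.curve ε j 0 := by simpa using D.curve_periodic ε j 0
    simp only [hzq, h10]

-- The classes `μ` are continued over the disc that the curve bounds in the second handlebody, so
-- they close up after one turn. The loop class `f y s` by which the radial class at `y` differs
-- from `μ s` is locally constant and jumps by the dual loop between the two copies of a disc of the
-- first family.
open scoped Classical in
theorem dualHom_relator [T2Space M] (hM : SemilocSimplyConn M) {β : Fin g → Bool}
    (hβ : ∀ i s, SidesOf (D.curve true i) s (D.sideSet i (β i))) (j : Fin g) :
    (D.handle true).dualHom β (D.gauss.relator j) = 1 := by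
  obtain ⟨z, hzc, -, hz10, hz⟩ := D.exists_lift_curve false j
  obtain ⟨y₀, hy₀⟩ := D.exists_q_curve true false j 0
  let F : C(D2, M) := (D.q false).comp ⟨_, (D.handle false).continuous_footPt j true⟩
  have hF : D.q true y₀ = F (z 0) := hy₀.trans (hz 0 true).symm
  let ν : D2 → PathsFrom (D.handle true).center := PathsFrom.transport F (z 0)
    (Path.Homotopic.Quotient.cast ((D.handle true).radial y₀).2 rfl hF.symm)
  let μ : ℝ → PathsFrom (D.handle true).center := ν ∘ z
  have hμ : PathsFrom.IsHorizontal μ := (PathsFrom.isHorizontal_transport _ _ _).comp hzc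
  have hμ1 : ∀ s, (μ s).1 = D.incl (D.curve false j s) := fun s => hz s true
  have hex : ∀ y s, D.q true y = D.incl (D.curve false j s) →
      ∃ γ, (D.handle true).radial y = (μ s).act γ := fun y s h =>
    PathsFrom.exists_act ((hμ1 s).trans h.symm)
  let f : D3 → ℝ → FundamentalGroup M (D.handle true).center := fun y s =>
    if h : D.q true y = D.incl (D.curve false j s) then (hex y s h).choose else 1
  have hf : ∀ y s, D.q true y = D.incl (D.curve false j s) →
      (D.handle true).radial y = (μ s).act (f y s) := fun y s h => by
    simp only [f, dif_pos h]
    exact (hex y s h).choose_spec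
  refine relator_eq_one_of_jumps hβ j ((D.handle true).dualHom β) f ?_ ?_ ?_
  · rintro ⟨y, s⟩ ⟨-, h⟩
    have h1 := hμ.eventually_eq_act hM (D.handle true).isHorizontal_radial (hf y s h)
    have h2 : Tendsto Prod.swap (𝓝 (y, s)) (𝓝 (s, y)) := continuous_swap.continuousAt
    filter_upwards [h2.eventually h1] with r hr h3
    replace h3 := h3.2
    exact (μ r.2).act_injective ((hf r.1 r.2 h3).symm.trans (hr ((hμ1 _).trans h3.symm)))
  · intro i w s hs h
    have h' : ∀ b, D.q true ((D.handle true).footPt i b w) = D.incl (D.curve false j s) := fun b =>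
      ((D.handle true).glue_footPt' i b true w).trans h
    refine (μ s).act_injective ?_
    rw [← hf _ _ (h' _), PathsFrom.act_mul, ← hf _ _ (h' _), radial_footPt _ hM, dualHom,
      FreeGroup.lift_apply_of]
  · intro y hy
    have h10 : D.curve false j 1 = D.curve false j 0 := by
      simpa using D.curve_periodic false j 0
    have h2 : μ 1 = μ 0 := congrArg ν hz10
    refine (μ 0).act_injective ?_
    rw [← hf y 0 hy, ← h2, ← hf y 1 (by rw [hy, h10])]

/-- The homomorphism from the presented group to the fundamental group. -/
def presentedHom [T2Space M] (hM : SemilocSimplyConn M) {β : Fin g → Bool}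
    (hβ : ∀ i s, SidesOf (D.curve true i) s (D.sideSet i (β i))) :
    PresentedGroup (range D.gauss.relator) →* FundamentalGroup M (D.handle true).center :=
  PresentedGroup.toGroup (f := fun i => (D.handle true).dual i (β i)) (by
    rintro _ ⟨j, rfl⟩
    exact dualHom_relator hM hβ j)

theorem presentedHom_of [T2Space M] (hM : SemilocSimplyConn M) {β : Fin g → Bool}
    (hβ : ∀ i s, SidesOf (D.curve true i) s (D.sideSet i (β i))) (i : Fin g) :
    presentedHom hM hβ (PresentedGroup.of i) = (D.handle true).dual i (β i) :=
  PresentedGroup.toGroup.of _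

end HeegaardDiagram

/-! ### Cocycles for the gluing of the balls -/

theorem LocConstOn.comp {A B P : Type*} [TopologicalSpace A] [TopologicalSpace B] {R : Set B}
    {f : B → P} (h : LocConstOn R f) {R' : Set A} {φ : A → B} (hφ : Continuous φ)
    (hR : MapsTo φ R' R) : LocConstOn R' fun a => f (φ a) := fun a ha => by
  filter_upwards [hφ.continuousAt.eventually (h _ (hR ha))] with b hb hb' using hb (hR hb')

namespace IsLocConstCocycle

/-- The cocycle identity is automatic for quotients of a potential. The potentials themselves may be
discontinuous; all the content is in the local constancy of the quotients on the fibre products. -/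
theorem of_sum {X A B P : Type*} [TopologicalSpace A] [TopologicalSpace B] [Group P]
    {q : A → X} {q' : B → X} {w : A → P} {w' : B → P}
    (h₁ : LocConstOn {r : A × A | q r.1 = q r.2} fun r => w r.1 * (w r.2)⁻¹)
    (h₁₂ : LocConstOn {r : A × B | q r.1 = q' r.2} fun r => w r.1 * (w' r.2)⁻¹)
    (h₂ : LocConstOn {r : B × B | q' r.1 = q' r.2} fun r => w' r.1 * (w' r.2)⁻¹) :
    IsLocConstCocycle (Sum.elim q q') fun a b => Sum.elim w w' a * (Sum.elim w w' b)⁻¹ := by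
  refine ⟨fun a b c _ _ => by group, ?_⟩
  rintro ⟨a | a, b | b⟩ hab
  · have e := ((IsOpenEmbedding.inl : IsOpenEmbedding (Sum.inl : A → A ⊕ B)).prodMap
      (IsOpenEmbedding.inl : IsOpenEmbedding (Sum.inl : A → A ⊕ B))).map_nhds_eq (a, b)
    rw [Prod.map_apply] at e
    rw [← e, eventually_map]
    exact h₁ (a, b) hab
  · have e := ((IsOpenEmbedding.inl : IsOpenEmbedding (Sum.inl : A → A ⊕ B)).prodMap
      (IsOpenEmbedding.inr : IsOpenEmbedding (Sum.inr : B → A ⊕ B))).map_nhds_eq (a, b)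
    rw [Prod.map_apply] at e
    rw [← e, eventually_map]
    exact h₁₂ (a, b) hab
  · have e := ((IsOpenEmbedding.inr : IsOpenEmbedding (Sum.inr : B → A ⊕ B)).prodMap
      (IsOpenEmbedding.inl : IsOpenEmbedding (Sum.inl : A → A ⊕ B))).map_nhds_eq (a, b)
    rw [Prod.map_apply] at e
    rw [← e, eventually_map]
    filter_upwards [(continuous_swap.continuousAt (x := (a, b))).eventually
      (h₁₂ (b, a) (Eq.symm hab))] with r hr hr'
    have := congrArg (·⁻¹) (hr (Eq.symm hr'))
    simpa using this
  · have e := ((IsOpenEmbedding.inr : IsOpenEmbedding (Sum.inr : B → A ⊕ B)).prodMap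
      (IsOpenEmbedding.inr : IsOpenEmbedding (Sum.inr : B → A ⊕ B))).map_nhds_eq (a, b)
    rw [Prod.map_apply] at e
    rw [← e, eventually_map]
    exact h₂ (a, b) hab

/-- A cocycle over the sphere is a coboundary. -/
theorem exists_trivialization {K P : Type*} [TopologicalSpace K] [T2Space K] [CompactSpace K]
    [Group P] {q : K → S2} {τ : K → K → P} (h : IsLocConstCocycle q τ) (hc : Continuous q)
    (hfin : ∀ x, (q ⁻¹' {x}).Finite) (hs : Function.Surjective q) :
    ∃ κ : K → P, (∀ a, ∀ᶠ b in 𝓝 a, κ b = κ a) ∧ ∀ a b, q a = q b → κ a = τ a b * κ b := by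
  obtain ⟨E, _, p, mk, cov, hmk, hp, hmk_eq, hmk_surj⟩ :=
    h.exists_isCoveringMap hc hc.isClosedMap hfin hs
  obtain ⟨σ, hσ, hpσ⟩ := cov.exists_section_sphere fun x => by
    obtain ⟨a, rfl⟩ := hs x
    exact ⟨mk a 1, hp a 1⟩
  have hex : ∀ a, ∃ k, mk a k = σ (q a) := fun a => by
    obtain ⟨b, l, hb⟩ := hmk_surj (σ (q a))
    have : q a = q b := by rw [← hp b l, hb, hpσ]
    exact ⟨τ a b * l, hb ▸ (hmk_eq _ _ _ _).2 ⟨this, rfl⟩⟩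
  choose κ hκ using hex
  refine ⟨κ, fun a => ?_, fun a b hab => ((hmk_eq _ _ _ _).1 (by rw [hκ, hκ, hab])).2⟩
  obtain ⟨U, hU, haU, hinj⟩ := (cov.isLocalHomeomorph.isLocallyInjective) (mk a (κ a))
  have h1 := ((hmk (κ a)).continuousAt (x := a)).eventually (hU.mem_nhds haU)
  have h2 : ContinuousAt (fun b => σ (q b)) a := (hσ.comp hc).continuousAt
  rw [hκ] at haU
  filter_upwards [h1, h2.eventually (hU.mem_nhds haU)] with b hb hb'
  have h3 := hinj hb hb' (by rw [hp, hpσ])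
  rw [← hκ] at h3
  have := ((hmk_eq _ _ _ _).1 h3).2
  rw [this, h.self, one_mul]

end IsLocConstCocycle

/-! ### Potentials on the balls and on the sphere of the second ball -/

namespace MeridianSystem

variable {M : Type*} [TopologicalSpace M] {g : ℕ} (H : MeridianSystem M g)

theorem isClosed_range_footPt (i : Fin g) (b : Bool) : IsClosed (range (H.footPt i b)) :=
  (isCompact_range (H.continuous_footPt i b)).isClosed

/-- Near a diagonal pair the fibre product contains diagonal pairs only, and near a pair of opposite
copies only matching points of the same disc. Hence the values of `w` off the copies do not matter.
-/
theorem locConstOn_foot {P : Type*} [Group P] {w : D3 → P} {C : Fin g → Bool → P}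
    (hw : ∀ i b z, w (H.footPt i b z) * (w (H.footPt i (!b) z))⁻¹ = C i b) :
    LocConstOn {r : D3 × D3 | H.glue r.1 = H.glue r.2} fun r => w r.1 * (w r.2)⁻¹ := by
  rintro ⟨x, x'⟩ h
  rcases glue_eq h with (rfl : x = x') | ⟨i, b, z, hx, hx'⟩
  · have : ∀ᶠ r in 𝓝 (x, x), H.glue r.1 = H.glue r.2 → r.1 = r.2 := by
      by_cases hf : ∃ i b z, x = H.footPt i b z
      · obtain ⟨i, b, z, rfl⟩ := hf
        have hN := (H.isOpen_footNhd i b).mem_nhds (H.footPt_mem_footNhd i b z)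
        filter_upwards [prod_mem_nhds hN hN] with r hr hr'
        rcases glue_eq hr' with h | ⟨k, c, v, h1, h2⟩
        · exact h
        · have e1 := footNhd_eq hr.1 (h1 ▸ H.footPt_mem_footNhd k c v)
          have e2 := footNhd_eq hr.2 (h2 ▸ H.footPt_mem_footNhd k (!c) v)
          have := e1.2.symm.trans e2.2
          simp at this
      · have hN : ∀ᶠ y in 𝓝 x, ∀ i b, y ∉ range (H.footPt i b) :=
          eventually_all.2 fun i => eventually_all.2 fun b =>
            (H.isClosed_range_footPt i b).isOpen_compl.mem_nhds
              fun ⟨z, hz⟩ => hf ⟨i, b, z, hz.symm⟩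
        filter_upwards [(continuousAt_fst (p := (x, x))).eventually hN] with r hr hr'
        rcases glue_eq hr' with h | ⟨k, c, v, h1, h2⟩
        · exact h
        · exact absurd ⟨v, h1.symm⟩ (hr k c)
    filter_upwards [this] with r hr hr'
    rw [hr hr', mul_inv_cancel, mul_inv_cancel]
  · obtain rfl : x = _ := hx
    obtain rfl : x' = _ := hx'
    filter_upwards [prod_mem_nhds ((H.isOpen_footNhd i b).mem_nhds (H.footPt_mem_footNhd i b z))
      ((H.isOpen_footNhd i (!b)).mem_nhds (H.footPt_mem_footNhd i (!b) z))] with r hr hr'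
    simp only [hw]
    rcases glue_eq hr' with h | ⟨k, c, v, h1, h2⟩
    · have := (footNhd_eq hr.1 (h ▸ hr.2)).2
      simp at this
    · obtain ⟨rfl, rfl⟩ := footNhd_eq hr.1 (h1 ▸ H.footPt_mem_footNhd k c v)
      rw [h1, h2, hw]

open scoped Classical in
/-- The potential of the cocycle of the first handlebody. -/
def weight (β : Fin g → Bool) (y : D3) : FreeGroup (Fin g) :=
  if h : ∃ i z, y = H.footPt i (β i) z then (FreeGroup.of h.choose)⁻¹ else 1

theorem weight_footPt (β : Fin g → Bool) (i : Fin g) (b : Bool) (z : D2) :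
    H.weight β (H.footPt i b z) = if b = β i then (FreeGroup.of i)⁻¹ else 1 := by
  by_cases hb : b = β i
  · have h : ∃ k v, H.footPt i b z = H.footPt k (β k) v := ⟨i, z, by rw [hb]⟩
    rw [weight, dif_pos h, if_pos hb]
    obtain ⟨v, hv⟩ := h.choose_spec
    rw [← (footPt_eq hv).1]
  · rw [weight, dif_neg, if_neg hb]
    rintro ⟨k, v, h⟩
    obtain ⟨rfl, h', -⟩ := footPt_eq h
    exact hb h'

end MeridianSystem

namespace HeegaardDiagram

open MeridianSystem

variable {M : Type*} [TopologicalSpace M] [T2Space M] {S : Type*} [TopologicalSpace S]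
  [ChartedSpace E2 S] {g : ℕ} (D : HeegaardDiagram M S g)

/-- The presented group of the diagram. -/
abbrev presented : Type := PresentedGroup (range D.gauss.relator)

/-- The potential of the cocycle of the first handlebody in the presented group. -/
def pweight (β : Fin g → Bool) (y : D3) : D.presented :=
  PresentedGroup.mk _ ((D.handle true).weight β y)

theorem pweight_footPt (β : Fin g → Bool) (i : Fin g) (b : Bool) (z : D2) :
    D.pweight β ((D.handle true).footPt i b z) =
      if b = β i then (PresentedGroup.of i)⁻¹ else 1 := by
  rw [pweight, weight_footPt]
  split_ifs
  · rw [map_inv]; rfl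
  · rw [map_one]

/-- The word read along a curve of the second family, as an element of the presented group. -/
def pword (β : Fin g → Bool) (j : Fin g) (y : D3) (s : ℝ) : D.presented :=
  PresentedGroup.mk _ (D.word β j y s)

variable {D}

/-- The potential cancels the jump of the word between the two copies of a disc, and the relator,
which is trivial in the presented group, is the only difference between the parameters 0 and 1. So
the product is a function of the point of `M`. -/
theorem pword_mul_pweight {β : Fin g → Bool} {j : Fin g} {y y' : D3} {s s' : ℝ}
    (hs : s ∈ Icc (0 : ℝ) 1) (hs' : s' ∈ Icc (0 : ℝ) 1)
    (h : D.q true y = D.incl (D.curve false j s)) (h' : D.q true y' = D.incl (D.curve false j s'))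
    (hyy' : D.q true y = D.q true y') :
    D.pword β j y s * D.pweight β y = D.pword β j y' s' * D.pweight β y' := by
  have h1 : D.pword β j y s * D.pweight β y = D.pword β j y' s * D.pweight β y' := by
    rcases glue_eq hyy' with rfl | ⟨i, b, z, rfl, rfl⟩
    · rfl
    · have h1 : D.q true ((D.handle true).footPt i true z) = D.incl (D.curve false j s) :=
        ((D.handle true).glue_footPt' i true b z).trans h
      have h2 := word_footPt (β := β) h1
      have h3 : D.pword β j ((D.handle true).footPt i (β i) z) s *
          D.pweight β ((D.handle true).footPt i (β i) z) =
          D.pword β j ((D.handle true).footPt i (!β i) z) s *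
          D.pweight β ((D.handle true).footPt i (!β i) z) := by
        rw [pword, pword, h2, pweight_footPt, pweight_footPt, map_mul]
        simp [PresentedGroup.of]
      rcases Bool.eq_or_eq_not b (β i) with rfl | rfl
      · exact h3
      · rw [Bool.not_not]; exact h3.symm
  rw [h1]
  congr 1
  have h01 : D.pword β j y' 1 = D.pword β j y' 0 := by
    have : PresentedGroup.mk (range D.gauss.relator) (D.gauss.relator j) = 1 :=
      (PresentedGroup.mk_eq_one_iff).2 (Subgroup.subset_normalClosure (mem_range_self j))
    rw [pword, word_one, map_mul, this, one_mul, pword]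
  obtain ⟨-, n, rfl⟩ := D.curve_disjoint false _ _ _ _
    (D.isEmbedding_incl.injective (h.symm.trans (hyy'.trans h')))
  have hn1 : n ≤ 1 := by
    have : (n : ℝ) ≤ 1 := by linarith [hs.1, hs'.2]
    exact_mod_cast this
  have hn2 : -1 ≤ n := by
    have : (-1 : ℝ) ≤ n := by linarith [hs.2, hs'.1]
    exact_mod_cast this
  -- Two parameters in `[0, 1]` of the same point differ only if they are the two ends.
  obtain rfl | rfl | rfl : n = -1 ∨ n = 0 ∨ n = 1 := by omega
  · obtain rfl : s = 1 := le_antisymm hs.2 (by have := hs'.1; push_cast at this; linarith)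
    simpa using h01
  · simp
  · obtain rfl : s = 0 := le_antisymm (by have := hs'.2; push_cast at this; linarith) hs.1
    simpa using h01.symm

open scoped Classical in
/-- The potential over the discs of the second handlebody. -/
def discWeight (D : HeegaardDiagram M S g) (β : Fin g → Bool) (j : Fin g) (m : M) : D.presented :=
  if h : ∃ r : D3 × ℝ, r ∈ D.overCurve j ∧ D.q true r.1 = m then
    D.pword β j h.choose.1 h.choose.2 * D.pweight β h.choose.1 else 1

theorem discWeight_eq {β : Fin g → Bool} {j : Fin g} {y : D3} {s : ℝ} (h : (y, s) ∈ D.overCurve j) :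
    D.discWeight β j (D.q true y) = D.pword β j y s * D.pweight β y := by
  have H : ∃ r : D3 × ℝ, r ∈ D.overCurve j ∧ D.q true r.1 = D.q true y := ⟨_, h, rfl⟩
  rw [discWeight, dif_pos H]
  exact pword_mul_pweight H.choose_spec.1.1 h.1 H.choose_spec.1.2 h.2 H.choose_spec.2

theorem finite_fiber_curve (D : HeegaardDiagram M S g) (j : Fin g) (m : M) :
    ((fun s : Icc (0 : ℝ) 1 => D.incl (D.curve false j s)) ⁻¹' {m}).Finite := by
  rcases ((fun s : Icc (0 : ℝ) 1 => D.incl (D.curve false j s)) ⁻¹' {m}).eq_empty_or_nonempty with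
    h | ⟨t, ht⟩
  · simp [h]
  have h1 : ((fun n : ℤ => (t : ℝ) + n) '' Icc (-1) 1).Finite := (finite_Icc _ _).image _
  refine (h1.preimage Subtype.val_injective.injOn).subset fun s hs => ?_
  obtain ⟨-, n, hn⟩ := D.curve_disjoint false _ _ _ _
    (D.isEmbedding_incl.injective (Eq.trans ht (Eq.symm hs)))
  refine ⟨n, ⟨?_, ?_⟩, hn.symm⟩
  · have : (-1 : ℝ) ≤ n := by linarith [s.2.1, t.2.2]
    exact_mod_cast this
  · have : (n : ℝ) ≤ 1 := by linarith [s.2.2, t.2.1]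
    exact_mod_cast this

/-- The pairs of points of the two balls over the same point. -/
abbrev Overlap (D : HeegaardDiagram M S g) : Type := {r : D3 × D3 // D.q true r.1 = D.q false r.2}

instance : CompactSpace D.Overlap :=
  isCompact_iff_compactSpace.1 (isClosed_eq ((D.q true).continuous.comp continuous_fst)
    ((D.q false).continuous.comp continuous_snd)).isCompact

theorem exists_outer_overlap (r : D.Overlap) : ∃ x ∈ (D.handle false).outer, r.1.2 = bd x :=
  exists_outer_of_mem_range (mem_range_incl (ε := false) r.2.symm)

/-- The point of the second sphere. -/
def overlapPt (r : D.Overlap) : S2 := ⟨r.1.2, by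
  obtain ⟨x, -, h⟩ := exists_outer_overlap r
  rw [h]
  exact x.2⟩

theorem bd_overlapPt (r : D.Overlap) : bd (overlapPt r) = r.1.2 := rfl

theorem continuous_overlap : Continuous fun r : D.Overlap => r.1 := continuous_subtype_val

theorem continuous_overlapPt : Continuous (overlapPt : D.Overlap → S2) :=
  (continuous_subtype_val.comp (continuous_snd.comp continuous_overlap)).subtype_mk _

/-- The map to the second sphere of the overlap and of the discs of the second handlebody. -/
def sphereMap (D : HeegaardDiagram M S g) : D.Overlap ⊕ (Fin g × Bool × D2) → S2 :=
  Sum.elim overlapPt fun a => (D.handle false).foot a.1 a.2.1 a.2.2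

theorem continuous_sphereMap : Continuous D.sphereMap :=
  continuous_overlapPt.sumElim
    (continuous_prod_of_discrete_left.2 fun _ => continuous_prod_of_discrete_left.2 fun _ =>
      ((D.handle false).foot _ _).continuous)

theorem surjective_sphereMap : Function.Surjective D.sphereMap := by
  intro x
  by_cases hx : x ∈ (D.handle false).outer
  · obtain ⟨y, -, hy⟩ := D.exists_q_eq true (q_mem_range hx)
    exact ⟨Sum.inl ⟨(bd y, bd x), hy⟩, rfl⟩
  · simp only [outer, mem_ofPred_eq, not_forall] at hx
    obtain ⟨j, b, z, h, -⟩ := hx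
    exact ⟨Sum.inr (j, b, z), h⟩

theorem finite_fiber_sphereMap (x : S2) : (D.sphereMap ⁻¹' {x}).Finite := by
  have h1 : (((fun r : D.Overlap => r.1.1) ⁻¹' (D.q true ⁻¹' {D.q false (bd x)})) ∩
      overlapPt ⁻¹' {x}).Finite := by
    refine Set.Finite.of_finite_image (f := fun r : D.Overlap => r.1.1)
      (((D.handle true).finite_fiber (D.q false (bd x))).subset ?_) ?_
    · rintro _ ⟨r, hr, rfl⟩
      exact hr.1
    · rintro r ⟨-, hr⟩ r' ⟨-, hr'⟩ h
      have h2 : r.1.2 = r'.1.2 := by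
        rw [← bd_overlapPt, ← bd_overlapPt, show overlapPt r = x from hr,
          show overlapPt r' = x from hr']
      exact Subtype.ext (Prod.ext h h2)
  have h2 : ((fun a : Fin g × Bool × D2 => (D.handle false).foot a.1 a.2.1 a.2.2) ⁻¹'
      {x}).Finite := (finite_singleton x).preimage (D.handle false).foot_inj.injOn
  refine ((h1.image Sum.inl).union (h2.image Sum.inr)).subset ?_
  rintro (r | a) h
  · refine Or.inl ⟨r, ⟨?_, h⟩, rfl⟩
    have h' : overlapPt r = x := h
    rw [mem_preimage, mem_preimage, mem_singleton_iff, r.2, ← h']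
    rfl
  · exact Or.inr ⟨a, h, rfl⟩

variable {β : Fin g → Bool}

theorem pweight_cocycle (i : Fin g) (b : Bool) (z : D2) :
    D.pweight β ((D.handle true).footPt i b z) *
      (D.pweight β ((D.handle true).footPt i (!b) z))⁻¹ =
      if b = β i then (PresentedGroup.of i)⁻¹ else PresentedGroup.of i := by
  rw [pweight_footPt, pweight_footPt]
  cases b <;> cases β i <;> simp

/-- The potential over the sphere. -/
def sphereWeight (D : HeegaardDiagram M S g) (β : Fin g → Bool) :
    D.Overlap ⊕ (Fin g × Bool × D2) → D.presented :=
  Sum.elim (fun r => D.pweight β r.1.1) fun a =>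
    D.discWeight β a.1 (D.q false ((D.handle false).footPt a.1 a.2.1 a.2.2))

/-- The weight of the disc is word times potential of the first ball, so the quotient is the inverse
of the word, and the word is locally constant over the curve. -/
theorem locConstOn_overlap_disc
    (hβ : ∀ i s, SidesOf (D.curve true i) s (D.sideSet i (β i))) :
    LocConstOn {r : D.Overlap × (Fin g × Bool × D2) |
        overlapPt r.1 = (D.handle false).foot r.2.1 r.2.2.1 r.2.2.2} fun r =>
      D.pweight β r.1.1.1 *
        (D.discWeight β r.2.1 (D.q false ((D.handle false).footPt r.2.1 r.2.2.1 r.2.2.2)))⁻¹ := by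
  have hq : ∀ r : D.Overlap × (Fin g × Bool × D2),
      overlapPt r.1 = (D.handle false).foot r.2.1 r.2.2.1 r.2.2.2 →
      D.q false ((D.handle false).footPt r.2.1 r.2.2.1 r.2.2.2) = D.q true r.1.1.1 := by
    intro r hr
    rw [r.1.2, ← bd_overlapPt, hr]
    rfl
  have key : ∀ r : D.Overlap × (Fin g × Bool × D2),
      overlapPt r.1 = (D.handle false).foot r.2.1 r.2.2.1 r.2.2.2 →
      (∃ s : Icc (0 : ℝ) 1, D.incl (D.curve false r.2.1 s) = D.q true r.1.1.1) ∧
      ∀ s : Icc (0 : ℝ) 1, D.incl (D.curve false r.2.1 s) = D.q true r.1.1.1 →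
        D.pweight β r.1.1.1 * (D.discWeight β r.2.1
          (D.q false ((D.handle false).footPt r.2.1 r.2.2.1 r.2.2.2)))⁻¹ =
          (D.pword β r.2.1 r.1.1.1 s)⁻¹ := by
    intro r hr
    refine ⟨?_, fun s hs => ?_⟩
    · obtain ⟨x, hx, e⟩ := exists_outer_overlap r.1
      have hx' : x = (D.handle false).foot r.2.1 r.2.2.1 r.2.2.2 := by
        rw [← hr]; exact bd_injective (e.symm.trans (bd_overlapPt _).symm)
      obtain ⟨s, hs, h⟩ := D.exists_curve_eq false r.2.1 r.2.2.1
        ((D.handle false).foot_mem_outer.1 (hx' ▸ hx))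
      exact ⟨⟨s, Ico_subset_Icc_self hs⟩, h.trans (hq r hr)⟩
    · rw [hq r hr, discWeight_eq ⟨s.2, hs.symm⟩]
      group
  intro r hr
  obtain ⟨⟨s₀, hs₀⟩, hkey₀⟩ := key r hr
  have hc : Continuous fun s : Icc (0 : ℝ) 1 => D.incl (D.curve false r.2.1 s) :=
    D.isEmbedding_incl.continuous.comp ((D.continuous_curve false r.2.1).comp
      continuous_subtype_val)
  have hy : Continuous fun r : D.Overlap × (Fin g × Bool × D2) => r.1.1.1 :=
    continuous_fst.comp (continuous_overlap.comp continuous_fst)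
  have h1 := hc.isClosedMap.eventually_forall_fiber (D.finite_fiber_curve r.2.1)
    (m := fun r : D.Overlap × (Fin g × Bool × D2) => D.q true r.1.1.1) (a₀ := r)
    ((D.q true).continuous.comp hy).continuousAt
    (p := fun z => (z.2.1.1.1, (z.1 : ℝ)) ∈ D.overCurve r.2.1 →
      D.pword β r.2.1 z.2.1.1.1 z.1 = D.pword β r.2.1 r.1.1.1 s₀) (by
    intro s hs
    have h2 := locConstOn_word hβ r.2.1 (r.1.1.1, (s : ℝ)) ⟨s.2, hs.symm⟩
    have h3 : Continuous fun z : Icc (0 : ℝ) 1 × (D.Overlap × (Fin g × Bool × D2)) =>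
        (z.2.1.1.1, (z.1 : ℝ)) :=
      (hy.comp continuous_snd).prodMk (continuous_subtype_val.comp continuous_fst)
    filter_upwards [h3.continuousAt.eventually h2] with z hz hz'
    have h4 : D.pword β r.2.1 z.2.1.1.1 z.1 = D.pword β r.2.1 r.1.1.1 s :=
      congrArg (PresentedGroup.mk _) (hz hz')
    rw [h4]
    exact inv_injective ((hkey₀ s hs).symm.trans (hkey₀ s₀ hs₀)))
  have h2 : ∀ᶠ r' : D.Overlap × (Fin g × Bool × D2) in 𝓝 r, r'.2.1 = r.2.1 := by
    have : Continuous fun r' : D.Overlap × (Fin g × Bool × D2) => r'.2.1 := by fun_prop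
    exact this.continuousAt.eventually (mem_nhds_discrete.2 rfl : {r.2.1} ∈ 𝓝 r.2.1)
  filter_upwards [h1, h2] with r' h1 h2 hr'
  obtain ⟨⟨s, hs⟩, hkey⟩ := key r' hr'
  rw [hkey s hs, hkey₀ s₀ hs₀]
  rw [h2] at hs ⊢
  rw [h1 s hs ⟨s.2, hs.symm⟩]

theorem sphere_cocycle (hβ : ∀ i s, SidesOf (D.curve true i) s (D.sideSet i (β i))) :
    IsLocConstCocycle D.sphereMap fun a b => D.sphereWeight β a * (D.sphereWeight β b)⁻¹ := by
  refine IsLocConstCocycle.of_sum ?_ (locConstOn_overlap_disc hβ) ?_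
  · refine LocConstOn.comp (φ := fun r : D.Overlap × D.Overlap => (r.1.1.1, r.2.1.1))
      (f := fun r : D3 × D3 => D.pweight β r.1 * (D.pweight β r.2)⁻¹)
      ((D.handle true).locConstOn_foot pweight_cocycle) ?_ ?_
    · exact (continuous_fst.comp (continuous_overlap.comp continuous_fst)).prodMk
        (continuous_fst.comp (continuous_overlap.comp continuous_snd))
    · intro r hr
      have hr' : overlapPt r.1 = overlapPt r.2 := hr
      have : D.q true r.1.1.1 = D.q true r.2.1.1 := by
        rw [r.1.2, r.2.2, ← bd_overlapPt, ← bd_overlapPt, hr']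
      exact this
  · rintro ⟨a, a'⟩ h
    refine Eventually.of_forall fun ⟨b, b'⟩ h' => ?_
    have e : a = a' := (D.handle false).foot_inj h
    have e' : b = b' := (D.handle false).foot_inj h'
    simp [e, e']

end HeegaardDiagram

/-! ### The covering of the manifold with the presented group as fibre -/

namespace HeegaardDiagram

open MeridianSystem

variable {M : Type*} [TopologicalSpace M] [T2Space M] {S : Type*} [TopologicalSpace S]
  [ChartedSpace E2 S] {g : ℕ} {D : HeegaardDiagram M S g} {β : Fin g → Bool}

/-- The two balls glued to the manifold. -/
def ballMap (D : HeegaardDiagram M S g) : D3 ⊕ D3 → M := Sum.elim (D.q true) (D.q false)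

theorem continuous_ballMap : Continuous D.ballMap :=
  (D.q true).continuous.sumElim (D.q false).continuous

theorem surjective_ballMap : Function.Surjective D.ballMap := by
  intro m
  have : m ∈ (D.handle true).handlebody ∪ (D.handle false).handlebody := by
    rw [D.union_eq]; trivial
  rcases this with ⟨y, hy⟩ | ⟨y, hy⟩
  · exact ⟨Sum.inl y, hy⟩
  · exact ⟨Sum.inr y, hy⟩

theorem finite_fiber_ballMap (m : M) : (D.ballMap ⁻¹' {m}).Finite := by
  refine ((((D.handle true).finite_fiber m).image Sum.inl).union
    (((D.handle false).finite_fiber m).image Sum.inr)).subset ?_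
  rintro (y | y) h
  · exact Or.inl ⟨y, h, rfl⟩
  · exact Or.inr ⟨y, h, rfl⟩

/-- Over the second sphere, the weights coming from the first ball and from the discs form a
cocycle, which is the coboundary of a locally constant `κ`. Correcting the weights by `κ` gives a
potential `v` on the sphere: on the overlap its quotient with the first potential is `κ`, and on
each disc `κ` is constant because the disc is connected. -/
theorem exists_ball_cocycle (hβ : ∀ i s, SidesOf (D.curve true i) s (D.sideSet i (β i))) :
    ∃ v : D3 → D.presented, IsLocConstCocycle D.ballMap fun a b =>
      Sum.elim (D.pweight β) v a * (Sum.elim (D.pweight β) v b)⁻¹ := by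
  obtain ⟨κ, hκ, hκτ⟩ := (sphere_cocycle hβ).exists_trivialization continuous_sphereMap
    finite_fiber_sphereMap surjective_sphereMap
  have hwd : ∀ a b, D.sphereMap a = D.sphereMap b →
      (κ a)⁻¹ * D.sphereWeight β a = (κ b)⁻¹ * D.sphereWeight β b := fun a b h => by
    rw [hκτ a b h]; group
  choose A hA using surjective_sphereMap (D := D)
  have hex : ∃ v : D3 → D.presented, ∀ a, v (bd (D.sphereMap a)) = (κ a)⁻¹ * D.sphereWeight β a := by
    classical
    -- The value 1 in the interior is a dummy: an interior point of the second ball is the only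
    -- point of the two balls over its image.
    refine ⟨fun y => if h : ‖(y : E3)‖ = 1 then
      (κ (A ⟨y, by simpa using h⟩))⁻¹ * D.sphereWeight β (A ⟨y, by simpa using h⟩) else 1,
      fun a => ?_⟩
    have h : ‖((bd (D.sphereMap a) : D3) : E3)‖ = 1 := by simp [bd]
    exact (dif_pos h).trans (hwd _ _ (hA _))
  obtain ⟨v, hv⟩ := hex
  refine ⟨v, IsLocConstCocycle.of_sum ((D.handle true).locConstOn_foot pweight_cocycle) ?_ ?_⟩
  · have h1 : ∀ r : D.Overlap, D.pweight β r.1.1 * (v r.1.2)⁻¹ = κ (Sum.inl r) := by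
      intro r
      have := hv (Sum.inl r)
      rw [show bd (D.sphereMap (Sum.inl r)) = r.1.2 from rfl] at this
      rw [this, sphereWeight, Sum.elim_inl]
      group
    intro r hr
    have h2 := hκ (Sum.inl (⟨r, hr⟩ : D.Overlap))
    have h3 := (continuous_inl.continuousAt (x := (⟨r, hr⟩ : D.Overlap))).eventually h2
    have h4 : ∀ᶠ r' : D.Overlap in 𝓝 ⟨r, hr⟩,
        D.pweight β r'.1.1 * (v r'.1.2)⁻¹ = D.pweight β r.1 * (v r.2)⁻¹ := by
      filter_upwards [h3] with r' h
      rw [h1, h, ← h1]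
    rw [nhds_subtype_eq_comap, eventually_comap] at h4
    filter_upwards [h4] with r' h hr'
    exact h ⟨r', hr'⟩ rfl
  · have h1 : ∀ j b z z', κ (Sum.inr (j, b, z)) = κ (Sum.inr (j, b, z')) := by
      intro j b z z'
      have hl : IsLocallyConstant fun z : D2 => κ (Sum.inr (j, b, z)) := by
        rw [IsLocallyConstant.iff_eventually_eq]
        intro z
        have : Continuous fun z : D2 => (Sum.inr (j, b, z) : D.Overlap ⊕ (Fin g × Bool × D2)) := by
          fun_prop
        exact this.continuousAt.eventually (hκ _)
      exact hl.apply_eq_of_preconnectedSpace z z'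
    refine (D.handle false).locConstOn_foot (C := fun j b =>
      (κ (Sum.inr (j, b, origin2)))⁻¹ * κ (Sum.inr (j, !b, origin2))) fun j b z => ?_
    have h2 : ∀ b, v ((D.handle false).footPt j b z) = (κ (Sum.inr (j, b, z)))⁻¹ *
        D.discWeight β j (D.q false ((D.handle false).footPt j b z)) := fun b =>
      hv (Sum.inr (j, b, z))
    rw [h2, h2, h1 j b origin2 z, h1 j (!b) origin2 z,
      show D.q false ((D.handle false).footPt j (!b) z) =
        D.q false ((D.handle false).footPt j b z) from (D.handle false).glue_footPt j b z]
    group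

end HeegaardDiagram

/-! ### Monodromy of the covering and injectivity -/

section

variable {X E : Type*} [TopologicalSpace X] [TopologicalSpace E] {p : E → X}

theorem IsCoveringMap.monodromy_mk (cov : IsCoveringMap p) {K : Type*} [TopologicalSpace K]
    {q : K → X} (hq : Continuous q) {f : K → E} (hf : Continuous f) (hpf : ∀ a, p (f a) = q a)
    {a b : K} (A : Path a b) :
    cov.monodromy (.mk (A.map hq)) ⟨f a, hpf a⟩ = ⟨f b, hpf b⟩ := by
  refine cov.monodromy_eq_of_map_eq (ex := ⟨f a, hpf a⟩) (ey := ⟨f b, hpf b⟩)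
    (.mk (A.map hf)) ?_
  refine congrArg Path.Homotopic.Quotient.mk ?_
  ext t
  exact hpf _

/-- If the lift of `A` from `e` and the lift of `B` from `e'` end at the same point, the lift along
`A` and back along `B` leads from `e` to `e'`. The dual loops have this shape. -/
theorem IsCoveringMap.monodromy_trans_symm (cov : IsCoveringMap p) {c m m' : X} (A : Path c m)
    (B : Path c m') (h : m = m') {e e' : p ⁻¹' {c}}
    (he : (cov.monodromy (.mk A) e).1 = (cov.monodromy (.mk B) e').1) :
    cov.monodromy (.mk (A.trans (B.symm.cast h rfl))) e = e' := by
  subst h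
  have h1 : cov.monodromy (.mk A) e = cov.monodromy (.mk B) e' := Subtype.ext he
  have h2 : B.symm.cast rfl rfl = B.symm := rfl
  rw [h2, Path.Homotopic.Quotient.mk_trans, cov.monodromy_trans_apply, h1,
    ← cov.monodromy_trans_apply, Path.Homotopic.Quotient.mk_symm,
    Path.Homotopic.Quotient.trans_symm, cov.monodromy_refl, id]

end

namespace HeegaardDiagram

open MeridianSystem

variable {M : Type*} [TopologicalSpace M] [T2Space M] {S : Type*} [TopologicalSpace S]
  [ChartedSpace E2 S] {g : ℕ} {D : HeegaardDiagram M S g} {β : Fin g → Bool}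

/-- The monodromy of the covering on the fibre over the centre turns the image of `x` into left
multiplication by `x`, which determines `x`. -/
theorem injective_presentedHom (hM : SemilocSimplyConn M)
    (hβ : ∀ i s, SidesOf (D.curve true i) s (D.sideSet i (β i))) :
    Function.Injective (presentedHom hM hβ) := by
  obtain ⟨v, hv⟩ := exists_ball_cocycle hβ
  obtain ⟨E, _, p, mk, cov, hmk, hp, hmk_eq, -⟩ := hv.exists_isCoveringMap continuous_ballMap
    continuous_ballMap.isClosedMap finite_fiber_ballMap surjective_ballMap
  let e : D.presented → p ⁻¹' {(D.handle true).center} := fun k =>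
    ⟨mk (Sum.inl origin3) k, hp _ _⟩
  let N : Subgroup D.presented :=
    { carrier := {x | ∀ k, cov.monodromyPerm _ (presentedHom hM hβ x) (e k) = e (x * k)}
      mul_mem' := fun {x y} hx hy k => by
        rw [map_mul, map_mul, Equiv.Perm.mul_apply, hy, hx, mul_assoc]
      one_mem' := fun k => by
        rw [map_one, map_one, one_mul]; rfl
      inv_mem' := fun {x} hx k => by
        rw [map_inv, map_inv, Equiv.Perm.inv_eq_iff_eq, hx, mul_inv_cancel_left] }
  have hgen : ∀ i, PresentedGroup.of i ∈ N := by
    intro i k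
    rw [presentedHom_of]
    have hpath : ∀ b k, cov.monodromy (.mk ((radius ((D.handle true).foot i b origin2)).map
        (D.handle true).glue.continuous)) (e k) =
        ⟨mk (Sum.inl ((D.handle true).footPt i b origin2)) k, hp _ _⟩ := fun b k =>
      cov.monodromy_mk (D.handle true).glue.continuous (f := fun y => mk (Sum.inl y) k)
        ((hmk k).comp continuous_inl) (fun y => hp _ _) (radius ((D.handle true).foot i b origin2))
    refine cov.monodromy_trans_symm _ _ _ ?_
    rw [hpath, hpath, hmk_eq]
    -- The sheet is constant along both radii. At the crossing the cocycle from the copy `β i` to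
    -- the other one is the inverse generator, so the sheet `k` is continued by the sheet
    -- `PresentedGroup.of i * k`.
    refine ⟨(D.handle true).glue_foot i (β i) origin2, ?_⟩
    simp only [Sum.elim_inl]
    rw [pweight_cocycle, if_pos rfl, inv_mul_cancel_left]
  have htop : N = ⊤ := by
    rw [eq_top_iff, ← PresentedGroup.closure_range_of, Subgroup.closure_le]
    rintro _ ⟨i, rfl⟩
    exact hgen i
  rw [injective_iff_map_eq_one]
  intro x hx
  have h1 : x ∈ N := htop ▸ Subgroup.mem_top x
  have h2 := h1 1
  rw [hx, map_one, Equiv.Perm.one_apply, mul_one] at h2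
  have h3 := ((hmk_eq _ _ _ _).1 (congrArg Subtype.val h2)).2
  simpa using h3.symm

end HeegaardDiagram

/-! ### The dual loops generate the fundamental group -/

namespace PathsFrom

variable {M : Type*} [TopologicalSpace M] {c : M}

theorem IsHorizontal.sumElim {A B : Type*} [TopologicalSpace A] [TopologicalSpace B]
    {l : A → PathsFrom c} {l' : B → PathsFrom c} (hl : IsHorizontal l) (hl' : IsHorizontal l') :
    IsHorizontal (Sum.elim l l') := by
  rintro (a | b) V hV
  · rw [nhds_inl, eventually_map]
    exact hl a V hV
  · rw [nhds_inr, eventually_map]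
    exact hl' b V hV

theorem mem_of_eq_act {N : Subgroup (FundamentalGroup M c)} {x y : PathsFrom c}
    {γ : FundamentalGroup M c} (h : y = x.act γ) (h' : ∃ n ∈ N, y = x.act n) : γ ∈ N := by
  obtain ⟨n, hn, e⟩ := h'
  exact x.act_injective (h.symm.trans e) ▸ hn

theorem exists_act_trans {N : Subgroup (FundamentalGroup M c)} {x y z : PathsFrom c}
    (h : ∃ n ∈ N, y = x.act n) (h' : ∃ n ∈ N, z = y.act n) : ∃ n ∈ N, z = x.act n := by
  obtain ⟨n, hn, rfl⟩ := h
  obtain ⟨n', hn', rfl⟩ := h'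
  exact ⟨n * n', N.mul_mem hn hn', (x.act_mul n n').symm⟩

theorem exists_act_symm {N : Subgroup (FundamentalGroup M c)} {x y : PathsFrom c}
    (h : ∃ n ∈ N, y = x.act n) : ∃ n ∈ N, x = y.act n := by
  obtain ⟨n, hn, rfl⟩ := h
  exact ⟨n⁻¹, N.inv_mem hn, by rw [← act_mul, mul_inv_cancel, act_one]⟩

/-- Two horizontal families that agree up to a subgroup at one point do so everywhere. -/
theorem IsHorizontal.forall_exists_act (hM : SemilocSimplyConn M)
    {N : Subgroup (FundamentalGroup M c)} {K A : Type*} [TopologicalSpace K] [TopologicalSpace A]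
    [PreconnectedSpace A] {l : K → PathsFrom c} (hl : IsHorizontal l) {l' : A → PathsFrom c}
    (hl' : IsHorizontal l') (hcl : IsClosedMap fun a => (l a).1)
    (hfin : ∀ m, ((fun a => (l a).1) ⁻¹' {m}).Finite)
    (hsim : ∀ a b, (l a).1 = (l b).1 → ∃ n ∈ N, l b = (l a).act n)
    (hc : Continuous fun t => (l' t).1) (hs : ∀ t, ∃ a, (l a).1 = (l' t).1) {a₀ : K} {t₀ : A}
    (h₀ : ∃ n ∈ N, l' t₀ = (l a₀).act n) (a : K) (t : A) (h : (l a).1 = (l' t).1) :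
    ∃ n ∈ N, l' t = (l a).act n := by
  -- By `hsim` it is enough to test one point of each fibre. The difference between the families is
  -- locally constant, so membership in `N` is a locally constant proposition on a connected space.
  let G : A → Prop := fun t => ∀ a, (l a).1 = (l' t).1 → ∃ n ∈ N, l' t = (l a).act n
  have hG : ∀ t a, (l a).1 = (l' t).1 → (∃ n ∈ N, l' t = (l a).act n) → G t :=
    fun t a h h' b hb => exists_act_trans (hsim b a (hb.trans h.symm)) h'
  have hloc : IsLocallyConstant G := by
    rw [IsLocallyConstant.iff_eventually_eq]
    intro t
    have h1 := hcl.eventually_forall_fiber hfin hc.continuousAt (a₀ := t) (p := fun z =>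
      (l z.1).1 = (l' z.2).1 → ((∃ n ∈ N, l' z.2 = (l z.1).act n) ↔ G t)) (by
      intro a ha
      obtain ⟨γ, hγ⟩ := exists_act ha
      filter_upwards [hl.eventually_eq_act hM hl' hγ] with z hz hz'
      have h2 := hz hz'
      constructor
      · intro h3
        exact hG t a ha ⟨γ, mem_of_eq_act h2 h3, hγ⟩
      · intro h3
        exact ⟨γ, mem_of_eq_act hγ (h3 a ha), h2⟩)
    filter_upwards [h1] with t' ht'
    obtain ⟨a, ha⟩ := hs t'
    exact propext ⟨fun h => (ht' a ha ha).1 (h a ha), fun h => hG t' a ha ((ht' a ha ha).2 h)⟩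
  have hG₀ : G t₀ := by
    obtain ⟨n, hn, e⟩ := h₀
    exact hG t₀ a₀ (by rw [e]; rfl) ⟨n, hn, e⟩
  rw [hloc.apply_eq_of_preconnectedSpace t₀ t] at hG₀
  exact hG₀ a h

end PathsFrom

namespace MeridianSystem

variable {M : Type*} [TopologicalSpace M] {g : ℕ} (H : MeridianSystem M g)

theorem outer_nonempty : H.outer.Nonempty := by
  by_cases h : Nonempty (Fin g)
  · obtain ⟨i⟩ := h
    obtain ⟨z, hz⟩ := rim_nonempty
    exact ⟨H.foot i true z, H.foot_mem_outer.2 hz⟩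
  · obtain ⟨v, hv⟩ := (NormedSpace.sphere_nonempty (x := (0 : E3)) (r := 1)).2 zero_le_one
    exact ⟨⟨v, hv⟩, fun i => absurd ⟨i⟩ h⟩

end MeridianSystem

namespace HeegaardDiagram

open MeridianSystem

variable {M : Type*} [TopologicalSpace M] [T2Space M] {S : Type*} [TopologicalSpace S]
  [ChartedSpace E2 S] {g : ℕ} {D : HeegaardDiagram M S g} {β : Fin g → Bool}

theorem radial_sim (hM : SemilocSimplyConn M)
    (hβ : ∀ i s, SidesOf (D.curve true i) s (D.sideSet i (β i))) (y y' : D3)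
    (h : D.q true y = D.q true y') : ∃ n ∈ (presentedHom hM hβ).range,
      (D.handle true).radial y' = ((D.handle true).radial y).act n := by
  rcases glue_eq h with rfl | ⟨i, b, z, rfl, rfl⟩
  · exact ⟨1, one_mem _, (PathsFrom.act_one _).symm⟩
  · have h1 : ∃ n ∈ (presentedHom hM hβ).range,
        (D.handle true).radial ((D.handle true).footPt i (β i) z) =
          ((D.handle true).radial ((D.handle true).footPt i (!β i) z)).act n :=
      ⟨_, ⟨PresentedGroup.of i, presentedHom_of hM hβ i⟩, radial_footPt _ hM i (β i) z⟩
    rcases Bool.eq_or_eq_not b (β i) with rfl | rfl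
    · exact PathsFrom.exists_act_symm h1
    · rw [Bool.not_not]; exact h1

/-- The classes of the paths to the points of the balls that are continued over the two balls. -/
theorem exists_ball_lift (hM : SemilocSimplyConn M)
    (hβ : ∀ i s, SidesOf (D.curve true i) s (D.sideSet i (β i))) :
    ∃ l : D3 ⊕ D3 → PathsFrom (D.handle true).center, PathsFrom.IsHorizontal l ∧
      (∀ a, (l a).1 = D.ballMap a) ∧
      l (Sum.inl origin3) = ⟨_, Path.Homotopic.Quotient.refl (D.handle true).center⟩ ∧
      ∀ a b, D.ballMap a = D.ballMap b →
        ∃ n ∈ (presentedHom hM hβ).range, l b = (l a).act n := by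
  obtain ⟨x₀, hx₀⟩ := (D.handle false).outer_nonempty
  obtain ⟨y₀, -, hy₀⟩ := D.exists_q_eq true (q_mem_range hx₀)
  -- The family on the second ball starts with the radial class of the first ball at one common
  -- point of the surface.
  let l' : D3 → PathsFrom (D.handle true).center := PathsFrom.transport (D.q false) (bd x₀)
    (Path.Homotopic.Quotient.cast ((D.handle true).radial (bd y₀)).2 rfl hy₀.symm)
  have hl' : PathsFrom.IsHorizontal l' := PathsFrom.isHorizontal_transport _ _ _
  have h₀ : l' (bd x₀) = (D.handle true).radial (bd y₀) := by
    refine (PathsFrom.transport_self _ _ _).trans ?_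
    have key : ∀ {m m' : M} (u : Path.Homotopic.Quotient (D.handle true).center m) (h : m' = m),
        (⟨m', u.cast rfl h⟩ : PathsFrom (D.handle true).center) = ⟨m, u⟩ := by
      rintro m m' u rfl; simp
    exact key _ hy₀.symm
  have hpre : PreconnectedSpace (D.handle false).outer :=
    Subtype.preconnectedSpace (D.isPreconnected_outer false)
  have hcont : Continuous fun x : (D.handle false).outer => bd x.1 :=
    continuous_bd.comp continuous_subtype_val
  -- The two families agree at the common point, hence up to the subgroup over the whole surface,
  -- whose preimage in the second sphere is connected.
  have hmix : ∀ y x, D.q true y = D.q false x →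
      ∃ n ∈ (presentedHom hM hβ).range, l' x = ((D.handle true).radial y).act n := by
    intro y x h
    obtain ⟨x, hx, rfl⟩ := exists_outer_of_mem_range (mem_range_incl (ε := false) h.symm)
    exact (D.handle true).isHorizontal_radial.forall_exists_act hM (hl'.comp hcont)
      (D.handle true).isClosedMap_glue (D.handle true).finite_fiber (radial_sim hM hβ)
      ((D.q false).continuous.comp hcont) (fun t => by
        obtain ⟨y, -, hy⟩ := D.exists_q_eq true (q_mem_range t.2)
        exact ⟨_, hy⟩) (a₀ := bd y₀) (t₀ := ⟨x₀, hx₀⟩)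
      ⟨1, one_mem _, h₀.trans (PathsFrom.act_one _).symm⟩ y ⟨x, hx⟩ h
  -- Over a disc of the second family the two copies differ by a constant loop class. At a point of
  -- the rim both can be compared with the first ball, so this class lies in the subgroup.
  have hminus : ∀ x x', D.q false x = D.q false x' →
      ∃ n ∈ (presentedHom hM hβ).range, l' x' = (l' x).act n := by
    intro x x' h
    rcases glue_eq h with rfl | ⟨j, b, z, rfl, rfl⟩
    · exact ⟨1, one_mem _, (PathsFrom.act_one _).symm⟩
    · obtain ⟨w, hw⟩ := rim_nonempty
      obtain ⟨γ, hγ⟩ := PathsFrom.exists_act (x := l' ((D.handle false).footPt j b w))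
        (y := l' ((D.handle false).footPt j (!b) w)) ((D.handle false).glue_footPt j b w).symm
      obtain ⟨y, -, hy⟩ := D.exists_q_eq true (q_mem_range ((D.handle false).foot_mem_outer.2 hw :
        (D.handle false).foot j b w ∈ (D.handle false).outer))
      refine ⟨γ, PathsFrom.mem_of_eq_act hγ (PathsFrom.exists_act_trans
        (PathsFrom.exists_act_symm (hmix (bd y) ((D.handle false).footPt j b w) hy))
        (hmix (bd y) ((D.handle false).footPt j (!b) w)
          (hy.trans ((D.handle false).glue_footPt j b w).symm))), ?_⟩
      exact PathsFrom.IsHorizontal.exists_eq_act hM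
        (l := l' ∘ (D.handle false).footPt j b) (l' := l' ∘ (D.handle false).footPt j (!b))
        (hl'.comp ((D.handle false).continuous_footPt j _))
        (hl'.comp ((D.handle false).continuous_footPt j _))
        (fun a => ((D.handle false).glue_footPt j b a).symm) w hγ z
  refine ⟨Sum.elim (D.handle true).radial l', (D.handle true).isHorizontal_radial.sumElim hl', ?_,
    (D.handle true).radial_origin, ?_⟩
  · rintro (y | x) <;> rfl
  · rintro (y | x) (y' | x') h
    · exact radial_sim hM hβ _ _ h
    · exact hmix _ _ h
    · exact PathsFrom.exists_act_symm (hmix _ _ (Eq.symm h))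
    · exact hminus _ _ h

/-- Path classes continued along a given loop stay equal, up to the image, to the family on the two
balls. At the end of the loop they differ from the initial class of that family exactly by the class
of the loop. -/
theorem surjective_presentedHom (hM : SemilocSimplyConn M)
    (hβ : ∀ i s, SidesOf (D.curve true i) s (D.sideSet i (β i))) :
    Function.Surjective (presentedHom hM hβ) := by
  obtain ⟨l, hl, hl1, hl0, hsim⟩ := exists_ball_lift hM hβ
  have hfun : (fun a => (l a).1) = D.ballMap := funext hl1
  intro γ
  induction γ using Quotient.inductionOn with | h γ => ?_
  let f : C(unitInterval, M) := γ.toContinuousMap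
  let T : unitInterval → PathsFrom (D.handle true).center :=
    PathsFrom.transport f 0 ((Path.Homotopic.Quotient.refl _).cast rfl γ.source)
  have hT0 : T 0 = l (Sum.inl origin3) := by
    refine (PathsFrom.transport_self _ _ _).trans ?_
    rw [hl0]
    have key : ∀ {m m' : M} (u : Path.Homotopic.Quotient (D.handle true).center m) (h : m' = m),
        (⟨m', u.cast rfl h⟩ : PathsFrom (D.handle true).center) = ⟨m, u⟩ := by
      rintro m m' u rfl; simp
    exact key _ γ.source
  have hT1 : T 1 = (l (Sum.inl origin3)).act (FundamentalGroup.fromPath (.mk γ)) := by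
    refine (PathsFrom.transport_path f γ.source γ.target).trans ?_
    rw [hl0]
    exact congrArg (Sigma.mk _) (Path.Homotopic.Quotient.trans_refl _).symm
  have hT : PathsFrom.IsHorizontal T := PathsFrom.isHorizontal_transport _ _ _
  have h := hl.forall_exists_act hM hT
    (by rw [hfun]; exact continuous_ballMap.isClosedMap)
    (fun m => by rw [hfun]; exact finite_fiber_ballMap m)
    (fun a b h => hsim a b (by rw [← hl1, ← hl1, h])) f.continuous
    (fun t => by
      obtain ⟨a, ha⟩ := surjective_ballMap (D := D) (f t)
      exact ⟨a, (hl1 a).trans ha⟩)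
    ⟨1, one_mem _, hT0.trans (PathsFrom.act_one _).symm⟩ (Sum.inl origin3) 1 (congrArg Sigma.fst hT1).symm
  exact PathsFrom.mem_of_eq_act hT1 h

/-- Every point comes from one of the balls, where the family above already provides a class of
paths from the centre. -/
theorem exists_path (hM : SemilocSimplyConn M)
    (hβ : ∀ i s, SidesOf (D.curve true i) s (D.sideSet i (β i))) (x : M) :
    Nonempty (Path x (D.handle true).center) := by
  obtain ⟨l, -, hl1, -, -⟩ := exists_ball_lift hM hβ
  obtain ⟨a, rfl⟩ := surjective_ballMap (D := D) x
  obtain ⟨p, -⟩ := Quotient.exists_rep (l a).2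
  rw [← hl1]
  exact ⟨p.symm⟩

end HeegaardDiagram

end

theorem mainTheorem7
    {M : Type*} [TopologicalSpace M] [T2Space M] [CompactSpace M] [ChartedSpace E3 M]
    {S : Type*} [TopologicalSpace S] [ChartedSpace E2 S] [IsManifold (𝓡 2) ∞ S]
    (hS : IsOrientedAtlas S) {g : ℕ} (D : HeegaardDiagram M S g)
    (hconn : D.gauss.IsConnected) (hgenus : (g : ℚ) = D.gauss.surfaceGenus) (x : M) :
    ∃ (p : Path x (D.handle true).center)
      (φ : PresentedGroup (Set.range D.gauss.relator) ≃* FundamentalGroup M x),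
      ∀ i : Fin g, ∃ b : Bool, φ (PresentedGroup.of i) =
        FundamentalGroup.fromPath ⟦(p.trans ((D.handle true).dualLoop i b)).trans p.symm⟧ := by
  have hM : SemilocSimplyConn M := semilocSimplyConn_of_chartedSpace E3 M
  obtain ⟨β, hβ⟩ := D.exists_side hS
  obtain ⟨p⟩ := HeegaardDiagram.exists_path hM hβ x
  have hbij : Function.Bijective (HeegaardDiagram.presentedHom hM hβ) :=
    ⟨HeegaardDiagram.injective_presentedHom hM hβ, HeegaardDiagram.surjective_presentedHom hM hβ⟩
  -- The isomorphism at the centre of the first ball is moved to the base point `x` along `p`, the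
  -- same path for all generators.
  refine ⟨p, (MulEquiv.ofBijective _ hbij).trans
    (FundamentalGroup.fundamentalGroupMulEquivOfPath p).symm, fun i => ⟨β i, ?_⟩⟩
  rw [MulEquiv.trans_apply, MulEquiv.ofBijective_apply, HeegaardDiagram.presentedHom_of]
  exact (Path.Homotopic.Quotient.trans_assoc (.mk p)
    (.mk ((D.handle true).dualLoop i (β i))) (.mk p.symm)).symm
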